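/- **Setting.** Let $V=\mathbb{R}^{2N}$, $N=N_A+N_B$, be a phase space with linear coordinates $\xi^a$ and Poisson brackets $\{\xi^a,\xi^b\}=\Omega^{ab}$, where $\Omega$ is antisymmetric and invertible; put $\omega=\Omega^{-1}$. A decomposition into complementary subsystems $A$, $B$ with $N_A$, $N_B$ degrees of freedom is given by Darboux bases $\mathcal{D}_A=(\theta^1,\dots,\theta^{2N_A})$ and $\mathcal{D}_B=(\Theta^1,\dots,\Theta^{2N_B})$ of linear observables ($\{q_i,q_j\}=\{p_i,p_j\}=0$, $\{q_i,p_j\}=\delta_{ij}$ within each, and zero brackets between $\mathcal{D}_A$ and $\mathcal{D}_B$); let $\vartheta_r$ (in $A$) be the vectors of the dual basis of $V$ belonging to $\mathcal{D}_A$. The Hilbert space is $\mathcal{H}=\mathcal{H}_A\otimes\mathcal{H}_B$, where $\mathcal{H}_A$ and $\mathcal{H}_B$ are the Fock representations of the canonical commutation relations for $\mathcal{D}_A$ and $\mathcal{D}_B$; $\hat\xi^a$ are the resulting operators, so $[\hat\xi^a,\hat\xi^b]=\mathrm{i}\,\Omega^{ab}$. Let $J$ be a compatible complex structure: $J^2=-1$,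 $J\Omega J^{\mathsf T}=\Omega$, and $\omega J$ is symmetric and positive definite. Let $\zeta\in\mathbb{R}^{2N}$, and let $\psi=|J,\zeta\rangle\in\mathcal{H}$ be a Gaussian state, i.e. a unit vector with $\big[(\hat\xi^b-\zeta^b)+\mathrm{i}J^b{}_a(\hat\xi^a-\zeta^a)\big]\psi=0$ for all $b$. Let $\rho_A=\mathrm{Tr}_{\mathcal{H}_B}|\psi\rangle\langle\psi|$ and $$S_A=-\mathrm{Tr}(\rho_A\log\rho_A),\qquad R_A=-\log\mathrm{Tr}(\rho_A^2)$$ (entanglement entropy and Rényi entropy of order 2). Let $G^{ab}=-J^a{}_c\Omega^{cb}$, let $[\mathrm{i}J]_A=(\mathrm{i}\,\theta^r_aJ^a{}_b\vartheta^b_s)_{rs}$, and let $\mathrm{Vol}_G(\mathcal{V}_A)=\sqrt{\det(\theta^r_aG^{ab}\theta^s_b)_{rs}}$ be the volume, measured with $G$, of the symplectic cube $\mathcal{V}_A=\{\sum_r c_r\theta^r\mid 0\le c_r\le1\}$. **Claim.** The operators $\rho_A\log\rho_A$ and $\rho_A^2$ have well-defined (finite, real) traces, $\mathrm{Tr}(\rho_A^2)>0$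 and $\mathrm{Vol}_G(\mathcal{V}_A)>0$. Moreover $$R_A\le S_A,\qquad S_A<R_A+(1-\log 2)\,\min(N_A,N_B)\quad\text{if }N_A,N_B\ge1,$$ $$R_A=\log\mathrm{Vol}_G(\mathcal{V}_A)=\tfrac12\log\big|\det[\mathrm{i}J]_A\big| .$$ In addition, the function $S(\nu)=\frac{\nu+1}{2}\log\frac{\nu+1}{2}-\frac{\nu-1}{2}\log\frac{\nu-1}{2}$ (with $0\log 0=0$) satisfies $$0\le S(\nu)-\log\nu<1-\log 2\qquad\text{for all real }\nu\ge1 .$$ -/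

import Mathlib

open scoped Matrix ComplexConjugate InnerProductSpace

noncomputable section

namespace GaussianEntropy

/-! ## Classical phase space -/

/-- The matrix of the Poisson brackets of a Darboux basis `(q₁,…,qₙ,p₁,…,pₙ)`:
`{qᵢ,qⱼ} = {pᵢ,pⱼ} = 0`, `{qᵢ,pⱼ} = δᵢⱼ`. -/
def stdOmega (n : ℕ) : Matrix (Fin n ⊕ Fin n) (Fin n ⊕ Fin n) ℝ :=
  Matrix.fromBlocks 0 1 (-1) 0

/-- `Ω^{ab}` is a symplectic structure: antisymmetric and nondegenerate. -/
def IsSymplecticForm {d : ℕ} (Ω : Matrix (Fin d) (Fin d) ℝ) : Prop :=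
  Ωᵀ = -Ω ∧ IsUnit Ω.det

/-- A decomposition of the phase space `ℝ^{2(NA+NB)}` into two complementary symplectic subsystems
`A` and `B`, given by a Darboux basis `(D_A, D_B)` of linear observables.
The rows of `θA`, `θB` are the observables of `D_A`, `D_B` (covectors), and the columns of
`vA`, `vB` form the dual basis of the phase space, adapted to `V = A ⊕ B`. -/
structure Subsystems (NA NB : ℕ)
    (Ω : Matrix (Fin (2 * (NA + NB))) (Fin (2 * (NA + NB))) ℝ) where
  θA : Matrix (Fin NA ⊕ Fin NA) (Fin (2 * (NA + NB))) ℝ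
  θB : Matrix (Fin NB ⊕ Fin NB) (Fin (2 * (NA + NB))) ℝ
  bracketAA : θA * Ω * θAᵀ = stdOmega NA
  bracketBB : θB * Ω * θBᵀ = stdOmega NB
  bracketAB : θA * Ω * θBᵀ = 0
  vA : Matrix (Fin (2 * (NA + NB))) (Fin NA ⊕ Fin NA) ℝ
  vB : Matrix (Fin (2 * (NA + NB))) (Fin NB ⊕ Fin NB) ℝ
  dualAA : θA * vA = 1
  dualAB : θA * vB = 0
  dualBA : θB * vA = 0
  dualBB : θB * vB = 1

/-- Compatible complex structure: `J² = -1`, `J` is symplectic, and `g = ω J` with `ω = Ω⁻¹` is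
symmetric and positive definite. -/
def IsCompatibleComplexStructure {d : ℕ} (Ω J : Matrix (Fin d) (Fin d) ℝ) : Prop :=
  J * J = -1 ∧ J * Ω * Jᵀ = Ω ∧ (Ω⁻¹ * J).PosDef

/-- The metric `G^{ab} = - J^a_c Ω^{cb}` on linear observables (covariance matrix of the state),
the inverse of `g = ω J`. -/
def metricG {d : ℕ} (Ω J : Matrix (Fin d) (Fin d) ℝ) : Matrix (Fin d) (Fin d) ℝ :=
  -(J * Ω)

variable {NA NB : ℕ} {Ω : Matrix (Fin (2 * (NA + NB))) (Fin (2 * (NA + NB))) ℝ}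

/-- The restriction `[J]_A = (θ^r_a J^a_b ϑ^b_s)`. -/
def restrictJ (F : Subsystems NA NB Ω)
    (J : Matrix (Fin (2 * (NA + NB))) (Fin (2 * (NA + NB))) ℝ) :
    Matrix (Fin NA ⊕ Fin NA) (Fin NA ⊕ Fin NA) ℝ :=
  F.θA * J * F.vA

/-- The restriction `[iJ]_A = i [J]_A`, a complex matrix. -/
def restrictIJ (F : Subsystems NA NB Ω)
    (J : Matrix (Fin (2 * (NA + NB))) (Fin (2 * (NA + NB))) ℝ) :
    Matrix (Fin NA ⊕ Fin NA) (Fin NA ⊕ Fin NA) ℂ :=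
  Complex.I • (restrictJ F J).map (fun x : ℝ => (x : ℂ))

/-- The volume with respect to `G` of the symplectic cube
`{∑ c_r θ^r | 0 ≤ c_r ≤ 1}` spanned by the Darboux basis of `A`: the square root of the
determinant of the Gram matrix `(θ^r_a G^{ab} θ^s_b)`. -/
def cubeVolume (F : Subsystems NA NB Ω)
    (G : Matrix (Fin (2 * (NA + NB))) (Fin (2 * (NA + NB))) ℝ) : ℝ :=
  Real.sqrt (F.θA * G * F.θAᵀ).det

/-! ## Fock representation

An amplitude `f : (Fin n → ℕ) → ℂ` stands for `∑ f(k) |k₁,…,kₙ⟩`. Ladder operators and their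
linear combinations act on arbitrary amplitudes, so that no domain has to be fixed; states are the
square-summable amplitudes. -/

/-- The Fock space of `n` bosonic modes, with orthonormal Fock basis `|k₁,…,kₙ⟩`. -/
abbrev FockSpace (n : ℕ) : Type := lp (fun _ : Fin n → ℕ => ℂ) 2

/-- The Hilbert space `H = H_A ⊗ H_B`, with orthonormal basis `|k⟩ ⊗ |l⟩`. -/
abbrev BipartiteFockSpace (NA NB : ℕ) : Type :=
  lp (fun _ : (Fin NA → ℕ) × (Fin NB → ℕ) => ℂ) 2

/-- Annihilation operator: `aᵢ |k⟩ = √kᵢ |k - eᵢ⟩`, in terms of amplitudes. -/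
def annihilate {n : ℕ} (i : Fin n) : Module.End ℂ ((Fin n → ℕ) → ℂ) where
  toFun f := fun k => (Real.sqrt ((k i : ℝ) + 1) : ℂ) * f (Function.update k i (k i + 1))
  map_add' f g := by funext k; simp [mul_add]
  map_smul' c f := by funext k; simp [mul_left_comm]

/-- Creation operator: `aᵢ† |k⟩ = √(kᵢ+1) |k + eᵢ⟩`, in terms of amplitudes
(the coefficient vanishes where `kᵢ = 0`). -/
def create {n : ℕ} (i : Fin n) : Module.End ℂ ((Fin n → ℕ) → ℂ) where
  toFun f := fun k => (Real.sqrt (k i : ℝ) : ℂ) * f (Function.update k i (k i - 1))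
  map_add' f g := by funext k; simp [mul_add]
  map_smul' c f := by funext k; simp [mul_left_comm]

/-- The canonical observables `qᵢ = (aᵢ + aᵢ†)/√2` and `pᵢ = (aᵢ - aᵢ†)/(i√2)`. -/
def canonicalObservable {n : ℕ} : Fin n ⊕ Fin n → Module.End ℂ ((Fin n → ℕ) → ℂ)
  | Sum.inl i => (1 / (Real.sqrt 2 : ℂ)) • (annihilate i + create i)
  | Sum.inr i => (1 / (Complex.I * (Real.sqrt 2 : ℂ))) • (annihilate i - create i)

/-- `O ⊗ 1` on amplitudes of the composite system. -/
def onA {NA NB : ℕ} (O : Module.End ℂ ((Fin NA → ℕ) → ℂ)) :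
    Module.End ℂ ((Fin NA → ℕ) × (Fin NB → ℕ) → ℂ) where
  toFun f := fun x => O (fun k => f (k, x.2)) x.1
  map_add' f g := by
    funext x
    exact congrFun (O.map_add (fun k => f (k, x.2)) (fun k => g (k, x.2))) x.1
  map_smul' c f := by
    funext x
    exact congrFun (O.map_smul c (fun k => f (k, x.2))) x.1

/-- `1 ⊗ O` on amplitudes of the composite system. -/
def onB {NA NB : ℕ} (O : Module.End ℂ ((Fin NB → ℕ) → ℂ)) :
    Module.End ℂ ((Fin NA → ℕ) × (Fin NB → ℕ) → ℂ) where
  toFun f := fun x => O (fun l => f (x.1, l)) x.2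
  map_add' f g := by
    funext x
    exact congrFun (O.map_add (fun l => f (x.1, l)) (fun l => g (x.1, l))) x.2
  map_smul' c f := by
    funext x
    exact congrFun (O.map_smul c (fun l => f (x.1, l))) x.2

/-- The quantized linear observable `ξ̂^a = ∑_r ϑ^a_r θ̂^r`, where the observables `θ̂^r` of the
Darboux bases of `A` and of `B` are represented on the two tensor factors. -/
def xiHat (F : Subsystems NA NB Ω) (a : Fin (2 * (NA + NB))) :
    Module.End ℂ ((Fin NA → ℕ) × (Fin NB → ℕ) → ℂ) :=
  ∑ r, (F.vA a r : ℂ) • onA (canonicalObservable r) +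
    ∑ s, (F.vB a s : ℂ) • onB (canonicalObservable s)

/-- The operator `a^b_{Jζ} = ((ξ̂^b - ζ^b) + i J^b_a (ξ̂^a - ζ^a)) / √2`. -/
def gaussianAnnihilator (F : Subsystems NA NB Ω)
    (J : Matrix (Fin (2 * (NA + NB))) (Fin (2 * (NA + NB))) ℝ)
    (ζ : Fin (2 * (NA + NB)) → ℝ) (b : Fin (2 * (NA + NB))) :
    Module.End ℂ ((Fin NA → ℕ) × (Fin NB → ℕ) → ℂ) :=
  (1 / (Real.sqrt 2 : ℂ)) • ((xiHat F b - (ζ b : ℂ) • 1) +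
    Complex.I • ∑ a, (J b a : ℂ) • (xiHat F a - (ζ a : ℂ) • 1))

/-- `ψ` is (a representative of) the Gaussian state `|J,ζ⟩`: a unit vector annihilated by all the
operators `a^b_{Jζ}`. -/
def IsGaussianState (F : Subsystems NA NB Ω)
    (J : Matrix (Fin (2 * (NA + NB))) (Fin (2 * (NA + NB))) ℝ)
    (ζ : Fin (2 * (NA + NB)) → ℝ) (ψ : BipartiteFockSpace NA NB) : Prop :=
  ‖ψ‖ = 1 ∧ ∀ b, gaussianAnnihilator F J ζ b (ψ : (Fin NA → ℕ) × (Fin NB → ℕ) → ℂ) = 0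

/-! ## Reduced state and entropies -/

/-- The partial scalar product `⟨l|_B ψ ∈ H_A`, with amplitudes `k ↦ ψ(k,l)`. -/
def slice (ψ : BipartiteFockSpace NA NB) (l : Fin NB → ℕ) : FockSpace NA :=
  ⟨fun k => ψ (k, l), by
    have h := (lp.memℓp ψ).summable (by norm_num)
    refine memℓp_gen ?_
    exact h.comp_injective (i := fun k : Fin NA → ℕ => (k, l)) (fun a b hab => by simpa using hab)⟩

/-- The reduced density operator `ρ_A = Tr_{H_B} |ψ⟩⟨ψ| = ∑_l ⟨l|_B |ψ⟩⟨ψ| |l⟩_B`. -/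
def reducedDensity (ψ : BipartiteFockSpace NA NB) : FockSpace NA →L[ℂ] FockSpace NA :=
  ∑' l : Fin NB → ℕ, InnerProductSpace.rankOne ℂ (slice ψ l) (slice ψ l)

/-- The series that defines the reduced density operator converges in operator norm. -/
theorem summable_reducedDensity (ψ : BipartiteFockSpace NA NB) :
    Summable fun l : Fin NB → ℕ => InnerProductSpace.rankOne ℂ (slice ψ l) (slice ψ l) := by
  have h : Summable fun x : (Fin NA → ℕ) × (Fin NB → ℕ) => ‖ψ x‖ ^ (2 : ℝ) := by
    simpa using (lp.memℓp ψ).summable (by norm_num)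
  have h' := ((Equiv.prodComm _ _).summable_iff.mpr h).prod
  refine Summable.of_norm (h'.congr fun l => ?_)
  have e := lp.norm_rpow_eq_tsum (p := 2) (by norm_num) (slice ψ l)
  simp only [ENNReal.toReal_ofNat] at e
  rw [InnerProductSpace.norm_rankOne, ← pow_two, ← Real.rpow_natCast]
  push_cast
  rw [e]
  rfl

/-- `T` has trace `t`: in every orthonormal basis the diagonal of `T` sums (unconditionally)
to `t`. -/
def HasTrace {H : Type} [NormedAddCommGroup H] [InnerProductSpace ℂ H] (T : H →L[ℂ] H) (t : ℂ) :
    Prop :=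
  ∀ (ι : Type) (b : HilbertBasis ι ℂ H), HasSum (fun i => ⟪b i, T (b i)⟫_ℂ) t

open Classical in
/-- The trace of an operator (`0` if there is none). -/
def opTrace {H : Type} [NormedAddCommGroup H] [InnerProductSpace ℂ H] (T : H →L[ℂ] H) : ℂ :=
  if h : ∃ t, HasTrace T t then h.choose else 0

/-- The operator `-ρ log ρ`, by continuous functional calculus for `x ↦ -x log x`
(with the convention `0 log 0 = 0`). -/
def entropyOperator {H : Type} [NormedAddCommGroup H] [InnerProductSpace ℂ H] [CompleteSpace H]
    (ρ : H →L[ℂ] H) : H →L[ℂ] H :=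
  cfc Real.negMulLog ρ

/-- Entanglement entropy `S_A = -Tr(ρ_A log ρ_A)`. -/
def entanglementEntropy (ψ : BipartiteFockSpace NA NB) : ℝ :=
  (opTrace (entropyOperator (reducedDensity ψ))).re

/-- Rényi entropy of order `n`: `R_A^{(n)} = -(1/(n-1)) log Tr(ρ_A^n)`. -/
def renyiEntropyOfOrder (n : ℕ) (ψ : BipartiteFockSpace NA NB) : ℝ :=
  -(1 / ((n : ℝ) - 1)) * Real.log (opTrace (reducedDensity ψ ^ n)).re

/-- The Rényi entropy, of order two: `R_A = -log Tr(ρ_A²)`. -/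
def renyiEntropy (ψ : BipartiteFockSpace NA NB) : ℝ :=
  renyiEntropyOfOrder 2 ψ

/-- `S(ν) = (ν+1)/2 log((ν+1)/2) - (ν-1)/2 log((ν-1)/2)` (equal to `0` at `ν = 1`). -/
def entropyFunction (ν : ℝ) : ℝ :=
  (ν + 1) / 2 * Real.log ((ν + 1) / 2) - (ν - 1) / 2 * Real.log ((ν - 1) / 2)

end GaussianEntropy

end

noncomputable section

namespace GaussianEntropy

/-! ## The entropy function of one mode -/

/-! The reduced state is a product of thermal states, one per normal mode of the restriction `G_A`
of `G` to `A`. By Williamson's theorem (`exists_isWilliamson`) `G_A` has normal modes with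
symplectic eigenvalues `ν i > 0`, and the uncertainty relation `G ≥ iΩ` gives `ν i ≥ 1`. With `λ i =
(ν i - 1)/(ν i + 1)`, the nonzero eigenvalues of `ρ_A` are among the numbers `∏ (1 - λ i) λ i ^ k
i`. Geometric series give `Tr ρ_A² = ∏ 1/ν i` and `S_A = ∑ S(ν i)`. Since `det G_A = ∏ (ν i)²` and
`[J]_A` is `G_A` times the standard symplectic matrix, `R_A = ∑ log (ν i)` is the logarithm of the
volume and half the logarithm of `|det [iJ]_A|`.

The corridor follows mode by mode from `0 ≤ S(ν) - log ν < 1 - log 2`. Modes with `ν = 1` contribute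
nothing, and at most `min(N_A, N_B)` others exist: `1 + [J]_A²` has rank twice their number, and as
`J² = -1` it factors through `B` (`Subsystems.one_add_restrictJ_mul_self`).

Thermality comes from intertwining. The equations for `ψ` trade a normal mode operator `c i` of `A`
for an observable of `B`, and its adjoint `d i` for the adjoint observable. Moving these through the
partial trace yields `c i ρ = λ i ρ c i` and `ρ d i = λ i d i ρ`
(`IsGaussianState.observable_reducedDensity`). As `ρ` is compact and positive, it has an eigenvector
`φ` with almost maximal eigenvalue `μ`. A nonzero `c i φ` would have the eigenvalue `μ / λ i`, which
is too large, so `φ` is a vacuum. The `d i` build from it a Fock family of eigenvectors. The vacuum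
is unique up to a factor, so `ρ` vanishes on the orthogonal complement of the family
(`NormalModes.exists_isDiagonal`). Unit trace fixes the normalisation.

Ladder operators are unbounded, so these manipulations need convergence. The equations for `ψ` can
be solved as `a ψ = S a† ψ + u ψ` with `‖S‖ < 1`, which forces exponential decay in the total
occupation number (`expDecay_of_annihilation`). Then every vector in the range of `ρ` decays
exponentially too, ladder operators preserve this decay, and the scalar products involved converge
absolutely. -/

theorem mul_log_add_log_le {x : ℝ} (hx : 0 ≤ x) :
    x * Real.log x + Real.log (2 * x + 1) ≤ (x + 1) * Real.log (x + 1) := by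
  rcases hx.eq_or_lt with rfl | hx
  · simp
  -- Concavity of the logarithm at `x` and `2x + 1` with weights `x/(x+1)` and `1/(x+1)`, whose
  -- weighted mean is `x + 1`.
  have h := strictConcaveOn_log_Ioi.concaveOn.2 (show x ∈ Set.Ioi 0 from hx)
    (show 2 * x + 1 ∈ Set.Ioi (0 : ℝ) from by simp only [Set.mem_Ioi]; positivity)
    (show 0 ≤ x / (x + 1) by positivity) (show 0 ≤ 1 / (x + 1) by positivity) (by field_simp)
  have e : x / (x + 1) * x + 1 / (x + 1) * (2 * x + 1) = x + 1 := by field_simp; ring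
  simp only [smul_eq_mul, e] at h
  have h1 : (0 : ℝ) < x + 1 := by positivity
  have := mul_le_mul_of_nonneg_left h h1.le
  calc _ = (x + 1) * (x / (x + 1) * Real.log x + 1 / (x + 1) * Real.log (2 * x + 1)) := by
        field_simp
    _ ≤ _ := this

theorem mul_log_sub_mul_log_lt {y : ℝ} (hy : 0 < y) (hy1 : y < 1) :
    (1 + y) * Real.log (1 + y) - (1 - y) * Real.log (1 - y) < 2 * y := by
  -- `f 0 = 0`, and the derivative collapses to `-log (1 - z²)`, which is positive inside the
  -- interval.
  let f : ℝ → ℝ := fun y => 2 * y - ((1 + y) * Real.log (1 + y) - (1 - y) * Real.log (1 - y))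
  have hd : ∀ z ∈ Set.Ico (0 : ℝ) 1, HasDerivAt f (-Real.log (1 - z ^ 2)) z := by
    intro z hz
    have h1 : (1 : ℝ) + z ≠ 0 := by linarith [hz.1]
    have h2 : (1 : ℝ) - z ≠ 0 := by linarith [hz.2]
    have d1 : HasDerivAt (fun z : ℝ => 1 + z) 1 z := (hasDerivAt_id z).const_add 1
    have d2 : HasDerivAt (fun z : ℝ => 1 - z) (-1) z := (hasDerivAt_id z).const_sub 1
    have := ((hasDerivAt_id z).const_mul 2).sub
      ((d1.mul (d1.log h1)).sub (d2.mul (d2.log h2)))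
    refine this.congr_deriv ?_
    have : (1 : ℝ) - z ^ 2 = (1 + z) * (1 - z) := by ring
    rw [this, Real.log_mul h1 h2]
    field_simp
    ring
  have hm : StrictMonoOn f (Set.Ico 0 1) := by
    refine strictMonoOn_of_deriv_pos (convex_Ico 0 1)
      (fun z hz => (hd z hz).continuousAt.continuousWithinAt) fun z hz => ?_
    rw [interior_Ico] at hz
    rw [(hd z ⟨hz.1.le, hz.2⟩).deriv]
    have : Real.log (1 - z ^ 2) < 0 := Real.log_neg (by nlinarith [hz.1, hz.2])
      (by nlinarith [hz.1, hz.2])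
    linarith
  have := hm (a := 0) (b := y) ⟨le_rfl, one_pos⟩ ⟨hy.le, hy1⟩ hy
  simp only [f] at this
  norm_num at this
  linarith

theorem entropyFunction_one : entropyFunction 1 = 0 := by
  norm_num [entropyFunction]

theorem log_le_entropyFunction {ν : ℝ} (hν : 1 ≤ ν) : Real.log ν ≤ entropyFunction ν := by
  have h := mul_log_add_log_le (x := (ν - 1) / 2) (by linarith)
  rw [show 2 * ((ν - 1) / 2) + 1 = ν by ring, show (ν - 1) / 2 + 1 = (ν + 1) / 2 by ring] at h
  rw [entropyFunction]
  linarith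

theorem entropyFunction_sub_log_lt {ν : ℝ} (hν : 1 ≤ ν) :
    entropyFunction ν - Real.log ν < 1 - Real.log 2 := by
  have h2 := Real.log_two_lt_d9
  rcases hν.eq_or_lt with rfl | hν
  · rw [entropyFunction_one]
    norm_num
    linarith
  have hν0 : 0 < ν := by linarith
  -- The claim is this inequality at `y = 1/ν`, multiplied by `ν/2`; `ν = 1` is treated apart
  -- because `y < 1` is needed.
  have h := mul_log_sub_mul_log_lt (y := 1 / ν) (by positivity) ((div_lt_one hν0).mpr hν)
  have e1 : (1 : ℝ) + 1 / ν = 2 * ((ν + 1) / 2) / ν := by field_simp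
  have e2 : (1 : ℝ) - 1 / ν = 2 * ((ν - 1) / 2) / ν := by field_simp
  have p1 : (ν + 1) / 2 ≠ 0 := by linarith
  have p2 : (ν - 1) / 2 ≠ 0 := by linarith
  rw [e1, e2, Real.log_div (by positivity) hν0.ne',
    Real.log_div (mul_ne_zero two_ne_zero p2) hν0.ne',
    Real.log_mul two_ne_zero p1, Real.log_mul two_ne_zero p2] at h
  have h' := mul_lt_mul_of_pos_left h (half_pos hν0)
  have e3 : ν / 2 * (2 * (1 / ν)) = 1 := by field_simp
  rw [e3] at h'
  rw [entropyFunction]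
  have e4 : ν / 2 * (2 * ((ν + 1) / 2) / ν * (Real.log 2 + Real.log ((ν + 1) / 2) - Real.log ν) -
      2 * ((ν - 1) / 2) / ν * (Real.log 2 + Real.log ((ν - 1) / 2) - Real.log ν)) =
      (ν + 1) / 2 * Real.log ((ν + 1) / 2) - (ν - 1) / 2 * Real.log ((ν - 1) / 2) +
      Real.log 2 - Real.log ν := by
    field_simp
    ring
  linarith

/-! ## Sums over occupation numbers -/

theorem hasSum_mul_of_nonneg {α β : Type*} {f : α → ℝ} {g : β → ℝ} {a b : ℝ} (hf : HasSum f a)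
    (hg : HasSum g b) (hf0 : ∀ x, 0 ≤ f x) (hg0 : ∀ y, 0 ≤ g y) :
    HasSum (fun x : α × β => f x.1 * g x.2) (a * b) :=
  hf.mul hg (hf.summable.mul_of_nonneg hg.summable hf0 hg0)

theorem hasSum_prod_pi {n : ℕ} {f : Fin n → ℕ → ℝ} {a : Fin n → ℝ}
    (h0 : ∀ i k, 0 ≤ f i k) (h : ∀ i, HasSum (f i) (a i)) :
    HasSum (fun k : Fin n → ℕ => ∏ i, f i (k i)) (∏ i, a i) := by
  induction n with
  | zero => simp
  | succ n ih =>
    have ih' := ih (f := fun i => f i.succ) (fun i k => h0 _ k) (fun i => h i.succ)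
    have := hasSum_mul_of_nonneg (h 0) ih' (h0 0) (fun k => Finset.prod_nonneg fun i _ => h0 _ _)
    rw [← (Fin.consEquiv fun _ => ℕ).hasSum_iff, Fin.prod_univ_succ]
    refine this.congr_fun ?_
    intro x
    simp [Fin.prod_univ_succ, Fin.consEquiv]

/-- Additivity of entropy over independent distributions: `negMulLog (x * y) = y * negMulLog x + x *
negMulLog y`, and each distribution sums to one. The bound `p ≤ 1` makes all terms nonnegative, so
that double sums converge. -/
theorem hasSum_negMulLog_prod_pi {n : ℕ} {p : Fin n → ℕ → ℝ} {s : Fin n → ℝ}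
    (h0 : ∀ i k, 0 ≤ p i k) (h1 : ∀ i, HasSum (p i) 1)
    (hs : ∀ i, HasSum (fun k => Real.negMulLog (p i k)) (s i)) :
    HasSum (fun k : Fin n → ℕ => Real.negMulLog (∏ i, p i (k i))) (∑ i, s i) := by
  have hle : ∀ i k, p i k ≤ 1 := fun i k => le_hasSum (h1 i) k fun j _ => h0 i j
  induction n with
  | zero => simp
  | succ n ih =>
    have ih' := ih (p := fun i => p i.succ) (fun i k => h0 _ k) (fun i => h1 i.succ)
      (fun i => hs i.succ) (fun i k => hle _ k)
    have h1' := hasSum_prod_pi (f := fun i : Fin n => p i.succ) (fun i k => h0 _ k)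
      (fun i => h1 i.succ)
    have q0 : ∀ k : Fin n → ℕ, 0 ≤ ∏ i, p i.succ (k i) := fun k =>
      Finset.prod_nonneg fun i _ => h0 _ _
    have q1 : ∀ k : Fin n → ℕ, ∏ i, p i.succ (k i) ≤ 1 := fun k =>
      Finset.prod_le_one (fun i _ => h0 _ _) fun i _ => hle _ _
    have A := hasSum_mul_of_nonneg (hs 0) h1'
      (fun k => Real.negMulLog_nonneg (h0 _ _) (hle _ _)) q0
    have B := hasSum_mul_of_nonneg (h1 0) ih' (h0 0)
      (fun k => Real.negMulLog_nonneg (q0 k) (q1 k))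
    have := A.add B
    rw [← (Fin.consEquiv fun _ => ℕ).hasSum_iff, Fin.sum_univ_succ]
    simp only [Finset.prod_const_one, mul_one, one_mul] at this
    refine this.congr_fun ?_
    intro x
    simp [Fin.prod_univ_succ, Fin.consEquiv, Real.negMulLog_mul]
    ring

/-- The thermal ratio `λ = (ν-1)/(ν+1)` of a mode. -/
def thermalRatio (ν : ℝ) : ℝ := (ν - 1) / (ν + 1)

theorem thermalRatio_nonneg {ν : ℝ} (hν : 1 ≤ ν) : 0 ≤ thermalRatio ν :=
  div_nonneg (by linarith) (by linarith)

theorem thermalRatio_lt_one {ν : ℝ} (hν : 1 ≤ ν) : thermalRatio ν < 1 := by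
  rw [thermalRatio, div_lt_one (by linarith)]
  linarith

theorem one_sub_thermalRatio {ν : ℝ} (hν : 1 ≤ ν) : 1 - thermalRatio ν = 2 / (ν + 1) := by
  have : ν + 1 ≠ 0 := by linarith
  rw [thermalRatio]
  field_simp
  ring

theorem hasSum_thermal {ν : ℝ} (hν : 1 ≤ ν) :
    HasSum (fun k : ℕ => (1 - thermalRatio ν) * thermalRatio ν ^ k) 1 := by
  have h := (hasSum_geometric_of_lt_one (thermalRatio_nonneg hν) (thermalRatio_lt_one hν)).mul_left
    (1 - thermalRatio ν)
  rwa [mul_inv_cancel₀ (by linarith [thermalRatio_lt_one hν])] at h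

/-- The purity of one thermal mode: `(1 - λ)² / (1 - λ²) = (1 - λ)/(1 + λ) = 1/ν`. -/
theorem hasSum_thermal_sq {ν : ℝ} (hν : 1 ≤ ν) :
    HasSum (fun k : ℕ => ((1 - thermalRatio ν) * thermalRatio ν ^ k) ^ 2) ν⁻¹ := by
  have l0 := thermalRatio_nonneg hν
  have l1 := thermalRatio_lt_one hν
  have h := (hasSum_geometric_of_lt_one (sq_nonneg (thermalRatio ν))
    (by nlinarith)).mul_left ((1 - thermalRatio ν) ^ 2)
  have e : (1 - thermalRatio ν) ^ 2 * (1 - thermalRatio ν ^ 2)⁻¹ = ν⁻¹ := by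
    have : ν + 1 ≠ 0 := by linarith
    have h0 : ν ≠ 0 := by linarith
    have e2 : 1 - thermalRatio ν ^ 2 = 4 * ν / (ν + 1) ^ 2 := by
      rw [thermalRatio]
      field_simp
      ring
    rw [one_sub_thermalRatio hν, e2]
    field_simp
    norm_num
  rw [e] at h
  refine h.congr_fun fun k => ?_
  rw [mul_pow, ← pow_mul, ← pow_mul, mul_comm k]

/-- The logarithm of a thermal probability is affine in `k`, so only the normalisation and the mean
occupation `λ/(1 - λ)` enter. -/
theorem hasSum_negMulLog_thermal {ν : ℝ} (hν : 1 ≤ ν) :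
    HasSum (fun k : ℕ => Real.negMulLog ((1 - thermalRatio ν) * thermalRatio ν ^ k))
      (entropyFunction ν) := by
  -- For `ν = 1` the ratio is `0`, its logarithm is a default value, and the distribution is a point
  -- mass at `k = 0`.
  rcases hν.eq_or_lt with rfl | hν1
  · rw [entropyFunction_one]
    convert hasSum_zero (α := ℝ) (β := ℕ) using 2 with k
    rcases k with _ | k <;> simp [thermalRatio, Real.negMulLog]
  have l0 : 0 < thermalRatio ν := div_pos (by linarith) (by linarith)
  have l1 := thermalRatio_lt_one hν
  have A := (hasSum_thermal hν).mul_left (-Real.log (1 - thermalRatio ν))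
  have B := (hasSum_coe_mul_geometric_of_norm_lt_one (r := thermalRatio ν)
    (by rwa [Real.norm_of_nonneg l0.le])).mul_left
      (-(1 - thermalRatio ν) * Real.log (thermalRatio ν))
  have e : -Real.log (1 - thermalRatio ν) * 1 + -(1 - thermalRatio ν) * Real.log (thermalRatio ν) *
      (thermalRatio ν / (1 - thermalRatio ν) ^ 2) = entropyFunction ν := by
    have p1 : (ν + 1) / 2 ≠ 0 := by linarith
    have p2 : (ν - 1) / 2 ≠ 0 := by linarith
    have p3 : ν + 1 ≠ 0 := by linarith
    have e1 : Real.log (thermalRatio ν) = Real.log ((ν - 1) / 2) - Real.log ((ν + 1) / 2) := by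
      rw [← Real.log_div p2 p1, thermalRatio]
      congr 1
      field_simp
    have e2 : Real.log (1 - thermalRatio ν) = - Real.log ((ν + 1) / 2) := by
      rw [one_sub_thermalRatio hν, ← Real.log_inv, inv_div]
    rw [e1, e2, one_sub_thermalRatio hν, entropyFunction, thermalRatio]
    field_simp
    ring
  rw [← e]
  refine (A.add B).congr_fun fun k => ?_
  have : (1 - thermalRatio ν) ≠ 0 := by linarith
  rw [Real.negMulLog, Real.log_mul this (pow_ne_zero _ l0.ne'), Real.log_pow]
  ring

/-! ## Operators that are diagonal in an orthonormal family -/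

section Operators

variable {H : Type} [NormedAddCommGroup H] [InnerProductSpace ℂ H] [CompleteSpace H]

/-- The functions for which this holds form a closed subalgebra of `C(spectrum ℝ T, ℝ)` that
contains the constants and the identity, so Stone–Weierstrass applies. -/
theorem cfc_apply_eigenvector {T : H →L[ℂ] H} (hT : IsSelfAdjoint T) {f : ℝ → ℝ}
    (hf : Continuous f) {x : H} {μ : ℝ} (hx : T x = (μ : ℂ) • x) :
    cfc f T x = (f μ : ℂ) • x := by
  rcases eq_or_ne x 0 with rfl | hx0
  · simp
  have hμ : μ ∈ spectrum ℝ T := by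
    rw [spectrum.mem_iff]
    intro hu
    obtain ⟨b, hb⟩ := hu.exists_left_inv
    have := DFunLike.congr_fun hb x
    simp [hx, Algebra.algebraMap_eq_smul_one] at this
    exact hx0 this.symm
  rw [cfc_apply f T hT hf.continuousOn]
  have key : ∀ F : C(spectrum ℝ T, ℝ), cfcHom hT F x = (F ⟨μ, hμ⟩ : ℂ) • x := by
    intro F
    induction F using ContinuousMap.induction_on_of_compact with
    | const r =>
      have := AlgHomClass.commutes (cfcHom hT) r
      rw [show ContinuousMap.const (spectrum ℝ T) r = algebraMap ℝ _ r from rfl, this]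
      simp [Algebra.algebraMap_eq_smul_one]
    | id => rw [cfcHom_id hT, hx]; rfl
    | star_id => rw [map_star, cfcHom_id hT, hT.star_eq, hx]; rfl
    | add F G hF hG => simp [map_add, hF, hG, add_smul]
    | mul F G hF hG =>
      rw [map_mul, mul_apply_eq_comp, hG, map_smul, hF, smul_smul, ContinuousMap.mul_apply,
        Complex.ofReal_mul, mul_comm]
    | frequently F hF =>
      have hc : IsClosed {F : C(spectrum ℝ T, ℝ) | cfcHom hT F x = (F ⟨μ, hμ⟩ : ℂ) • x} := by
        refine isClosed_eq ?_ ?_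
        · exact (cfcHom_continuous hT).clm_apply continuous_const
        · exact (Complex.continuous_ofReal.comp (continuous_eval_const _)).smul
            continuous_const
      exact hc.closure_subset (mem_closure_iff_frequently.2 hF)
  exact key _

omit [CompleteSpace H] in
theorem inner_mul_inner_eq_norm_sq (x y : H) :
    ⟪x, y⟫_ℂ * ⟪y, x⟫_ℂ = ((‖⟪y, x⟫_ℂ‖ ^ 2 : ℝ) : ℂ) := by
  rw [← inner_conj_symm, mul_comm, Complex.mul_conj, Complex.normSq_eq_norm_sq]

theorem hasSum_prod_of_nonneg_of_hasSum_one {κ ι : Type*} {m : κ → ℝ} {g : κ → ι → ℝ} {t : ℝ}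
    (h0 : ∀ k, 0 ≤ m k) (hg : ∀ k i, 0 ≤ g k i) (hm : HasSum m t) (h1 : ∀ k, HasSum (g k) 1) :
    HasSum (fun x : κ × ι => m x.1 * g x.1 x.2) t := by
  have h2 : ∀ k, HasSum (fun i => m k * g k i) (m k) := fun k => by
    simpa using (h1 k).mul_left (m k)
  have hS : Summable fun x : κ × ι => m x.1 * g x.1 x.2 := by
    refine (summable_prod_of_nonneg fun x => mul_nonneg (h0 _) (hg _ _)).2
      ⟨fun k => (h2 k).summable, ?_⟩
    simpa only [fun k => (h2 k).tsum_eq] using hm.summable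
  have h := hS.hasSum
  rwa [(h.prod_fiberwise h2).unique hm] at h

omit [CompleteSpace H] in
/-- If `T` is diagonal, with nonnegative summable eigenvalues, in a Hilbert basis, it has a
trace. -/
theorem hasTrace_of_hilbertBasis {T : H →L[ℂ] H} {κ : Type} (e : HilbertBasis κ ℂ H) {m : κ → ℝ}
    (he : ∀ k, T (e k) = (m k : ℂ) • e k) (h0 : ∀ k, 0 ≤ m k) {t : ℝ} (hm : HasSum m t) :
    HasTrace T (t : ℂ) := by
  intro ι b
  have hN : ∀ k, HasSum (fun i => ‖⟪b i, e k⟫_ℂ‖ ^ 2) 1 := by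
    intro k
    have h1 := b.hasSum_inner_mul_inner (e k) (e k)
    rw [inner_self_eq_norm_sq_to_K, e.orthonormal.1 k] at h1
    simp only [inner_mul_inner_eq_norm_sq] at h1
    exact Complex.hasSum_ofReal.1 (by simpa using h1)
  -- Each diagonal entry in the basis `b` is a mixture of eigenvalues with weights `|⟪b i, e k⟫|²`.
  -- These weights sum to one over `i` by Parseval, and nonnegativity permits exchanging the two
  -- sums.
  have hS2 : HasSum (fun x : κ × ι => m x.1 * ‖⟪b x.2, e x.1⟫_ℂ‖ ^ 2) t :=
    hasSum_prod_of_nonneg_of_hasSum_one (g := fun k i => ‖⟪b i, e k⟫_ℂ‖ ^ 2) h0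
      (fun _ _ => sq_nonneg _) hm hN
  have hb : ∀ i, HasSum (fun k => m k * ‖⟪b i, e k⟫_ℂ‖ ^ 2) (⟪b i, T (b i)⟫_ℂ).re ∧
      ((⟪b i, T (b i)⟫_ℂ).re : ℂ) = ⟪b i, T (b i)⟫_ℂ := by
    intro i
    have h1 := e.hasSum_repr (b i)
    have h2 := (innerSL ℂ (b i)).hasSum (T.hasSum h1)
    simp only [map_smul, he, innerSL_apply_apply, smul_eq_mul, e.repr_apply_apply] at h2
    have h3 : ∀ k, ⟪e k, b i⟫_ℂ * (m k * ⟪b i, e k⟫_ℂ) =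
        ((m k * ‖⟪b i, e k⟫_ℂ‖ ^ 2 : ℝ) : ℂ) := by
      intro k
      rw [mul_left_comm, inner_mul_inner_eq_norm_sq]
      simp
    simp only [h3] at h2
    have h4 := Complex.reCLM.hasSum h2
    simp only [Complex.reCLM_apply, Complex.ofReal_re] at h4
    exact ⟨h4, (Complex.hasSum_ofReal.2 h4).unique h2⟩
  have h5 := ((Equiv.prodComm ι κ).hasSum_iff.2 hS2).prod_fiberwise fun i => (hb i).1
  have h6 := Complex.hasSum_ofReal.2 h5
  simpa only [(hb _).2] using h6

/-- `T` acts on the orthonormal family `e` as multiplication by `m`, and vanishes on its orthogonal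
complement. -/
structure IsDiagonal (T : H →L[ℂ] H) {κ : Type} (e : κ → H) (m : κ → ℝ) : Prop where
  orthonormal : Orthonormal ℂ e
  apply_eq : ∀ k, T (e k) = (m k : ℂ) • e k
  apply_eq_zero : ∀ x, (∀ k, ⟪e k, x⟫_ℂ = 0) → T x = 0

theorem IsDiagonal.hasTrace {T : H →L[ℂ] H} {κ : Type} {e : κ → H} {m : κ → ℝ}
    (h : IsDiagonal T e m) (h0 : ∀ k, 0 ≤ m k) {t : ℝ} (hm : HasSum m t) :
    HasTrace T (t : ℂ) := by
  classical
  -- The family is completed to a Hilbert basis; the added vectors are orthogonal to it and get the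
  -- eigenvalue `0`, which does not change the sum.
  obtain ⟨w, b, hw, hb⟩ := h.orthonormal.toSubtypeRange.exists_hilbertBasis_extension
  have hinj : Function.Injective e := h.orthonormal.linearIndependent.injective
  let g : κ → w := fun k => ⟨e k, hw (Set.mem_range_self k)⟩
  have hg : Function.Injective g := fun a c hac => hinj (congrArg Subtype.val hac)
  have hbg : ∀ k, b (g k) = e k := fun k => by rw [hb]
  refine hasTrace_of_hilbertBasis b (m := Function.extend g m 0) ?_ ?_ ?_
  · intro j
    by_cases hj : ∃ k, g k = j
    · obtain ⟨k, rfl⟩ := hj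
      rw [hg.extend_apply, hbg, h.apply_eq]
    · rw [Function.extend_apply' _ _ _ hj, Pi.zero_apply, Complex.ofReal_zero, zero_smul]
      refine h.apply_eq_zero _ fun k => ?_
      rw [← hbg k]
      exact b.orthonormal.2 fun hk => hj ⟨k, hk⟩
  · intro j
    by_cases hj : ∃ k, g k = j
    · obtain ⟨k, rfl⟩ := hj
      rw [hg.extend_apply]
      exact h0 k
    · rw [Function.extend_apply' _ _ _ hj]
      rfl
  · exact (hasSum_extend_zero hg).2 hm

/-- The complement of the family lies in the kernel of `T`, where `f(T)` acts as `f 0`; hence the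
condition `f 0 = 0`. -/
theorem IsDiagonal.cfc {T : H →L[ℂ] H} (hT : IsSelfAdjoint T) {κ : Type} {e : κ → H} {m : κ → ℝ}
    (h : IsDiagonal T e m) {f : ℝ → ℝ} (hf : Continuous f) (hf0 : f 0 = 0) :
    IsDiagonal (cfc f T) e fun k => f (m k) where
  orthonormal := h.orthonormal
  apply_eq k := cfc_apply_eigenvector hT hf (h.apply_eq k)
  apply_eq_zero x hx := by
    have := cfc_apply_eigenvector hT hf (x := x) (μ := 0) (by simp [h.apply_eq_zero x hx])
    simpa [hf0] using this

omit [CompleteSpace H] in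
theorem IsDiagonal.sq {T : H →L[ℂ] H} {κ : Type} {e : κ → H} {m : κ → ℝ}
    (h : IsDiagonal T e m) : IsDiagonal (T ^ 2) e fun k => m k ^ 2 where
  orthonormal := h.orthonormal
  apply_eq k := by
    simp only [pow_two, mul_apply_eq_comp, h.apply_eq, map_smul, smul_smul,
      Complex.ofReal_mul]
  apply_eq_zero x hx := by simp [pow_two, h.apply_eq_zero x hx]

theorem HasTrace.unique {T : H →L[ℂ] H} {s t : ℂ} (hs : HasTrace T s) (ht : HasTrace T t) :
    s = t := by
  obtain ⟨w, b, -⟩ := exists_hilbertBasis ℂ H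
  exact (hs w b).unique (ht w b)

theorem HasTrace.opTrace_eq {T : H →L[ℂ] H} {t : ℂ} (ht : HasTrace T t) : opTrace T = t := by
  have h : ∃ t, HasTrace T t := ⟨t, ht⟩
  rw [opTrace, dif_pos h]
  exact h.choose_spec.unique ht

/-- A compact positive operator that does not vanish on a closed invariant subspace `K` has there
a positive eigenvalue that is almost maximal. -/
theorem exists_eigenvector_almost_max {T : H →L[ℂ] H} (hc : IsCompactOperator T)
    (hT : T.IsPositive) (K : Submodule ℂ H) (hK : IsClosed (K : Set H)) (hTK : ∀ x ∈ K, T x ∈ K)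
    {x : H} (hx : x ∈ K) (hTx : T x ≠ 0) {l : ℝ} (hl : l < 1) :
    ∃ μ : ℝ, 0 < μ ∧ ∃ φ ∈ K, φ ≠ 0 ∧ T φ = (μ : ℂ) • φ ∧
      ∀ μ' : ℝ, ∀ φ' ∈ K, T φ' = (μ' : ℂ) • φ' → μ ≤ l * μ' → φ' = 0 := by
  let A : Set ℝ := {μ | ∃ φ ∈ K, φ ≠ 0 ∧ T φ = (μ : ℂ) • φ}
  have hpos : ∀ μ ∈ A, 0 ≤ μ := by
    rintro μ ⟨φ, -, h0, h⟩
    have := hT.re_inner_nonneg_right φ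
    rw [h, inner_smul_right, inner_self_eq_norm_sq_to_K] at this
    have h1 : 0 ≤ μ * ‖φ‖ ^ 2 := by
      simpa [← Complex.ofReal_pow, ← Complex.ofReal_mul] using this
    exact nonneg_of_mul_nonneg_left h1 (by positivity)
  have hbdd : BddAbove A := by
    refine ⟨‖T‖, ?_⟩
    rintro μ ⟨φ, hφ, h0, h⟩
    have h1 := T.le_opNorm φ
    rw [h, norm_smul] at h1
    have := le_of_mul_le_mul_right h1 (norm_pos_iff.2 h0)
    exact (le_abs_self μ).trans (by simpa using this)
  -- Without a positive eigenvalue on `K`, the compact symmetric restriction of `T` would have only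
  -- the eigenvalue `0` and would vanish.
  obtain ⟨μ₀, hμ₀, h0⟩ : ∃ μ ∈ A, 0 < μ := by
    by_contra! hcon
    have : CompleteSpace K := hK.completeSpace_coe
    let S : K →L[ℂ] K := T.restrict hTK
    have hS : IsCompactOperator S := hc.restrict' hTK
    have hS' : S.IsSymmetric := hT.isSymmetric.restrict_invariant hTK
    have := (ContinuousLinearMap.eq_zero_of_forall_hasEigenvalue_eq_zero hS hS').1 ?_
    · apply hTx
      exact congrArg Subtype.val (DFunLike.congr_fun this ⟨x, hx⟩)
    · intro μ hμ
      have hr : conj μ = μ := hS'.conj_eigenvalue_eq_self hμ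
      obtain ⟨v, hv⟩ := hμ.exists_hasEigenvector
      obtain ⟨r, rfl⟩ := Complex.conj_eq_iff_real.1 hr
      have hv' : T v = (r : ℂ) • (v : H) := congrArg Subtype.val hv.apply_eq_smul
      have hrA : r ∈ A := ⟨v, v.2, by simpa using hv.2, hv'⟩
      simp [le_antisymm (hcon r hrA) (hpos r hrA)]
  have hM : 0 < sSup A := h0.trans_le (le_csSup hbdd hμ₀)
  -- An eigenvalue above `max l 0 * sSup A` suffices, so the supremum need not be shown to be
  -- attained. The maximum with `0` covers negative `l`.
  obtain ⟨μ, hμ, hlt⟩ := exists_lt_of_lt_csSup ⟨μ₀, hμ₀⟩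
    (show max l 0 * sSup A < sSup A by
      have : max l 0 < 1 := max_lt hl one_pos
      nlinarith)
  have hμ0 : 0 < μ := lt_of_le_of_lt (by positivity) hlt
  obtain ⟨φ, hφ, hne, hTφ⟩ := id hμ
  refine ⟨μ, hμ0, φ, hφ, hne, hTφ, fun μ' φ' hφ' h' hle => ?_⟩
  by_contra hne'
  have hA : μ' ∈ A := ⟨φ', hφ', hne', h'⟩
  have h1 := le_csSup hbdd hA
  have h2 := hpos μ' hA
  have : l * μ' ≤ max l 0 * sSup A :=
    mul_le_mul (le_max_left _ _) h1 h2 (le_max_right _ _)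
  linarith

end Operators

/-! ## Exponential decay of amplitudes from the annihilation equations -/

section Decay

variable {ι : Type*} [Fintype ι] [DecidableEq ι]

theorem sum_update_add_one (k : ι → ℕ) (i : ι) :
    ∑ j, Function.update k i (k i + 1) j = ∑ j, k j + 1 := by
  rw [Finset.sum_update_of_mem (Finset.mem_univ i),
    ← Finset.add_sum_erase _ k (Finset.mem_univ i), Finset.sdiff_singleton_eq_erase]
  ring

theorem sum_update_sub_one {k : ι → ℕ} {i : ι} (hk : 0 < k i) :
    ∑ j, Function.update k i (k i - 1) j + 1 = ∑ j, k j := by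
  rw [Finset.sum_update_of_mem (Finset.mem_univ i),
    ← Finset.add_sum_erase _ k (Finset.mem_univ i), Finset.sdiff_singleton_eq_erase]
  omega

/-- The occupation numbers of total number `n`. -/
abbrev level (ι : Type*) [Fintype ι] [DecidableEq ι] (n : ℕ) : Finset (ι → ℕ) :=
  Finset.piAntidiag Finset.univ n

theorem mem_level {n : ℕ} {k : ι → ℕ} : k ∈ level ι n ↔ ∑ i, k i = n := by
  simp [Finset.mem_piAntidiag]

/-- Raising the `j`-th number is a bijection from pairs `(k, j)` with `k` of total number `n` onto
those of total number `n + 1` with `k j > 0`. -/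
theorem sum_level_raise (F : (ι → ℕ) → ι → ℝ) (n : ℕ) :
    ∑ k ∈ level ι n, ∑ j, F (Function.update k j (k j + 1)) j =
      ∑ k ∈ level ι (n + 1), ∑ j, if 0 < k j then F k j else 0 := by
  rw [← Finset.sum_product', ← Finset.sum_product', ← Finset.sum_filter]
  refine Finset.sum_bij' (fun x _ => (Function.update x.1 x.2 (x.1 x.2 + 1), x.2))
    (fun x _ => (Function.update x.1 x.2 (x.1 x.2 - 1), x.2)) ?_ ?_ ?_ ?_ ?_
  · rintro ⟨k, j⟩ h
    simp only [Finset.mem_product, mem_level, Finset.mem_univ, and_true, Finset.mem_filter] at h ⊢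
    exact ⟨by rw [sum_update_add_one, h], by simp⟩
  · rintro ⟨k, j⟩ h
    simp only [Finset.mem_product, mem_level, Finset.mem_univ, and_true, Finset.mem_filter] at h ⊢
    have := sum_update_sub_one h.2
    omega
  · rintro ⟨k, j⟩ h
    simp
  · rintro ⟨k, j⟩ h
    simp only [Finset.mem_product, mem_level, Finset.mem_univ, and_true, Finset.mem_filter] at h
    simp [Nat.sub_add_cancel (show 1 ≤ k j from h.2)]
  · rintro ⟨k, j⟩ h
    rfl

/-- The weight of the amplitude `ψ` on the occupation numbers of total number `n`. -/
def levelWeight (ψ : (ι → ℕ) → ℂ) (n : ℕ) : ℝ := ∑ k ∈ level ι n, ‖ψ k‖ ^ 2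

/-- This is `∑ aⱼ† aⱼ = N`, with `N` the total number operator, read on one level. -/
theorem sum_level_lower (ψ : (ι → ℕ) → ℂ) (n : ℕ) :
    ∑ k ∈ level ι n, ∑ j, ‖(Real.sqrt ((k j : ℝ) + 1) : ℂ) * ψ (Function.update k j (k j + 1))‖ ^ 2 =
      (n + 1) * levelWeight ψ (n + 1) := by
  have h := sum_level_raise (fun k j => (k j : ℝ) * ‖ψ k‖ ^ 2) n
  have e1 : ∀ (k : ι → ℕ) (j : ι),
      ‖(Real.sqrt ((k j : ℝ) + 1) : ℂ) * ψ (Function.update k j (k j + 1))‖ ^ 2 =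
      ((Function.update k j (k j + 1) j : ℕ) : ℝ) * ‖ψ (Function.update k j (k j + 1))‖ ^ 2 := by
    intro k j
    rw [norm_mul, mul_pow, Complex.norm_real, Real.norm_of_nonneg (Real.sqrt_nonneg _),
      Real.sq_sqrt (by positivity)]
    simp
  simp only [e1]
  rw [h, levelWeight, Finset.mul_sum]
  refine Finset.sum_congr rfl fun k hk => ?_
  have e2 : ∀ j, (if 0 < k j then (k j : ℝ) * ‖ψ k‖ ^ 2 else 0) = (k j : ℝ) * ‖ψ k‖ ^ 2 := by
    intro j
    split_ifs with hj
    · rfl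
    · simp [Nat.eq_zero_of_not_pos hj]
  simp only [e2]
  rw [← Finset.sum_mul, ← Nat.cast_sum, mem_level.1 hk]
  push_cast
  ring

/-- This is `∑ aⱼ aⱼ† = N + card ι`, read on one level. -/
theorem sum_level_create (ψ : (ι → ℕ) → ℂ) (n : ℕ) :
    ∑ k ∈ level ι (n + 1), ∑ j,
      ‖(Real.sqrt (k j : ℝ) : ℂ) * ψ (Function.update k j (k j - 1))‖ ^ 2 =
      (n + Fintype.card ι) * levelWeight ψ n := by
  have h := sum_level_raise
    (fun k j => (k j : ℝ) * ‖ψ (Function.update k j (k j - 1))‖ ^ 2) n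
  have e1 : ∀ (k : ι → ℕ) (j : ι),
      ‖(Real.sqrt (k j : ℝ) : ℂ) * ψ (Function.update k j (k j - 1))‖ ^ 2 =
      if 0 < k j then (k j : ℝ) * ‖ψ (Function.update k j (k j - 1))‖ ^ 2 else 0 := by
    intro k j
    rw [norm_mul, mul_pow, Complex.norm_real, Real.norm_of_nonneg (Real.sqrt_nonneg _),
      Real.sq_sqrt (by positivity)]
    split_ifs with hj
    · rfl
    · simp [Nat.eq_zero_of_not_pos hj]
  simp only [e1]
  rw [← h, levelWeight, Finset.mul_sum]
  refine Finset.sum_congr rfl fun k hk => ?_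
  simp only [Function.update_self, Function.update_idem, Nat.add_sub_cancel,
    Function.update_eq_self]
  rw [← Finset.sum_mul]
  push_cast
  rw [Finset.sum_add_distrib, ← Nat.cast_sum, mem_level.1 hk]
  simp

theorem add_sq_le_of_pos {x y ε : ℝ} (hε : 0 < ε) :
    (x + y) ^ 2 ≤ (1 + ε) * x ^ 2 + (1 + ε⁻¹) * y ^ 2 := by
  have h : 0 ≤ (ε * x - y) ^ 2 * ε⁻¹ := by positivity
  have e : (ε * x - y) ^ 2 * ε⁻¹ = ε * x ^ 2 - 2 * x * y + ε⁻¹ * y ^ 2 := by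
    field_simp
    ring
  nlinarith

/-- The recursion for the level weights of an amplitude with `aᵢ ψ = ∑ⱼ Sᵢⱼ aⱼ† ψ + uᵢ ψ`. -/
theorem levelWeight_recursion {ψ : (ι → ℕ) → ℂ} {S : Matrix ι ι ℂ} {u : ι → ℂ} {σ : ℝ}
    (hS : ∀ y : ι → ℂ, ∑ i, ‖∑ j, S i j * y j‖ ^ 2 ≤ σ * ∑ j, ‖y j‖ ^ 2)
    (hψ : ∀ k i, (Real.sqrt ((k i : ℝ) + 1) : ℂ) * ψ (Function.update k i (k i + 1)) =
      ∑ j, S i j * ((Real.sqrt (k j : ℝ) : ℂ) * ψ (Function.update k j (k j - 1))) + u i * ψ k)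
    {ε : ℝ} (hε : 0 < ε) (n : ℕ) :
    (n + 2) * levelWeight ψ (n + 2) ≤ (1 + ε) * σ * ((n + Fintype.card ι) * levelWeight ψ n) +
      (1 + ε⁻¹) * (∑ i, ‖u i‖ ^ 2) * levelWeight ψ (n + 1) := by
  -- On level `n + 1` the annihilators see level `n + 2`, the creators see level `n`, and the term
  -- with `u` sees level `n + 1` itself.
  have h1 := sum_level_lower ψ (n + 1)
  have h2 := sum_level_create ψ n
  push_cast at h1
  rw [show (n : ℝ) + 2 = n + 1 + 1 by ring, ← h1, ← h2, levelWeight, Finset.mul_sum, Finset.mul_sum,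
    ← Finset.sum_add_distrib]
  refine Finset.sum_le_sum fun k _ => ?_
  calc ∑ i, ‖(Real.sqrt ((k i : ℝ) + 1) : ℂ) * ψ (Function.update k i (k i + 1))‖ ^ 2
      ≤ ∑ i, ((1 + ε) *
          ‖∑ j, S i j * ((Real.sqrt (k j : ℝ) : ℂ) * ψ (Function.update k j (k j - 1)))‖ ^ 2 +
          (1 + ε⁻¹) * (‖u i‖ ^ 2 * ‖ψ k‖ ^ 2)) := by
        refine Finset.sum_le_sum fun i _ => ?_
        rw [hψ, ← mul_pow, ← norm_mul]
        exact (pow_le_pow_left₀ (norm_nonneg _) (norm_add_le _ _) 2).trans (add_sq_le_of_pos hε)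
    _ ≤ _ := by
        rw [Finset.sum_add_distrib, ← Finset.mul_sum, ← Finset.mul_sum, ← Finset.sum_mul, mul_assoc,
          mul_assoc]
        gcongr
        exact hS _

/-- After division by `n + 2` the coefficients tend to `a` and `0`. So eventually they are at most
`a' = (1 + a)/2` and `(1 - a')/2`, whose sum `(1 + a')/2` is below one and is taken as `r²`, since
the recursion goes back by two levels. -/
theorem exists_geometric_bound {X : ℕ → ℝ} (hX : ∀ n, 0 ≤ X n) {a b d : ℝ} (ha : a < 1)
    (ha0 : 0 ≤ a)
    (h : ∀ n : ℕ, (n + 2) * X (n + 2) ≤ a * ((n + d) * X n) + b * X (n + 1)) :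
    ∃ C r : ℝ, 0 < r ∧ r < 1 ∧ ∀ n, X n ≤ C * r ^ n := by
  let a' := (1 + a) / 2
  let r := Real.sqrt ((1 + a') / 2)
  have ha' : a' < 1 := by simp only [a']; linarith
  have ha'0 : 0 < a' := by simp only [a']; linarith
  have hr0 : 0 < r := Real.sqrt_pos.2 (by linarith)
  have hr2 : r ^ 2 = (1 + a') / 2 := Real.sq_sqrt (by linarith)
  have hr1 : r < 1 := by
    rw [← abs_of_pos hr0, ← sq_lt_one_iff_abs_lt_one, hr2]
    linarith
  obtain ⟨N, hN⟩ := exists_nat_ge (max (a * d / (a' - a)) (b / ((1 - a') / 2)))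
  have hstep : ∀ n, N ≤ n → X (n + 2) ≤ a' * X n + (1 - a') / 2 * X (n + 1) := by
    intro n hn
    have hn' : (N : ℝ) ≤ n := by exact_mod_cast hn
    have h1 : a * d ≤ (a' - a) * n := by
      have : a * d / (a' - a) ≤ n := (le_max_left _ _).trans (hN.trans hn')
      rw [div_le_iff₀ (by simp only [a']; linarith)] at this
      linarith
    have h2 : b ≤ (1 - a') / 2 * n := by
      have : b / ((1 - a') / 2) ≤ n := (le_max_right _ _).trans (hN.trans hn')
      rw [div_le_iff₀ (by linarith)] at this
      linarith
    have hn0 : (0 : ℝ) ≤ n := Nat.cast_nonneg n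
    have h3 : (n + 2) * X (n + 2) ≤ (n + 2) * (a' * X n + (1 - a') / 2 * X (n + 1)) := by
      refine (h n).trans ?_
      have e1 : a * ((n + d) * X n) ≤ a' * (n + 2) * X n := by
        rw [← mul_assoc]
        exact mul_le_mul_of_nonneg_right (by nlinarith) (hX n)
      have e2 : b * X (n + 1) ≤ (1 - a') / 2 * (n + 2) * X (n + 1) :=
        mul_le_mul_of_nonneg_right (by nlinarith) (hX _)
      linarith
    exact le_of_mul_le_mul_left h3 (by positivity)
  obtain ⟨C, hC⟩ : ∃ C : ℝ, ∀ n ≤ N + 1, X n ≤ C * r ^ n := by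
    refine ⟨∑ m ∈ Finset.range (N + 2), X m / r ^ m, fun n hn => ?_⟩
    rw [← div_le_iff₀ (by positivity)]
    exact Finset.single_le_sum (f := fun m => X m / r ^ m)
      (fun m _ => div_nonneg (hX m) (by positivity)) (Finset.mem_range.2 (by omega))
  have hC0 : 0 ≤ C := by
    have := hC 0 (by omega)
    simp only [pow_zero, mul_one] at this
    exact (hX 0).trans this
  refine ⟨C, r, hr0, hr1, fun n => ?_⟩
  induction n using Nat.strong_induction_on with
  | _ n ih =>
    by_cases hn : n ≤ N + 1
    · exact hC n hn
    obtain ⟨m, rfl⟩ : ∃ m, n = m + 2 := ⟨n - 2, by omega⟩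
    have h1 := ih m (by omega)
    have h2 := ih (m + 1) (by omega)
    have h3 : C * r ^ (m + 1) ≤ C * r ^ m :=
      mul_le_mul_of_nonneg_left (pow_le_pow_of_le_one hr0.le hr1.le (by omega)) hC0
    calc X (m + 2) ≤ a' * X m + (1 - a') / 2 * X (m + 1) := hstep m (by omega)
      _ ≤ a' * (C * r ^ m) + (1 - a') / 2 * (C * r ^ m) := by
        gcongr
        linarith
      _ = C * r ^ (m + 2) := by
        rw [pow_add, hr2]
        ring

/-- Amplitudes that decay exponentially in the total occupation number. -/
def ExpDecay (f : (ι → ℕ) → ℂ) : Prop :=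
  ∃ C r : ℝ, 0 < r ∧ r < 1 ∧ ∀ k, ‖f k‖ ≤ C * r ^ (∑ i, k i)

/-- An amplitude with `aᵢ ψ = ∑ⱼ Sᵢⱼ aⱼ† ψ + uᵢ ψ` and `‖S‖ < 1` decays exponentially. -/
theorem expDecay_of_annihilation {ψ : (ι → ℕ) → ℂ} {S : Matrix ι ι ℂ} {u : ι → ℂ} {σ : ℝ}
    (hσ0 : 0 ≤ σ) (hσ : σ < 1)
    (hS : ∀ y : ι → ℂ, ∑ i, ‖∑ j, S i j * y j‖ ^ 2 ≤ σ * ∑ j, ‖y j‖ ^ 2)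
    (hψ : ∀ k i, (Real.sqrt ((k i : ℝ) + 1) : ℂ) * ψ (Function.update k i (k i + 1)) =
      ∑ j, S i j * ((Real.sqrt (k j : ℝ) : ℂ) * ψ (Function.update k j (k j - 1))) + u i * ψ k) :
    ExpDecay ψ := by
  have hX : ∀ n, 0 ≤ levelWeight ψ n := fun n => Finset.sum_nonneg fun _ _ => sq_nonneg _
  -- This `ε` keeps `(1 + ε) σ < 1`: the difference `1 - (1 + ε) σ` is `(1 - σ)(2 - σ)/2`.
  have hε : 0 < (1 - σ) / 2 := by linarith
  obtain ⟨C, r, hr0, hr1, h⟩ := exists_geometric_bound hX (a := (1 + (1 - σ) / 2) * σ)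
    (by nlinarith) (by positivity) (levelWeight_recursion hS hψ hε)
  have hC : 0 ≤ C := by simpa using (hX 0).trans (h 0)
  refine ⟨Real.sqrt C, Real.sqrt r, Real.sqrt_pos.2 hr0,
    (Real.sqrt_lt' one_pos).2 (by simpa using hr1), fun k => ?_⟩
  have h1 : ‖ψ k‖ ^ 2 ≤ levelWeight ψ (∑ i, k i) :=
    Finset.single_le_sum (f := fun k => ‖ψ k‖ ^ 2) (fun _ _ => sq_nonneg _) (mem_level.2 rfl)
  refine abs_le_of_sq_le_sq' ?_ (by positivity) |>.2
  rw [mul_pow, Real.sq_sqrt hC, ← pow_mul, mul_comm _ 2, pow_mul, Real.sq_sqrt hr0.le]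
  exact h1.trans (h _)

end Decay

/-! ## Exponentially decaying amplitudes -/

section ExpDecay

variable {n : ℕ}

theorem ExpDecay.exists_common {f g : (Fin n → ℕ) → ℂ} (hf : ExpDecay f) (hg : ExpDecay g) :
    ∃ C r : ℝ, 0 ≤ C ∧ 0 < r ∧ r < 1 ∧ (∀ k, ‖f k‖ ≤ C * r ^ (∑ i, k i)) ∧
      ∀ k, ‖g k‖ ≤ C * r ^ (∑ i, k i) := by
  obtain ⟨C, r, hr0, hr1, h⟩ := hf
  obtain ⟨C', r', hr0', hr1', h'⟩ := hg
  have hC : 0 ≤ C := by simpa using (norm_nonneg _).trans (h 0)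
  have hC' : 0 ≤ C' := by simpa using (norm_nonneg _).trans (h' 0)
  refine ⟨max C C', max r r', hC.trans (le_max_left _ _), hr0.trans_le (le_max_left _ _),
    max_lt hr1 hr1', fun k => (h k).trans ?_, fun k => (h' k).trans ?_⟩
  · gcongr <;> exact le_max_left _ _
  · gcongr <;> exact le_max_right _ _

theorem ExpDecay.add {f g : (Fin n → ℕ) → ℂ} (hf : ExpDecay f) (hg : ExpDecay g) :
    ExpDecay (f + g) := by
  obtain ⟨C, r, hC, hr0, hr1, h, h'⟩ := hf.exists_common hg
  refine ⟨C + C, r, hr0, hr1, fun k => (norm_add_le _ _).trans ?_⟩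
  rw [add_mul]
  exact add_le_add (h k) (h' k)

theorem ExpDecay.smul {f : (Fin n → ℕ) → ℂ} (hf : ExpDecay f) (c : ℂ) : ExpDecay (c • f) := by
  obtain ⟨C, r, hr0, hr1, h⟩ := hf
  refine ⟨‖c‖ * C, r, hr0, hr1, fun k => ?_⟩
  rw [Pi.smul_apply, smul_eq_mul, norm_mul, mul_assoc]
  exact mul_le_mul_of_nonneg_left (h k) (norm_nonneg _)

theorem expDecay_zero : ExpDecay (0 : (Fin n → ℕ) → ℂ) :=
  ⟨0, 1 / 2, by norm_num, by norm_num, by simp⟩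

theorem ExpDecay.sum {κ : Type*} (s : Finset κ) {f : κ → (Fin n → ℕ) → ℂ}
    (hf : ∀ i ∈ s, ExpDecay (f i)) : ExpDecay (∑ i ∈ s, f i) :=
  Finset.sum_induction _ _ (fun _ _ => ExpDecay.add) expDecay_zero hf

theorem ExpDecay.conj {f : (Fin n → ℕ) → ℂ} (hf : ExpDecay f) : ExpDecay fun k => conj (f k) := by
  simpa [ExpDecay] using hf

/-- Each of the `n + 1` terms `1, q, …, qⁿ` of the geometric series is at least `qⁿ`. -/
theorem natCast_add_one_mul_pow_le {q : ℝ} (hq0 : 0 ≤ q) (hq1 : q < 1) (n : ℕ) :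
    ((n : ℝ) + 1) * q ^ n ≤ (1 - q)⁻¹ := by
  have h := (summable_geometric_of_lt_one hq0 hq1).sum_le_tsum (Finset.range (n + 1))
    fun i _ => pow_nonneg hq0 i
  rw [tsum_geometric_of_lt_one hq0 hq1] at h
  refine le_trans ?_ h
  have := Finset.card_nsmul_le_sum (Finset.range (n + 1)) (fun i => q ^ i) (q ^ n)
    fun i hi => pow_le_pow_of_le_one hq0 hq1.le (Nat.lt_succ_iff.1 (Finset.mem_range.1 hi))
  simpa [nsmul_eq_mul] using this

/-- A factor linear in the total number is absorbed by weakening the rate from `r` to `√r`. This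
covers the square roots in the ladder operators. -/
theorem ExpDecay.of_le_mul {f : (Fin n → ℕ) → ℂ} {C r : ℝ} (hr0 : 0 < r) (hr1 : r < 1)
    (h : ∀ k, ‖f k‖ ≤ C * (((∑ i, k i : ℕ) : ℝ) + 1) * r ^ (∑ i, k i)) : ExpDecay f := by
  have hC : 0 ≤ C := by simpa using (norm_nonneg _).trans (h 0)
  have hs1 : Real.sqrt r < 1 := (Real.sqrt_lt' one_pos).2 (by simpa using hr1)
  refine ⟨C * (1 - Real.sqrt r)⁻¹, Real.sqrt r, Real.sqrt_pos.2 hr0, hs1, fun k => (h k).trans ?_⟩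
  have e : r ^ (∑ i, k i) = Real.sqrt r ^ (∑ i, k i) * Real.sqrt r ^ (∑ i, k i) := by
    rw [← mul_pow, Real.mul_self_sqrt hr0.le]
  rw [e, mul_assoc, mul_assoc, ← mul_assoc (_ + 1)]
  gcongr
  exact natCast_add_one_mul_pow_le (Real.sqrt_nonneg _) hs1 _

theorem apply_le_sum_apply (k : Fin n → ℕ) (i : Fin n) : k i ≤ ∑ j, k j :=
  Finset.single_le_sum (f := k) (fun _ _ => Nat.zero_le _) (Finset.mem_univ i)

theorem ExpDecay.annihilate {f : (Fin n → ℕ) → ℂ} (hf : ExpDecay f) (i : Fin n) :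
    ExpDecay (annihilate i f) := by
  obtain ⟨C, r, hr0, hr1, h⟩ := hf
  have hC : 0 ≤ C := by simpa using (norm_nonneg _).trans (h 0)
  refine .of_le_mul hr0 hr1 (C := C) fun k => ?_
  have h1 : ((k i : ℝ) + 1) ≤ ((∑ j, k j : ℕ) : ℝ) + 1 := by
    exact_mod_cast Nat.succ_le_succ (apply_le_sum_apply k i)
  have h2 : Real.sqrt ((k i : ℝ) + 1) ≤ ((∑ j, k j : ℕ) : ℝ) + 1 :=
    (Real.sqrt_le_self_iff.2 (Or.inr (by norm_cast; omega))).trans h1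
  have h3 := h (Function.update k i (k i + 1))
  rw [sum_update_add_one, pow_succ] at h3
  rw [GaussianEntropy.annihilate, LinearMap.coe_mk, AddHom.coe_mk, norm_mul, Complex.norm_real,
    Real.norm_of_nonneg (Real.sqrt_nonneg _)]
  calc _ ≤ (((∑ j, k j : ℕ) : ℝ) + 1) * (C * r ^ (∑ j, k j)) := by
        gcongr
        refine h3.trans ?_
        rw [← mul_assoc]
        exact mul_le_of_le_one_right (by positivity) hr1.le
    _ = _ := by ring

theorem ExpDecay.create {f : (Fin n → ℕ) → ℂ} (hf : ExpDecay f) (i : Fin n) :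
    ExpDecay (create i f) := by
  obtain ⟨C, r, hr0, hr1, h⟩ := hf
  have hC : 0 ≤ C := by simpa using (norm_nonneg _).trans (h 0)
  refine .of_le_mul hr0 hr1 (C := C / r) fun k => ?_
  rw [GaussianEntropy.create, LinearMap.coe_mk, AddHom.coe_mk, norm_mul, Complex.norm_real,
    Real.norm_of_nonneg (Real.sqrt_nonneg _)]
  rcases Nat.eq_zero_or_pos (k i) with hk | hk
  · rw [hk]
    simp only [Nat.cast_zero, Real.sqrt_zero, zero_mul]
    positivity
  have h1 : (k i : ℝ) ≤ ((∑ j, k j : ℕ) : ℝ) + 1 := by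
    exact_mod_cast (apply_le_sum_apply k i).trans (Nat.le_succ _)
  have h2 : Real.sqrt (k i : ℝ) ≤ ((∑ j, k j : ℕ) : ℝ) + 1 :=
    (Real.sqrt_le_self_iff.2 (Or.inr (by norm_cast))).trans h1
  have h3 := h (Function.update k i (k i - 1))
  calc _ ≤ (((∑ j, k j : ℕ) : ℝ) + 1) * (C * r ^ (∑ j, Function.update k i (k i - 1) j)) := by
        gcongr
    _ = _ := by
        rw [← sum_update_sub_one hk, pow_succ]
        field_simp

theorem summable_pow_sum {r : ℝ} (hr0 : 0 ≤ r) (hr1 : r < 1) :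
    Summable fun k : Fin n → ℕ => r ^ (∑ i, k i) := by
  have := (hasSum_prod_pi (n := n) (f := fun _ k => r ^ k) (fun _ k => pow_nonneg hr0 k)
    fun _ => hasSum_geometric_of_lt_one hr0 hr1).summable
  simpa only [Finset.prod_pow_eq_pow_sum] using this

theorem ExpDecay.summable_mul {f g : (Fin n → ℕ) → ℂ} (hf : ExpDecay f) (hg : ExpDecay g) :
    Summable fun k => f k * g k := by
  obtain ⟨C, r, hC, hr0, hr1, h, h'⟩ := hf.exists_common hg
  refine Summable.of_norm_bounded (g := fun k => C * C * r ^ (∑ i, k i))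
    ((summable_pow_sum hr0.le hr1).mul_left _) fun k => ?_
  rw [norm_mul]
  calc _ ≤ C * r ^ (∑ i, k i) * (C * r ^ (∑ i, k i)) :=
        mul_le_mul (h k) (h' k) (norm_nonneg _) (by positivity)
    _ ≤ C * 1 * (C * r ^ (∑ i, k i)) := by
        gcongr
        exact pow_le_one₀ hr0.le hr1.le
    _ = _ := by ring

theorem ExpDecay.memℓp {f : (Fin n → ℕ) → ℂ} (hf : ExpDecay f) : Memℓp f 2 := by
  refine memℓp_gen ?_
  have := (hf.summable_mul hf.conj).norm
  refine this.congr fun k => ?_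
  simp [pow_two]

/-- An exponentially decaying amplitude as an element of Fock space. -/
def ExpDecay.toFock {f : (Fin n → ℕ) → ℂ} (hf : ExpDecay f) : FockSpace n := ⟨f, hf.memℓp⟩

end ExpDecay

/-! ## Affine combinations of ladder operators -/

section Ladder

variable {n : ℕ}

/-- The operator `∑ᵢ αᵢ aᵢ + ∑ᵢ βᵢ aᵢ† + w`. -/
def ladder (α β : Fin n → ℂ) (w : ℂ) : Module.End ℂ ((Fin n → ℕ) → ℂ) :=
  ∑ i, α i • annihilate i + ∑ i, β i • create i + w • 1

theorem ladder_apply (α β : Fin n → ℂ) (w : ℂ) (f : (Fin n → ℕ) → ℂ) (k : Fin n → ℕ) :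
    ladder α β w f k = ∑ i, α i * ((Real.sqrt ((k i : ℝ) + 1) : ℂ) *
      f (Function.update k i (k i + 1))) + ∑ i, β i * ((Real.sqrt (k i : ℝ) : ℂ) *
      f (Function.update k i (k i - 1))) + w * f k := by
  simp [ladder, annihilate, create, LinearMap.sum_apply, Finset.sum_apply]

theorem ladder_apply' (α β : Fin n → ℂ) (w : ℂ) (f : (Fin n → ℕ) → ℂ) :
    ladder α β w f = ∑ i, α i • annihilate i f + ∑ i, β i • create i f + w • f := by
  simp [ladder, LinearMap.sum_apply]

theorem ExpDecay.ladder {f : (Fin n → ℕ) → ℂ} (hf : ExpDecay f) (α β : Fin n → ℂ) (w : ℂ) :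
    ExpDecay (ladder α β w f) := by
  rw [ladder_apply']
  exact ((ExpDecay.sum _ fun i _ => (hf.annihilate i).smul _).add
    (ExpDecay.sum _ fun i _ => (hf.create i).smul _)).add (hf.smul w)

/-- A ladder operator combines only finitely many amplitudes at each point, so pointwise convergence
is enough. -/
theorem hasSum_ladder {κ : Type*} {F : (Fin n → ℕ) → κ → ℂ} {f : (Fin n → ℕ) → ℂ}
    (h : ∀ k, HasSum (F k) (f k)) (α β : Fin n → ℂ) (w : ℂ) (k : Fin n → ℕ) :
    HasSum (fun l => ladder α β w (fun k' => F k' l) k) (ladder α β w f k) := by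
  simp only [ladder_apply]
  exact ((hasSum_sum fun i _ => ((h _).mul_left _).mul_left _).add
    (hasSum_sum fun i _ => ((h _).mul_left _).mul_left _)).add ((h k).mul_left _)

/-- The scalar product of amplitudes. -/
def pair (f g : (Fin n → ℕ) → ℂ) : ℂ := ∑' k, conj (f k) * g k

theorem conj_pair (f g : (Fin n → ℕ) → ℂ) : conj (pair f g) = pair g f := by
  rw [pair, Complex.conj_tsum]
  simp [pair, mul_comm]

theorem inner_eq_pair (f g : FockSpace n) : ⟪f, g⟫_ℂ = pair f g := by
  rw [lp.inner_eq_tsum, pair]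
  exact tsum_congr fun k => by simp [mul_comm]

theorem pair_add {f g h : (Fin n → ℕ) → ℂ} (hf : ExpDecay f) (hg : ExpDecay g) (hh : ExpDecay h) :
    pair f (g + h) = pair f g + pair f h := by
  simp only [pair, Pi.add_apply, mul_add]
  exact (hf.conj.summable_mul hg).tsum_add (hf.conj.summable_mul hh)

theorem pair_smul (f g : (Fin n → ℕ) → ℂ) (c : ℂ) : pair f (c • g) = c * pair f g := by
  simp only [pair, Pi.smul_apply, smul_eq_mul, mul_left_comm _ c]
  exact tsum_mul_left

theorem pair_zero (f : (Fin n → ℕ) → ℂ) : pair f 0 = 0 := by simp [pair]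

theorem pair_sum {κ : Type*} (s : Finset κ) {f : (Fin n → ℕ) → ℂ} {g : κ → (Fin n → ℕ) → ℂ}
    (hf : ExpDecay f) (hg : ∀ i, ExpDecay (g i)) :
    pair f (∑ i ∈ s, g i) = ∑ i ∈ s, pair f (g i) := by
  classical
  induction s using Finset.induction_on with
  | empty => simp [pair_zero]
  | insert a s ha ih =>
    rw [Finset.sum_insert ha, Finset.sum_insert ha, pair_add hf (hg a)
      (ExpDecay.sum _ fun i _ => hg i), ih]

/-- A reindexing by `k ↦ k + eᵢ`: amplitudes of `create i f` vanish where `k i = 0`, so no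
convergence is needed. -/
theorem pair_annihilate (f g : (Fin n → ℕ) → ℂ) (i : Fin n) :
    pair f (annihilate i g) = pair (create i f) g := by
  have hinj : Function.Injective fun k : Fin n → ℕ => Function.update k i (k i + 1) := by
    intro k k' h
    have h1 := congrArg (fun k : Fin n → ℕ => Function.update k i (k i - 1)) h
    simpa using h1
  have hsupp : Function.support (fun k => conj (create i f k) * g k) ⊆
      Set.range fun k : Fin n → ℕ => Function.update k i (k i + 1) := by
    intro k hk
    refine ⟨Function.update k i (k i - 1), ?_⟩
    have : 0 < k i := by
      by_contra h0
      have h0 : k i = 0 := by omega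
      simp [create, h0] at hk
    simp [Nat.sub_add_cancel (show 1 ≤ k i from this)]
  rw [pair, pair, ← hinj.tsum_eq hsupp]
  refine tsum_congr fun k => ?_
  simp [annihilate, create]
  ring

theorem pair_create (f g : (Fin n → ℕ) → ℂ) (i : Fin n) :
    pair f (create i g) = pair (annihilate i f) g := by
  rw [← conj_pair, ← pair_annihilate, conj_pair]

theorem pair_ladder {f g : (Fin n → ℕ) → ℂ} (hf : ExpDecay f) (hg : ExpDecay g)
    (α β : Fin n → ℂ) (w : ℂ) :
    pair f (ladder α β w g) =
      pair (ladder (fun i => conj (β i)) (fun i => conj (α i)) (conj w) f) g := by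
  have h1 : ∀ α β w, ∀ {f g : (Fin n → ℕ) → ℂ}, ExpDecay f → ExpDecay g →
      pair f (ladder α β w g) = ∑ i, α i * pair f (annihilate i g) +
        ∑ i, β i * pair f (create i g) + w * pair f g := by
    intro α β w f g hf hg
    rw [ladder_apply', pair_add hf ((ExpDecay.sum _ fun i _ => (hg.annihilate i).smul _).add
      (ExpDecay.sum _ fun i _ => (hg.create i).smul _)) (hg.smul w),
      pair_add hf (ExpDecay.sum _ fun i _ => (hg.annihilate i).smul _)
        (ExpDecay.sum _ fun i _ => (hg.create i).smul _),
      pair_sum _ hf fun i => (hg.annihilate i).smul _,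
      pair_sum _ hf fun i => (hg.create i).smul _]
    simp only [pair_smul]
  rw [h1 α β w hf hg, ← conj_pair g (ladder _ _ _ f), h1 _ _ _ hg hf]
  simp only [map_add, map_sum, map_mul, Complex.conj_conj, conj_pair, pair_annihilate, pair_create]
  ring

theorem annihilate_mul_annihilate (i j : Fin n) :
    annihilate i * annihilate j = annihilate j * annihilate i := by
  rcases eq_or_ne i j with rfl | hij
  · rfl
  ext f k
  simp [annihilate, Module.End.mul_apply, Function.update_of_ne hij, Function.update_of_ne hij.symm,
    Function.update_comm hij]
  ring

theorem create_mul_create (i j : Fin n) : create i * create j = create j * create i := by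
  rcases eq_or_ne i j with rfl | hij
  · rfl
  ext f k
  simp [create, Module.End.mul_apply, Function.update_of_ne hij, Function.update_of_ne hij.symm,
    Function.update_comm hij]
  ring

theorem annihilate_mul_create_of_ne {i j : Fin n} (hij : i ≠ j) :
    annihilate i * create j = create j * annihilate i := by
  ext f k
  simp [annihilate, create, Module.End.mul_apply, Function.update_of_ne hij,
    Function.update_of_ne hij.symm, Function.update_comm hij]
  ring

theorem annihilate_mul_create_self (i : Fin n) :
    annihilate i * create i = create i * annihilate i + 1 := by
  ext f k
  have hs : ∀ x : ℝ, 0 ≤ x → (Real.sqrt x : ℂ) * (Real.sqrt x : ℂ) = x := fun x hx => by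
    rw [← Complex.ofReal_mul, Real.mul_self_sqrt hx]
  have h1 : annihilate i (create i f) k = ((k i : ℝ) + 1 : ℝ) * f k := by
    rw [← hs _ (by positivity)]
    simp [annihilate, create, mul_assoc]
  have h2 : create i (annihilate i f) k = (k i : ℝ) * f k := by
    rw [← hs _ (by positivity)]
    -- At `k i = 0` the truncated difference `k i - 1` is harmless because its coefficient is `√0`.
    rcases Nat.eq_zero_or_pos (k i) with hk | hk
    · simp [annihilate, create, hk]
    · have h3 : ((k i - 1 : ℕ) : ℝ) + 1 = k i := by
        rw [Nat.cast_pred hk]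
        ring
      simp [annihilate, create, h3, Nat.sub_add_cancel (show 1 ≤ k i from hk), mul_assoc]
  simp only [Module.End.mul_apply, LinearMap.add_apply, Module.End.one_apply, Pi.add_apply, h1, h2]
  push_cast
  ring

theorem ladder_commutator (α β α' β' : Fin n → ℂ) (w w' : ℂ) :
    ladder α β w * ladder α' β' w' =
      ladder α' β' w' * ladder α β w + (∑ i, (α i * β' i - β i * α' i)) • 1 := by
  have h1 : (∑ i, α i • annihilate i) * (∑ i, α' i • annihilate i) =
      (∑ i, α' i • annihilate i) * (∑ i, α i • annihilate i) := by
    rw [Finset.sum_mul_sum, Finset.sum_mul_sum, Finset.sum_comm]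
    refine Finset.sum_congr rfl fun i _ => Finset.sum_congr rfl fun j _ => ?_
    rw [smul_mul_smul_comm, smul_mul_smul_comm, annihilate_mul_annihilate, mul_comm]
  have h2 : (∑ i, β i • create i) * (∑ i, β' i • create i) =
      (∑ i, β' i • create i) * (∑ i, β i • create i) := by
    rw [Finset.sum_mul_sum, Finset.sum_mul_sum, Finset.sum_comm]
    refine Finset.sum_congr rfl fun i _ => Finset.sum_congr rfl fun j _ => ?_
    rw [smul_mul_smul_comm, smul_mul_smul_comm, create_mul_create, mul_comm]
  have h3 : ∀ α β : Fin n → ℂ, (∑ i, α i • annihilate i) * (∑ i, β i • create i) =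
      (∑ i, β i • create i) * (∑ i, α i • annihilate i) + (∑ i, α i * β i) • 1 := by
    intro α β
    rw [Finset.sum_mul_sum, Finset.sum_mul_sum, Finset.sum_comm, Finset.sum_smul,
      ← Finset.sum_add_distrib]
    refine Finset.sum_congr rfl fun j _ => ?_
    rw [← Finset.add_sum_erase _ _ (Finset.mem_univ j),
      ← Finset.add_sum_erase _ (fun i => β j • create j * α i • annihilate i) (Finset.mem_univ j)]
    have : ∀ i ∈ Finset.univ.erase j, (α i • annihilate i) * (β j • create j) =
        (β j • create j) * (α i • annihilate i) := by
      intro i hi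
      rw [smul_mul_smul_comm, smul_mul_smul_comm,
        annihilate_mul_create_of_ne (Finset.ne_of_mem_erase hi),
        mul_comm]
    rw [Finset.sum_congr rfl this, smul_mul_smul_comm, smul_mul_smul_comm,
      annihilate_mul_create_self, smul_add, mul_comm (β j)]
    abel
  have h4 := h3 α β'
  have h5 := h3 α' β
  have e : ∑ i, α i * β' i = ∑ i, (α i * β' i - β i * α' i) + ∑ i, α' i * β i := by
    rw [← Finset.sum_add_distrib]
    refine Finset.sum_congr rfl fun i _ => ?_
    ring
  rw [e] at h4
  simp only [ladder, add_mul, mul_add, h1, h2, h4, h5, smul_mul_assoc, mul_smul_comm, one_mul,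
    mul_one]
  module

/-- An amplitude annihilated by operators `∑ⱼ αᵢⱼ aⱼ + ∑ⱼ βᵢⱼ aⱼ† + wᵢ` with `α` invertible is
determined by its value at `0`. -/
theorem eq_zero_of_ladder_eq_zero {α β γ : Matrix (Fin n) (Fin n) ℂ} {w : Fin n → ℂ}
    (hγ : γ * α = 1) {f : (Fin n → ℕ) → ℂ} (hf : ∀ i, ladder (α i) (β i) (w i) f = 0)
    (h0 : f 0 = 0) : f = 0 := by
  have key : ∀ m : ℕ, ∀ k : Fin n → ℕ, ∑ i, k i = m → f k = 0 := by
    intro m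
    induction m using Nat.strong_induction_on with
    | _ m ih =>
      intro k hk
      by_cases hk0 : k = 0
      · rw [hk0, h0]
      obtain ⟨i, hi⟩ := Function.ne_iff.1 hk0
      have hi : 0 < k i := Nat.pos_of_ne_zero hi
      -- The equations at `k' = k - eᵢ` involve total numbers `m`, `m - 1` and `m - 2`. The last two
      -- vanish by induction, and inverting `α` isolates the amplitudes of total number `m`, among
      -- them `f k`.
      set k' := Function.update k i (k i - 1) with hk'
      have hsum : ∑ j, k' j + 1 = m := by rw [← hk, ← sum_update_sub_one hi]
      have e0 : f k' = 0 := ih _ (by omega) k' rfl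
      have e1 : ∀ j, (Real.sqrt (k' j : ℝ) : ℂ) * f (Function.update k' j (k' j - 1)) = 0 := by
        intro j
        rcases Nat.eq_zero_or_pos (k' j) with h | h
        · simp [h]
        · rw [ih (m - 2) (by omega) _ (by have := sum_update_sub_one h; omega), mul_zero]
      let x : Fin n → ℂ := fun j =>
        (Real.sqrt ((k' j : ℝ) + 1) : ℂ) * f (Function.update k' j (k' j + 1))
      have e2 : α *ᵥ x = 0 := by
        funext l
        have := congrFun (hf l) k'
        rw [ladder_apply, e0] at this
        simpa [e1, Matrix.mulVec, dotProduct, x] using this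
      have e3 : x = 0 := by
        rw [← Matrix.one_mulVec x, ← hγ, ← Matrix.mulVec_mulVec, e2, Matrix.mulVec_zero]
      have e4 := congrFun e3 i
      have e5 : Function.update k' i (k' i + 1) = k := by
        simp [hk', Nat.sub_add_cancel (show 1 ≤ k i from hi)]
      have e6 : (Real.sqrt ((k' i : ℝ) + 1) : ℂ) ≠ 0 := by
        rw [Complex.ofReal_ne_zero]
        positivity
      simp only [x, e5, Pi.zero_apply, mul_eq_zero, e6, false_or] at e4
      exact e4
  exact funext fun k => key _ k rfl

end Ladder

/-! ## The reduced density operator on amplitudes -/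

section Reduced

variable {NA NB : ℕ}

theorem reducedDensity_apply (ψ : BipartiteFockSpace NA NB) (x : FockSpace NA) (k : Fin NA → ℕ) :
    HasSum (fun l => ψ (k, l) * ⟪slice ψ l, x⟫_ℂ) (reducedDensity ψ x k) := by
  have h1 := (summable_reducedDensity ψ).hasSum
  have h2 := (ContinuousLinearMap.apply ℂ (FockSpace NA) x).hasSum h1
  have h3 := (lp.evalCLM ℂ (fun _ : Fin NA → ℕ => ℂ) 2 k).hasSum h2
  refine h3.congr_fun fun l => ?_
  rw [mul_comm]
  rfl

/-- Joint exponential decay of the amplitudes of the composite system. -/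
def BipartiteExpDecay (ψ : (Fin NA → ℕ) × (Fin NB → ℕ) → ℂ) : Prop :=
  ∃ C r : ℝ, 0 < r ∧ r < 1 ∧ ∀ k l, ‖ψ (k, l)‖ ≤ C * r ^ (∑ i, k i) * r ^ (∑ i, l i)

end Reduced

/-! ### Positivity and compactness of convergent sums of operators. -/

section Operators

variable {H : Type} [NormedAddCommGroup H] [InnerProductSpace ℂ H] [CompleteSpace H]

omit [CompleteSpace H] in
theorem isPositive_of_hasSum {κ : Type*} {F : κ → H →L[ℂ] H} {T : H →L[ℂ] H} (h : HasSum F T)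
    (hF : ∀ i, (F i).IsPositive) : T.IsPositive := by
  have h1 : ∀ x, HasSum (fun i => F i x) (T x) := fun x =>
    (ContinuousLinearMap.apply ℂ H x).hasSum h
  have h2 : ∀ x y, HasSum (fun i => ⟪y, F i x⟫_ℂ) ⟪y, T x⟫_ℂ := fun x y =>
    (innerSL ℂ y).hasSum (h1 x)
  refine ⟨fun x y => ?_, fun x => ?_⟩
  · have h3 := Complex.hasSum_conj'.2 (h2 x y)
    simp only [inner_conj_symm] at h3
    refine h3.unique ?_
    have h4 : ∀ i, ⟪F i x, y⟫_ℂ = ⟪x, F i y⟫_ℂ := fun i => (hF i).isSymmetric x y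
    simp only [h4]
    exact h2 y x
  · have h3 := Complex.reCLM.hasSum (h2 x x)
    rw [ContinuousLinearMap.reApplyInnerSelf_apply, ← inner_conj_symm, RCLike.conj_re]
    exact h3.nonneg fun i => (hF i).re_inner_nonneg_right x

theorem isCompactOperator_of_hasSum {κ : Type*} {F : κ → H →L[ℂ] H} {T : H →L[ℂ] H}
    (h : HasSum F T) (hF : ∀ i, IsCompactOperator (F i)) : IsCompactOperator T := by
  refine isCompactOperator_of_tendsto h (.of_forall fun s => ?_)
  exact Submodule.sum_mem (compactOperator (RingHom.id ℂ) H H) fun l _ => hF l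

omit [CompleteSpace H] in
theorem isCompactOperator_rankOne (x y : H) :
    IsCompactOperator (InnerProductSpace.rankOne ℂ x y) :=
  (isCompactOperator_of_locallyCompactSpace_rng
    (ContinuousLinearMap.toSpanSingleton ℂ x)).comp_clm (innerSL ℂ y)

end Operators

/-! ### Decay, intertwining and trace of the reduced density operator. -/

section Reduced

variable {NA NB : ℕ}

theorem slice_apply (ψ : BipartiteFockSpace NA NB) (l : Fin NB → ℕ) (k : Fin NA → ℕ) :
    slice ψ l k = ψ (k, l) := rfl

theorem BipartiteExpDecay.left {ψ : (Fin NA → ℕ) × (Fin NB → ℕ) → ℂ} (h : BipartiteExpDecay ψ)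
    (l : Fin NB → ℕ) : ExpDecay fun k => ψ (k, l) := by
  obtain ⟨C, r, hr0, hr1, h⟩ := h
  exact ⟨C * r ^ (∑ i, l i), r, hr0, hr1, fun k => (h k l).trans_eq (by ring)⟩

theorem BipartiteExpDecay.right {ψ : (Fin NA → ℕ) × (Fin NB → ℕ) → ℂ} (h : BipartiteExpDecay ψ)
    (k : Fin NA → ℕ) : ExpDecay fun l => ψ (k, l) := by
  obtain ⟨C, r, hr0, hr1, h⟩ := h
  exact ⟨C * r ^ (∑ i, k i), r, hr0, hr1, fun l => h k l⟩

theorem norm_slice_le {ψ : BipartiteFockSpace NA NB} (h : BipartiteExpDecay ψ) :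
    ∃ C r : ℝ, 0 < r ∧ r < 1 ∧ ∀ l, ‖slice ψ l‖ ≤ C * r ^ (∑ i, l i) := by
  obtain ⟨C, r, hr0, hr1, h⟩ := h
  have hC : 0 ≤ C := by simpa using (norm_nonneg _).trans (h 0 0)
  have hs := summable_pow_sum (n := NA) (sq_nonneg r) (by nlinarith)
  refine ⟨C * Real.sqrt (∑' k : Fin NA → ℕ, (r ^ 2) ^ (∑ i, k i)), r, hr0, hr1, fun l => ?_⟩
  have h0 : 0 ≤ ∑' k : Fin NA → ℕ, (r ^ 2) ^ (∑ i, k i) := tsum_nonneg fun _ => by positivity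
  refine abs_le_of_sq_le_sq' ?_ (by positivity) |>.2
  have e := lp.norm_rpow_eq_tsum (p := 2) (by norm_num) (slice ψ l)
  simp only [ENNReal.toReal_ofNat, Real.rpow_two] at e
  rw [e, mul_pow, mul_pow, Real.sq_sqrt h0]
  have e2 : C ^ 2 * (∑' k : Fin NA → ℕ, (r ^ 2) ^ (∑ i, k i)) * (r ^ (∑ i, l i)) ^ 2 =
      ∑' k : Fin NA → ℕ, C ^ 2 * (r ^ (∑ i, l i)) ^ 2 * (r ^ 2) ^ (∑ i, k i) := by
    rw [tsum_mul_left]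
    ring
  rw [e2]
  have hm := (lp.memℓp (slice ψ l)).summable (by norm_num)
  simp only [ENNReal.toReal_ofNat, Real.rpow_two] at hm
  refine hm.tsum_le_tsum (fun k => ?_) (hs.mul_left _)
  calc ‖slice ψ l k‖ ^ 2 ≤ (C * r ^ (∑ i, k i) * r ^ (∑ i, l i)) ^ 2 :=
        pow_le_pow_left₀ (norm_nonneg _) (h k l) 2
    _ = _ := by ring

theorem expDecay_inner_slice {ψ : BipartiteFockSpace NA NB} (h : BipartiteExpDecay ψ)
    (x : FockSpace NA) : ExpDecay fun l => ⟪slice ψ l, x⟫_ℂ := by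
  obtain ⟨C, r, hr0, hr1, h⟩ := norm_slice_le h
  refine ⟨C * ‖x‖, r, hr0, hr1, fun l => (norm_inner_le_norm _ _).trans ?_⟩
  calc _ ≤ C * r ^ (∑ i, l i) * ‖x‖ := by gcongr; exact h l
    _ = _ := by ring

/-- This holds for arbitrary `x`, so eigenvectors of nonzero eigenvalue decay exponentially and
ladder operators may be applied to them. -/
theorem expDecay_reducedDensity {ψ : BipartiteFockSpace NA NB} (h : BipartiteExpDecay ψ)
    (x : FockSpace NA) : ExpDecay (reducedDensity ψ x) := by
  obtain ⟨C, r, hr0, hr1, hC⟩ := id h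
  have hC0 : 0 ≤ C := by simpa using (norm_nonneg _).trans (hC 0 0)
  obtain ⟨C', r', hr0', hr1', hC'⟩ := expDecay_inner_slice h x
  refine ⟨∑' l : Fin NB → ℕ, C * C' * r' ^ (∑ i, l i), r, hr0, hr1, fun k => ?_⟩
  have hs := ((summable_pow_sum (n := NB) hr0'.le hr1').mul_left (C * C')).hasSum.mul_right
    (r ^ (∑ i, k i))
  rw [← (reducedDensity_apply ψ x k).tsum_eq]
  refine tsum_of_norm_bounded hs fun l => ?_
  rw [norm_mul]
  calc _ ≤ C * r ^ (∑ i, k i) * 1 * (C' * r' ^ (∑ i, l i)) :=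
        mul_le_mul ((hC k l).trans (by gcongr; exact pow_le_one₀ hr0.le hr1.le)) (hC' l)
          (norm_nonneg _) (by positivity)
    _ = _ := by ring

theorem onA_apply (O : Module.End ℂ ((Fin NA → ℕ) → ℂ)) (f : (Fin NA → ℕ) × (Fin NB → ℕ) → ℂ)
    (k : Fin NA → ℕ) (l : Fin NB → ℕ) : onA O f (k, l) = O (fun k => f (k, l)) k := rfl

theorem onB_apply (O : Module.End ℂ ((Fin NB → ℕ) → ℂ)) (f : (Fin NA → ℕ) × (Fin NB → ℕ) → ℂ)
    (k : Fin NA → ℕ) (l : Fin NB → ℕ) : onB O f (k, l) = O (fun l => f (k, l)) l := rfl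

/-- If `O₁ ⊗ 1` and `O₁' ⊗ 1` act on `ψ` like `1 ⊗ O₂` and `1 ⊗ O₂†`, then `O₁ ρ = ρ O₁'†`. -/
theorem ladder_reducedDensity {ψ : BipartiteFockSpace NA NB} (hψ : BipartiteExpDecay ψ)
    {α₁ β₁ α₁' β₁' : Fin NA → ℂ} {w₁ w₁' : ℂ} {α₂ β₂ : Fin NB → ℂ} {w₂ : ℂ}
    (h₁ : onA (ladder α₁ β₁ w₁) (ψ : (Fin NA → ℕ) × (Fin NB → ℕ) → ℂ) =
      onB (ladder α₂ β₂ w₂) (ψ : (Fin NA → ℕ) × (Fin NB → ℕ) → ℂ))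
    (h₂ : onA (ladder α₁' β₁' w₁') (ψ : (Fin NA → ℕ) × (Fin NB → ℕ) → ℂ) =
      onB (ladder (fun i => conj (β₂ i)) (fun i => conj (α₂ i)) (conj w₂))
        (ψ : (Fin NA → ℕ) × (Fin NB → ℕ) → ℂ))
    {φ χ : FockSpace NA} (hφ : ExpDecay φ)
    (hχ : (χ : (Fin NA → ℕ) → ℂ) =
      ladder (fun i => conj (β₁' i)) (fun i => conj (α₁' i)) (conj w₁') φ) :
    ladder α₁ β₁ w₁ (reducedDensity ψ φ) = reducedDensity ψ χ := by
  funext k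
  have hD : ExpDecay fun l => ⟪φ, slice ψ l⟫_ℂ := by
    simpa using (expDecay_inner_slice hψ φ).conj
  -- The partial product of `φ` with `ψ` is an amplitude on `B`. The adjoint of `O₂` acts on it
  -- through `ψ`, is traded for `O₁'` by `h₂`, and then moves onto `φ` as its adjoint, giving `χ`.
  have hDχ : ∀ l, ladder (fun i => conj (β₂ i)) (fun i => conj (α₂ i)) (conj w₂)
      (fun l => ⟪φ, slice ψ l⟫_ℂ) l = ⟪χ, slice ψ l⟫_ℂ := by
    intro l
    have hs : ∀ l, HasSum (fun k => ψ (k, l) * conj (φ k)) ⟪φ, slice ψ l⟫_ℂ := by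
      intro l
      rw [inner_eq_pair, pair]
      have := (hφ.conj.summable_mul (hψ.left l)).hasSum
      exact this.congr_fun fun k => mul_comm _ _
    have h := hasSum_ladder hs (fun i => conj (β₂ i)) (fun i => conj (α₂ i)) (conj w₂) l
    have e : ∀ k, ladder (fun i => conj (β₂ i)) (fun i => conj (α₂ i)) (conj w₂)
        (fun l => ψ (k, l) * conj (φ k)) l =
        conj (φ k) * ladder α₁' β₁' w₁' (slice ψ l) k := by
      intro k
      have e1 : (fun l => ψ (k, l) * conj (φ k)) = conj (φ k) • fun l => ψ (k, l) := by
        funext l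
        simp [mul_comm]
      have e2 := congrFun h₂ (k, l)
      rw [onA_apply, onB_apply] at e2
      rw [e1, map_smul, Pi.smul_apply, smul_eq_mul, ← e2]
      rfl
    simp only [e] at h
    rw [← h.tsum_eq]
    have h3 := pair_ladder hφ (show ExpDecay (slice ψ l) from hψ.left l) α₁' β₁' w₁'
    rw [← hχ, ← inner_eq_pair] at h3
    exact h3
  have hs := hasSum_ladder (reducedDensity_apply ψ φ) α₁ β₁ w₁ k
  have e : ∀ l, ladder α₁ β₁ w₁ (fun k => ψ (k, l) * ⟪slice ψ l, φ⟫_ℂ) k =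
      conj ⟪φ, slice ψ l⟫_ℂ * ladder α₂ β₂ w₂ (fun l => ψ (k, l)) l := by
    intro l
    have e1 : (fun k => ψ (k, l) * ⟪slice ψ l, φ⟫_ℂ) = ⟪slice ψ l, φ⟫_ℂ • fun k => ψ (k, l) := by
      funext k
      simp [mul_comm]
    have e2 := congrFun h₁ (k, l)
    rw [onA_apply, onB_apply] at e2
    rw [e1, map_smul, Pi.smul_apply, smul_eq_mul, e2, inner_conj_symm]
  simp only [e] at hs
  rw [← hs.tsum_eq, ← (reducedDensity_apply ψ χ k).tsum_eq]
  -- After `h₁` has traded `O₁` for `O₂`, the sum over `l` is a scalar product on `B`, in which `O₂`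
  -- passes to the other side as its adjoint.
  change pair (fun l => ⟪φ, slice ψ l⟫_ℂ) (ladder α₂ β₂ w₂ fun l => ψ (k, l)) = _
  rw [pair_ladder hD (hψ.right k), pair]
  refine tsum_congr fun l => ?_
  rw [hDχ, inner_conj_symm, mul_comm]

theorem isPositive_reducedDensity (ψ : BipartiteFockSpace NA NB) :
    (reducedDensity ψ).IsPositive :=
  isPositive_of_hasSum (summable_reducedDensity ψ).hasSum
    fun _ => InnerProductSpace.isPositive_rankOne_self _

theorem isCompactOperator_reducedDensity (ψ : BipartiteFockSpace NA NB) :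
    IsCompactOperator (reducedDensity ψ) :=
  isCompactOperator_of_hasSum (summable_reducedDensity ψ).hasSum
    fun _ => isCompactOperator_rankOne _ _

/-- The trace of the reduced density operator is the squared norm of the state. -/
theorem HasTrace.eq_norm_sq_of_reducedDensity {ψ : BipartiteFockSpace NA NB} {t : ℂ}
    (h : HasTrace (reducedDensity ψ) t) : t = (‖ψ‖ ^ 2 : ℝ) := by
  let b : HilbertBasis (Fin NA → ℕ) ℂ (FockSpace NA) := ⟨LinearIsometryEquiv.refl ℂ _⟩
  have hb : ∀ (x : FockSpace NA) k, ⟪b k, x⟫_ℂ = x k := fun x k => (b.repr_apply_apply x k).symm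
  have h1 := h _ b
  have e := lp.norm_rpow_eq_tsum (p := 2) (by norm_num) ψ
  simp only [ENNReal.toReal_ofNat, Real.rpow_two] at e
  have hm := (lp.memℓp ψ).summable (by norm_num)
  simp only [ENNReal.toReal_ofNat, Real.rpow_two] at hm
  have h2 : HasSum (fun x => ((‖ψ x‖ ^ 2 : ℝ) : ℂ)) ((‖ψ‖ ^ 2 : ℝ) : ℂ) := by
    rw [e]
    exact Complex.hasSum_ofReal.2 hm.hasSum
  refine h1.unique (h2.prod_fiberwise fun k => ?_)
  rw [hb]
  refine (reducedDensity_apply ψ (b k) k).congr_fun fun l => ?_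
  rw [← inner_conj_symm, hb, slice_apply, Complex.mul_conj, Complex.normSq_eq_norm_sq]

end Reduced

/-! ## Fock states of normal modes -/

section OccupationFamily

variable {V : Type*} [AddCommGroup V] [Module ℂ V] {n : ℕ}

theorem mul_pow_of_ccr {c d : Module.End ℂ V} (h : c * d = d * c + 1) (m : ℕ) :
    c * d ^ m = d ^ m * c + (m : ℂ) • d ^ (m - 1) := by
  induction m with
  | zero => simp
  | succ m ih =>
    rcases m with _ | m
    · simp [h]
    · rw [pow_succ _ (m + 1), ← mul_assoc, ih, add_mul, mul_assoc, h, mul_add, smul_mul_assoc,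
        Nat.add_sub_cancel, Nat.add_sub_cancel, ← pow_succ, mul_one, ← mul_assoc]
      push_cast
      module

/-- Occupation number states `∏ᵢ dᵢ ^ kᵢ v` over a vacuum `v`. -/
theorem exists_occupation_family (c d : Fin n → Module.End ℂ V)
    (hccr : ∀ i j, c i * d j = d j * c i + (if i = j then 1 else 0))
    (hdd : ∀ i j, d i * d j = d j * d i) {v : V} (hv : ∀ i, c i v = 0) :
    ∃ F : (Fin n → ℕ) → V, F 0 = v ∧ (∀ k j, d j (F k) = F (Function.update k j (k j + 1))) ∧
      ∀ k j, c j (F k) = (k j : ℂ) • F (Function.update k j (k j - 1)) := by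
  have hcomm : ∀ (s : Finset (Fin n)) (k : Fin n → ℕ),
      (s : Set (Fin n)).Pairwise (Function.onFun Commute fun i => d i ^ k i) :=
    fun s k i _ j _ _ => Commute.pow_pow (hdd i j) _ _
  -- The product of all factors except the `j`-th one. It commutes with `c j`, so only the power of
  -- `d j` contributes to the commutator.
  let P : (Fin n → ℕ) → Fin n → Module.End ℂ V := fun k j =>
    (Finset.univ.erase j).noncommProd (fun i => d i ^ k i) (hcomm _ k)
  have hsplit : ∀ k j, Finset.univ.noncommProd (fun i => d i ^ k i) (hcomm _ k) =
      d j ^ k j * P k j := fun k j =>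
    (Finset.mul_noncommProd_erase _ (Finset.mem_univ j) _ _).symm
  have hP : ∀ k j m, P (Function.update k j m) j = P k j := by
    intro k j m
    refine Finset.noncommProd_congr rfl (fun i hi => ?_) _
    rw [Function.update_of_ne (Finset.ne_of_mem_erase hi)]
  have hcP : ∀ k j, c j * P k j = P k j * c j := by
    intro k j
    refine Finset.noncommProd_commute _ _ _ _ fun i hi => ?_
    have : Commute (c j) (d i) := by
      have := hccr j i
      rwa [if_neg (Finset.ne_of_mem_erase hi).symm, add_zero] at this
    exact this.pow_right _
  refine ⟨fun k => Finset.univ.noncommProd (fun i => d i ^ k i) (hcomm _ k) v, ?_, ?_, ?_⟩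
  · dsimp only
    rw [Finset.noncommProd_eq_pow_card _ _ _ 1 (by simp)]
    simp
  · intro k j
    dsimp only
    rw [hsplit k j, hsplit _ j, hP, Function.update_self, pow_succ', ← Module.End.mul_apply,
      mul_assoc]
  · intro k j
    dsimp only
    have h1 : c j * d j = d j * c j + 1 := by simpa using hccr j j
    rw [hsplit k j, hsplit _ j, hP, Function.update_self, ← Module.End.mul_apply, ← mul_assoc,
      mul_pow_of_ccr h1, add_mul, mul_assoc, hcP, ← mul_assoc, smul_mul_assoc, LinearMap.add_apply,
      Module.End.mul_apply _ (c j), hv]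
    simp

end OccupationFamily

/-- Annihilation operators `cᵢ = ∑ⱼ αᵢⱼ aⱼ + ∑ⱼ βᵢⱼ aⱼ† + wᵢ` of normal modes, satisfying the
canonical commutation relations. -/
structure NormalModes (n : ℕ) where
  α : Matrix (Fin n) (Fin n) ℂ
  β : Matrix (Fin n) (Fin n) ℂ
  w : Fin n → ℂ
  ccr : α * αᴴ - β * βᴴ = 1
  comm : α * βᵀ = β * αᵀ

namespace NormalModes

variable {n : ℕ} (M : NormalModes n)

/-- The annihilation operator of a normal mode. -/
def c (i : Fin n) : Module.End ℂ ((Fin n → ℕ) → ℂ) := ladder (M.α i) (M.β i) (M.w i)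

/-- The creation operator of a normal mode. -/
def d (i : Fin n) : Module.End ℂ ((Fin n → ℕ) → ℂ) :=
  ladder (fun j => conj (M.β i j)) (fun j => conj (M.α i j)) (conj (M.w i))

theorem c_mul_d (i j : Fin n) : M.c i * M.d j = M.d j * M.c i + (if i = j then 1 else 0) := by
  have h := congrFun (congrFun M.ccr i) j
  rw [c, d, ladder_commutator]
  simp only [Matrix.sub_apply, Matrix.mul_apply, Matrix.conjTranspose_apply,
    ← Finset.sum_sub_distrib] at h
  change ∑ x, (M.α i x * conj (M.α j x) - M.β i x * conj (M.β j x)) = _ at h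
  rw [h, Matrix.one_apply]
  split_ifs <;> simp

theorem d_mul_d (i j : Fin n) : M.d i * M.d j = M.d j * M.d i := by
  have h := congrArg conj (congrFun (congrFun M.comm i) j)
  simp only [Matrix.mul_apply, Matrix.transpose_apply, map_sum, map_mul] at h
  rw [d, d, ladder_commutator, Finset.sum_sub_distrib, h]
  simp

open scoped ComplexOrder in
-- By the commutation relations `α αᴴ = 1 + β βᴴ`, which is positive definite.
theorem exists_left_inverse : ∃ γ : Matrix (Fin n) (Fin n) ℂ, γ * M.α = 1 := by
  have h : (M.α * M.αᴴ).PosDef := by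
    rw [sub_eq_iff_eq_add.1 M.ccr]
    exact Matrix.PosDef.one.add_posSemidef (Matrix.posSemidef_self_mul_conjTranspose _)
  have h1 := h.isUnit
  rw [Matrix.isUnit_iff_isUnit_det, Matrix.det_mul] at h1
  have h2 : IsUnit M.α := (Matrix.isUnit_iff_isUnit_det _).2 (isUnit_of_mul_isUnit_left h1)
  exact h2.exists_left_inv

theorem expDecay_c {f : (Fin n → ℕ) → ℂ} (hf : ExpDecay f) (i : Fin n) : ExpDecay (M.c i f) :=
  hf.ladder _ _ _

theorem expDecay_d {f : (Fin n → ℕ) → ℂ} (hf : ExpDecay f) (i : Fin n) : ExpDecay (M.d i f) :=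
  hf.ladder _ _ _

theorem pair_d {f g : (Fin n → ℕ) → ℂ} (hf : ExpDecay f) (hg : ExpDecay g) (i : Fin n) :
    pair f (M.d i g) = pair (M.c i f) g := by
  rw [d, pair_ladder hf hg]
  simp [c]

theorem pair_c {f g : (Fin n → ℕ) → ℂ} (hf : ExpDecay f) (hg : ExpDecay g) (i : Fin n) :
    pair f (M.c i g) = pair (M.d i f) g := by
  rw [← conj_pair, ← M.pair_d hg hf, conj_pair]

theorem update_sub_one_eq_iff {k k' : Fin n → ℕ} {j : Fin n} (hk : 0 < k j) (hk' : 0 < k' j) :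
    Function.update k j (k j - 1) = Function.update k' j (k' j - 1) ↔ k = k' := by
  refine ⟨fun h => ?_, fun h => by rw [h]⟩
  have h1 := congrArg (fun f : Fin n → ℕ => Function.update f j (f j + 1)) h
  simpa [Nat.sub_add_cancel (show 1 ≤ k j from hk), Nat.sub_add_cancel (show 1 ≤ k' j from hk')]
    using h1

theorem exists_lower {k : Fin n → ℕ} (hk : k ≠ 0) : ∃ (k' : Fin n → ℕ) (j : Fin n),
    k = Function.update k' j (k' j + 1) ∧ k' = Function.update k j (k j - 1) ∧ 0 < k j ∧
      ∑ i, k' i < ∑ i, k i := by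
  obtain ⟨j, hj⟩ := Function.ne_iff.1 hk
  have hj : 0 < k j := Nat.pos_of_ne_zero hj
  refine ⟨Function.update k j (k j - 1), j, ?_, rfl, hj, ?_⟩
  · simp [Nat.sub_add_cancel (show 1 ≤ k j from hj)]
  · have := sum_update_sub_one hj
    omega

theorem occupation_induction {p : (Fin n → ℕ) → Prop} (h0 : p 0)
    (hs : ∀ k j, p k → p (Function.update k j (k j + 1))) (k : Fin n → ℕ) : p k := by
  induction hm : ∑ i, k i using Nat.strong_induction_on generalizing k with
  | _ m ih =>
    by_cases hk : k = 0
    · rwa [hk]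
    · obtain ⟨k', j, h1, -, -, h2⟩ := exists_lower hk
      rw [h1]
      exact hs k' j (ih _ (hm ▸ h2) k' rfl)

theorem pair_occupation_family {F : (Fin n → ℕ) → (Fin n → ℕ) → ℂ} (hE : ∀ k, ExpDecay (F k))
    (h0 : ∀ i, M.c i (F 0) = 0) (h1 : pair (F 0) (F 0) = 1)
    (hd : ∀ k j, M.d j (F k) = F (Function.update k j (k j + 1)))
    (hc : ∀ k j, M.c j (F k) = (k j : ℂ) • F (Function.update k j (k j - 1)))
    (k k' : Fin n → ℕ) :
    pair (F k) (F k') = if k = k' then ∏ i, ((k i).factorial : ℂ) else 0 := by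
  induction k using occupation_induction generalizing k' with
  | h0 =>
    by_cases hk' : k' = 0
    · simp [hk', h1]
    · obtain ⟨l, j, h2, -, -, -⟩ := exists_lower hk'
      rw [if_neg (Ne.symm hk'), h2, ← hd, M.pair_d (hE _) (hE _), h0]
      simp [pair]
  | hs k j ih =>
    -- A creator on the left becomes an annihilator on the right, which lowers `k' j` and yields the
    -- factor `k' j`; for `k' j = 0` this factor vanishes.
    rw [← hd, ← M.pair_c (hE _) (hE _), hc, pair_smul, ih]
    rcases Nat.eq_zero_or_pos (k' j) with h | h
    · have : Function.update k j (k j + 1) ≠ k' := by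
        rintro rfl
        simp at h
      simp [h, this]
    · have e : k = Function.update k' j (k' j - 1) ↔ Function.update k j (k j + 1) = k' := by
        rw [← update_sub_one_eq_iff (j := j) (by simp) h]
        simp
      by_cases hk : Function.update k j (k j + 1) = k'
      · rw [if_pos (e.2 hk), if_pos hk, ← hk, Function.update_self,
          ← Finset.mul_prod_erase _ _ (Finset.mem_univ j),
          ← Finset.mul_prod_erase _ (fun i => ((Function.update k j (k j + 1) i).factorial : ℂ))
            (Finset.mem_univ j), Function.update_self, Nat.factorial_succ]
        have : ∏ i ∈ Finset.univ.erase j, ((Function.update k j (k j + 1) i).factorial : ℂ) =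
            ∏ i ∈ Finset.univ.erase j, ((k i).factorial : ℂ) :=
          Finset.prod_congr rfl fun i hi => by
            rw [Function.update_of_ne (Finset.ne_of_mem_erase hi)]
        rw [this]
        push_cast
        ring
      · rw [if_neg (fun h => hk (e.1 h)), if_neg hk, mul_zero]

/-- Uniqueness of the vacuum: a solution is determined by its amplitude at `0`, so subtracting a
multiple that cancels this amplitude leaves zero. -/
theorem eq_smul_of_c_eq_zero {f g : (Fin n → ℕ) → ℂ} (hf : ∀ i, M.c i f = 0)
    (hg : ∀ i, M.c i g = 0) (hf0 : f ≠ 0) : ∃ a : ℂ, g = a • f := by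
  obtain ⟨γ, hγ⟩ := M.exists_left_inverse
  have h0 : f 0 ≠ 0 := fun h => hf0 (eq_zero_of_ladder_eq_zero hγ hf h)
  refine ⟨g 0 / f 0, ?_⟩
  have := eq_zero_of_ladder_eq_zero hγ (f := g - (g 0 / f 0) • f) (w := M.w) (β := M.β)
    (fun i => by
      have e1 := hf i
      have e2 := hg i
      rw [c] at e1 e2
      rw [map_sub, map_smul, e1, e2]
      simp)
    (by simp [h0])
  exact sub_eq_zero.1 this

variable {ρ : FockSpace n →L[ℂ] FockSpace n} {l : Fin n → ℝ}

/-- For an eigenvector `φ` of eigenvalue `μ`, the relation `c ρ = λ ρ c` makes `c φ` an eigenvector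
of eigenvalue `μ/λ` (or zero, if `λ = 0`). Near-maximality of `μ` then excludes `c φ ≠ 0`. The
subspace `K` is general because the lemma serves both on the whole space and on the complement of
the Fock family. -/
theorem exists_vacuum (hcpt : IsCompactOperator ρ) (hpos : ρ.IsPositive)
    (hE : ∀ x, ExpDecay (ρ x)) (hl1 : ∀ i, l i < 1) (hl0 : ∀ i, 0 ≤ l i)
    (hc : ∀ (i : Fin n) (φ χ : FockSpace n), ExpDecay φ → (χ : (Fin n → ℕ) → ℂ) = M.c i φ →
      M.c i (ρ φ) = (l i : ℂ) • (ρ χ : (Fin n → ℕ) → ℂ))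
    (K : Submodule ℂ (FockSpace n)) (hK : IsClosed (K : Set (FockSpace n)))
    (hρK : ∀ x ∈ K, ρ x ∈ K)
    (hcK : ∀ (i : Fin n) (φ χ : FockSpace n), ExpDecay φ → (χ : (Fin n → ℕ) → ℂ) = M.c i φ →
      φ ∈ K → χ ∈ K)
    {x : FockSpace n} (hx : x ∈ K) (hρx : ρ x ≠ 0) :
    ∃ μ : ℝ, 0 < μ ∧ ∃ φ ∈ K, φ ≠ 0 ∧ ExpDecay φ ∧ ρ φ = (μ : ℂ) • φ ∧ ∀ i, M.c i φ = 0 := by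
  obtain ⟨L, hL1, hL⟩ : ∃ L < 1, ∀ i, l i ≤ L := by
    rcases isEmpty_or_nonempty (Fin n) with h | h
    · exact ⟨0, one_pos, fun i => h.elim i⟩
    · obtain ⟨i, hi⟩ := Finite.exists_max l
      exact ⟨l i, hl1 i, hi⟩
  obtain ⟨μ, hμ, φ, hφ, hne, hρφ, hmax⟩ :=
    exists_eigenvector_almost_max hcpt hpos K hK hρK hx hρx hL1
  have hμ' : (μ : ℂ) ≠ 0 := Complex.ofReal_ne_zero.2 hμ.ne'
  have hφE : ExpDecay φ := by
    have h := (hE φ).smul (μ : ℂ)⁻¹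
    rwa [hρφ, lp.coeFn_smul, smul_smul, inv_mul_cancel₀ hμ', one_smul] at h
  refine ⟨μ, hμ, φ, hφ, hne, hφE, hρφ, fun i => ?_⟩
  let χ : FockSpace n := (M.expDecay_c hφE i).toFock
  have hχ : (χ : (Fin n → ℕ) → ℂ) = M.c i φ := rfl
  have h1 : μ • χ = (l i : ℂ) • ρ χ := by
    have h := hc i φ χ hφE hχ
    rw [hρφ, lp.coeFn_smul, map_smul, ← hχ] at h
    exact lp.ext h
  have h2 : χ = 0 := by
    rcases (hl0 i).eq_or_lt with h | h
    · rw [← h, Complex.ofReal_zero, zero_smul] at h1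
      exact (smul_eq_zero.1 h1).resolve_left hμ.ne'
    · have hl' : (l i : ℂ) ≠ 0 := Complex.ofReal_ne_zero.2 h.ne'
      refine hmax (μ / l i) χ (hcK i φ χ hφE hχ hφ) ?_ ?_
      · have h3 := congrArg (fun y => (l i : ℂ)⁻¹ • y) h1
        rw [smul_smul, inv_mul_cancel₀ hl', one_smul] at h3
        rw [← h3]
        change (l i : ℂ)⁻¹ • ((μ : ℂ) • χ) = _
        rw [smul_smul]
        push_cast
        rw [div_eq_inv_mul]
      · rw [← mul_div_assoc, le_div_iff₀ h, mul_comm]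
        exact mul_le_mul_of_nonneg_right (hL i) hμ.le
  rw [← hχ, h2]
  rfl

/-- An operator that is lowered by normal modes is diagonal in the Fock states of these modes. -/
theorem exists_isDiagonal (hcpt : IsCompactOperator ρ) (hpos : ρ.IsPositive)
    (hE : ∀ x, ExpDecay (ρ x)) (hl1 : ∀ i, l i < 1) (hl0 : ∀ i, 0 ≤ l i)
    (hc : ∀ (i : Fin n) (φ χ : FockSpace n), ExpDecay φ → (χ : (Fin n → ℕ) → ℂ) = M.c i φ →
      M.c i (ρ φ) = (l i : ℂ) • (ρ χ : (Fin n → ℕ) → ℂ))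
    (hd : ∀ (i : Fin n) (φ χ : FockSpace n), ExpDecay φ → (χ : (Fin n → ℕ) → ℂ) = M.d i φ →
      (ρ χ : (Fin n → ℕ) → ℂ) = (l i : ℂ) • M.d i (ρ φ))
    (hρ : ρ ≠ 0) :
    ∃ (e : (Fin n → ℕ) → FockSpace n) (μ : ℝ), 0 < μ ∧
      IsDiagonal ρ e fun k => μ * ∏ i, l i ^ k i := by
  obtain ⟨x, hx⟩ : ∃ x, ρ x ≠ 0 := by
    by_contra! h
    exact hρ (ContinuousLinearMap.ext h)
  obtain ⟨μ, hμ, φ₀, -, hne, hφE, hρφ, hcφ⟩ := M.exists_vacuum hcpt hpos hE hl1 hl0 hc ⊤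
    isClosed_univ (fun _ _ => trivial) (fun _ _ _ _ _ _ => trivial) (x := x) trivial hx
  obtain ⟨v, hvE, hρv, hcv, hv1⟩ : ∃ v : FockSpace n, ExpDecay v ∧ ρ v = (μ : ℂ) • v ∧
      (∀ i, M.c i v = 0) ∧ ‖v‖ = 1 := by
    have hn : (‖φ₀‖ : ℂ) ≠ 0 := by simpa using hne
    refine ⟨(‖φ₀‖ : ℂ)⁻¹ • φ₀, hφE.smul _, ?_, fun i => ?_, ?_⟩
    · rw [map_smul, hρφ, smul_comm]
    · rw [lp.coeFn_smul, map_smul, hcφ, smul_zero]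
    · rw [norm_smul, norm_inv, Complex.norm_real, norm_norm, inv_mul_cancel₀ (by simpa using hne)]
  obtain ⟨F, hF0, hFd, hFc⟩ := exists_occupation_family M.c M.d M.c_mul_d M.d_mul_d hcv
  have hFE : ∀ k, ExpDecay (F k) := fun k => by
    induction k using occupation_induction with
    | h0 => rwa [hF0]
    | hs k j ih =>
      rw [← hFd]
      exact M.expDecay_d ih j
  have hpair := M.pair_occupation_family hFE (fun i => by rw [hF0, hcv])
    (by rw [hF0, ← inner_eq_pair, inner_self_eq_norm_sq_to_K, hv1]; simp) hFd hFc
  let f : (Fin n → ℕ) → FockSpace n := fun k => (hFE k).toFock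
  have hf : ∀ k k', ⟪f k, f k'⟫_ℂ = if k = k' then ∏ i, ((k i).factorial : ℂ) else 0 := by
    intro k k'
    rw [inner_eq_pair]
    exact hpair k k'
  -- By `ρ d = λ d ρ`, each creator multiplies the eigenvalue by the ratio of its mode.
  have hfρ : ∀ k, ρ (f k) = ((μ * ∏ i, l i ^ k i : ℝ) : ℂ) • f k := fun k => by
    induction k using occupation_induction with
    | h0 =>
      have : f 0 = v := lp.ext hF0
      rw [this, hρv]
      simp
    | hs k j ih =>
      refine lp.ext ?_
      rw [hd j (f k) (f _) (hFE k) (hFd k j).symm, ih, lp.coeFn_smul, map_smul, lp.coeFn_smul,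
        smul_smul]
      have e1 : (f (Function.update k j (k j + 1)) : (Fin n → ℕ) → ℂ) = M.d j (f k) :=
        (hFd k j).symm
      rw [e1]
      congr 1
      rw [← Complex.ofReal_mul]
      congr 1
      rw [← Finset.mul_prod_erase _ _ (Finset.mem_univ j),
        ← Finset.mul_prod_erase _ (fun i => l i ^ Function.update k j (k j + 1) i)
          (Finset.mem_univ j), Function.update_self]
      have : ∏ i ∈ Finset.univ.erase j, l i ^ Function.update k j (k j + 1) i =
          ∏ i ∈ Finset.univ.erase j, l i ^ k i :=
        Finset.prod_congr rfl fun i hi => by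
          rw [Function.update_of_ne (Finset.ne_of_mem_erase hi)]
      rw [this]
      ring
  have hfn : ∀ k, ‖f k‖ ≠ 0 := fun k h => by
    have h1 := hf k k
    rw [if_pos rfl, norm_eq_zero.1 h, inner_zero_left] at h1
    exact Finset.prod_ne_zero_iff.2
      (fun i _ => Nat.cast_ne_zero.2 (Nat.factorial_ne_zero (k i))) h1.symm
  refine ⟨fun k => (‖f k‖ : ℂ)⁻¹ • f k, μ, hμ, ⟨?_, ?_⟩, fun k => ?_, ?_⟩
  · intro k
    rw [norm_smul, norm_inv, Complex.norm_real, norm_norm, inv_mul_cancel₀ (hfn k)]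
  · intro k k' hkk
    rw [inner_smul_left, inner_smul_right, hf, if_neg hkk, mul_zero, mul_zero]
  · rw [map_smul, hfρ, smul_comm]
  · intro x hx
    have hx' : ∀ k, ⟪f k, x⟫_ℂ = 0 := by
      intro k
      have h := hx k
      rw [inner_smul_left, mul_eq_zero] at h
      exact h.resolve_left (by simpa using hfn k)
    -- The complement `K` of the Fock family is invariant under `ρ` and, on decaying vectors, under
    -- the annihilators. If `ρ` did not vanish there, `K` would contain a second vacuum, which is a
    -- multiple of `f 0` and also orthogonal to it.
    by_contra hρx
    let K : Submodule ℂ (FockSpace n) :=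
      { carrier := {x | ∀ k, ⟪f k, x⟫_ℂ = 0}
        add_mem' := fun ha hb k => by rw [inner_add_right, ha k, hb k, add_zero]
        zero_mem' := fun k => inner_zero_right _
        smul_mem' := fun c x hx k => by rw [inner_smul_right, hx k, mul_zero] }
    have hK : IsClosed (K : Set (FockSpace n)) := by
      have : (K : Set (FockSpace n)) = ⋂ k, {x | ⟪f k, x⟫_ℂ = 0} := by
        ext x
        simp [K]
      rw [this]
      exact isClosed_iInter fun k => isClosed_eq (by fun_prop) continuous_const
    obtain ⟨μ', -, φ, hφK, hφ0, hφE, -, hcφ⟩ := M.exists_vacuum hcpt hpos hE hl1 hl0 hc K hK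
      (fun x hx k => by
        rw [← hpos.inner_left_eq_inner_right, hfρ, inner_smul_left, hx k, mul_zero])
      (fun i φ χ hφE hχ hφ k => by
        have h := hφ (Function.update k i (k i + 1))
        rw [inner_eq_pair] at h
        rw [inner_eq_pair, hχ]
        refine (M.pair_c (hFE k) hφE i).trans ?_
        rw [hFd]
        exact h)
      hx' hρx
    obtain ⟨a, ha⟩ := M.eq_smul_of_c_eq_zero hcv hcφ (by
      intro h
      have : v = 0 := lp.ext h
      simp [this] at hv1)
    have h1 : φ = a • f 0 := lp.ext (by rw [ha, lp.coeFn_smul]; congr 1; exact hF0.symm)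
    apply hφ0
    have h2 := hφK 0
    rw [h1, inner_smul_right, mul_eq_zero, inner_self_eq_zero] at h2
    rcases h2 with h2 | h2
    · rw [h1, h2, zero_smul]
    · rw [h1, h2, smul_zero]

end NormalModes

/-! ## Williamson normal form -/

section LinearAlgebra

/-- A real matrix as a complex matrix. -/
abbrev cx {m n : Type*} (A : Matrix m n ℝ) : Matrix m n ℂ := A.map (fun x : ℝ => (x : ℂ))

variable {m : Type*} [Fintype m] [DecidableEq m]

omit [DecidableEq m] in
theorem cx_mul {l n : Type*} (A : Matrix l m ℝ) (B : Matrix m n ℝ) : cx (A * B) = cx A * cx B :=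
  Matrix.map_mul (f := Complex.ofRealHom)

omit [Fintype m] in
theorem cx_one : cx (1 : Matrix m m ℝ) = 1 :=
  Matrix.map_one _ Complex.ofReal_zero Complex.ofReal_one

omit [DecidableEq m] in
theorem map_conj_mul {l n : Type*} (A : Matrix l m ℂ) (B : Matrix m n ℂ) :
    (A * B).map conj = A.map conj * B.map conj := Matrix.map_mul (f := starRingEnd ℂ)

theorem map_conj_cx {l n : Type*} (A : Matrix l n ℝ) : (cx A).map conj = cx A := by
  ext
  simp

theorem map_conj_smul {l n : Type*} (c : ℂ) (A : Matrix l n ℂ) :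
    (c • A).map conj = conj c • A.map conj := by
  ext
  simp

open scoped MatrixOrder in
theorem exists_factor_of_posDef {G : Matrix m m ℝ} (hG : G.PosDef) :
    ∃ B A : Matrix m m ℝ, G = Bᵀ * B ∧ A * B = 1 := by
  obtain ⟨B, hB⟩ := CStarAlgebra.nonneg_iff_eq_star_mul_self.mp hG.posSemidef.nonneg
  have h : G = Bᵀ * B := by
    rw [hB, Matrix.star_eq_conjTranspose, Matrix.conjTranspose_eq_transpose_of_trivial]
  have h1 := hG.isUnit
  rw [h, Matrix.isUnit_iff_isUnit_det, Matrix.det_mul] at h1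
  obtain ⟨A, hA⟩ := ((Matrix.isUnit_iff_isUnit_det _).2
    (isUnit_of_mul_isUnit_right h1)).exists_left_inv
  exact ⟨B, A, h, hA⟩

omit [DecidableEq m] in
theorem star_dotProduct_self_eq (x : m → ℂ) : star x ⬝ᵥ x = ((∑ r, ‖x r‖ ^ 2 : ℝ) : ℂ) := by
  rw [dotProduct, Complex.ofReal_sum]
  refine Finset.sum_congr rfl fun r _ => ?_
  rw [Pi.star_apply, mul_comm, Complex.star_def, Complex.mul_conj, Complex.normSq_eq_norm_sq]

/-- Positive part of the spectrum of an imaginary antisymmetric matrix. -/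
theorem exists_positive_eigenvectors {n : ℕ} (hm : Fintype.card m = 2 * n) {M : Matrix m m ℂ}
    (hM : M.IsHermitian) (hM' : M.map conj = -M) (hdet : M.det ≠ 0) :
    ∃ (X : Matrix (Fin n) m ℂ) (ν : Fin n → ℝ), (∀ i, 0 < ν i) ∧
      X * M = Matrix.diagonal (fun i => (ν i : ℂ)) * X ∧ X * Xᴴ = 1 ∧ X * Xᵀ = 0 := by
  let κ := hM.eigenvalues
  let u : m → m → ℂ := fun r => hM.eigenvectorBasis r
  have hu : ∀ r, M *ᵥ u r = (κ r : ℂ) • u r := fun r => by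
    simpa using hM.mulVec_eigenvectorBasis r
  have horth : ∀ r s, star (u r) ⬝ᵥ u s = if r = s then 1 else 0 := fun r s => by
    have h := (orthonormal_iff_ite.1 hM.eigenvectorBasis.orthonormal) r s
    rw [EuclideanSpace.inner_eq_star_dotProduct] at h
    rw [← h, dotProduct_comm]
  have hconj : ∀ r, M *ᵥ star (u r) = (-κ r : ℂ) • star (u r) := fun r => by
    have h := congrArg star (hu r)
    rw [Matrix.star_mulVec, ← Matrix.mulVec_transpose] at h
    have : (Mᴴ)ᵀ = -M := by rw [← hM']; rfl
    rw [this, Matrix.neg_mulVec] at h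
    rw [← neg_eq_iff_eq_neg.2 h.symm, star_smul]
    simp
  -- A Hermitian matrix that conjugation negates is antisymmetric, so the bilinear product of two
  -- eigenvectors vanishes unless their eigenvalues are opposite.
  have hcross : ∀ r s, κ r + κ s ≠ 0 → u r ⬝ᵥ u s = 0 := by
    intro r s hrs
    have h1 : u r ⬝ᵥ (M *ᵥ u s) = κ s * (u r ⬝ᵥ u s) := by rw [hu, dotProduct_smul, smul_eq_mul]
    have h2 : u r ⬝ᵥ (M *ᵥ u s) = -κ r * (u r ⬝ᵥ u s) := by
      rw [Matrix.dotProduct_mulVec]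
      have : u r ᵥ* M = (-κ r : ℂ) • u r := by
        have h := congrArg star (hconj r)
        rw [Matrix.star_mulVec, star_star, hM.eq, star_smul, star_star] at h
        simpa using h
      rw [this, smul_dotProduct, smul_eq_mul]
    have h3 : ((κ r + κ s : ℝ) : ℂ) * (u r ⬝ᵥ u s) = 0 := by
      push_cast
      linear_combination h1.symm.trans h2
    exact (mul_eq_zero.1 h3).resolve_left (Complex.ofReal_ne_zero.2 hrs)
  -- If no two eigenvalues in a set are opposite, the eigenvectors together with their conjugates
  -- are orthonormal, so the set has at most half the dimension.
  have hcard : ∀ p : m → Prop, [DecidablePred p] → (∀ r s, p r → p s → κ r + κ s ≠ 0) →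
      Fintype.card {r // p r} ≤ n := by
    intro p _ hp
    let g : {r // p r} ⊕ {r // p r} → EuclideanSpace ℂ m :=
      Sum.elim (fun r => WithLp.toLp 2 (u r)) (fun r => WithLp.toLp 2 (star (u r)))
    have hg : Orthonormal ℂ g := by
      rw [orthonormal_iff_ite]
      rintro (⟨r, hr⟩ | ⟨r, hr⟩) (⟨s, hs⟩ | ⟨s, hs⟩)
      · simp only [g, Sum.elim_inl, EuclideanSpace.inner_toLp_toLp]
        rw [dotProduct_comm, horth]
        simp
      · simp only [g, Sum.elim_inl, Sum.elim_inr, EuclideanSpace.inner_toLp_toLp]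
        rw [Matrix.star_dotProduct_star, hcross r s (hp r s hr hs)]
        simp
      · simp only [g, Sum.elim_inl, Sum.elim_inr, EuclideanSpace.inner_toLp_toLp]
        rw [star_star, hcross s r (hp s r hs hr)]
        simp
      · simp only [g, Sum.elim_inr, EuclideanSpace.inner_toLp_toLp]
        rw [star_star, horth]
        simp [eq_comm]
    have h := hg.linearIndependent.fintype_card_le_finrank
    rw [finrank_euclideanSpace, hm, Fintype.card_sum] at h
    omega
  have hκ0 : ∀ r, κ r ≠ 0 := by
    intro r hr
    apply hdet
    rw [hM.det_eq_prod_eigenvalues]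
    exact Finset.prod_eq_zero (Finset.mem_univ r) (by simpa using hr)
  -- Both the positive and the negative eigenvalues number at most `n`; together they number `2n`.
  have hP : Fintype.card {r // 0 < κ r} = n := by
    have h1 := hcard (fun r => 0 < κ r) fun r s hr hs => (add_pos hr hs).ne'
    have h2 := hcard (fun r => ¬ 0 < κ r) fun r s hr hs => by
      have hr' := lt_of_le_of_ne (not_lt.1 hr) (hκ0 r)
      have hs' := lt_of_le_of_ne (not_lt.1 hs) (hκ0 s)
      linarith
    have h3 := Fintype.card_subtype_compl fun r => 0 < κ r
    have h4 := Fintype.card_subtype_le fun r => 0 < κ r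
    omega
  let e : Fin n ≃ {r // 0 < κ r} := (Fintype.equivFinOfCardEq hP).symm
  refine ⟨Matrix.of fun i => star (u (e i)), fun i => κ (e i), fun i => (e i).2, ?_, ?_, ?_⟩
  · ext i s
    have h := congrArg star (hu (e i))
    rw [Matrix.star_mulVec, hM.eq, star_smul] at h
    have h' := congrFun h s
    rw [Matrix.diagonal_mul]
    simpa [Matrix.mul_apply, Matrix.vecMul, dotProduct] using h'
  · ext i j
    have h := horth (e i) (e j)
    rw [Matrix.mul_apply, Matrix.one_apply]
    simpa [dotProduct, Subtype.val_inj, e.injective.eq_iff] using h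
  · ext i j
    have h := congrArg star (hcross (e j) (e i) (add_pos (e j).2 (e i).2).ne')
    rw [← Matrix.star_dotProduct_star, star_zero] at h
    rw [Matrix.mul_apply, Matrix.zero_apply]
    simpa [dotProduct, mul_comm] using h

theorem stdOmega_mul_self (n : ℕ) : stdOmega n * stdOmega n = -1 := by
  rw [stdOmega, Matrix.fromBlocks_multiply, ← Matrix.fromBlocks_one, Matrix.fromBlocks_neg]
  simp

theorem stdOmega_transpose (n : ℕ) : (stdOmega n)ᵀ = -stdOmega n := by
  simp [stdOmega, Matrix.fromBlocks_transpose, Matrix.fromBlocks_neg]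

theorem I_smul_stdOmega_mul_self (n : ℕ) :
    (Complex.I • cx (stdOmega n)) * (Complex.I • cx (stdOmega n)) = 1 := by
  rw [smul_mul_smul_comm, ← cx_mul, stdOmega_mul_self, Complex.I_mul_I]
  ext i j
  by_cases h : i = j <;> simp [Matrix.one_apply, h]

/-- The rows of `h` are normal modes, of symplectic eigenvalues `ν`, of the quadratic form `G`. -/
structure IsWilliamson {n : ℕ} (G : Matrix (Fin n ⊕ Fin n) (Fin n ⊕ Fin n) ℝ)
    (h : Matrix (Fin n) (Fin n ⊕ Fin n) ℂ) (ν : Fin n → ℝ) : Prop where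
  pos : ∀ i, 0 < ν i
  mul_eq : h * (Complex.I • cx (G * stdOmega n)) = Matrix.diagonal (fun i => (ν i : ℂ)) * h
  ccr : h * (Complex.I • cx (stdOmega n)) * hᴴ = 1
  comm : h * (Complex.I • cx (stdOmega n)) * hᵀ = 0

/-- **Williamson's theorem**: a positive definite form has normal modes. -/
theorem exists_isWilliamson {n : ℕ} {G : Matrix (Fin n ⊕ Fin n) (Fin n ⊕ Fin n) ℝ}
    (hG : G.PosDef) : ∃ h ν, IsWilliamson G h ν := by
  obtain ⟨B, A, hB, hAB⟩ := exists_factor_of_posDef hG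
  have hBA : B * A = 1 := mul_eq_one_comm.1 hAB
  set W := Complex.I • cx (stdOmega n) with hW
  have hWW : W * W = 1 := I_smul_stdOmega_mul_self n
  have hWt : Wᵀ = -W := by
    rw [hW, Matrix.transpose_smul, ← Matrix.transpose_map, stdOmega_transpose]
    ext
    simp
  have hWc : W.map conj = -W := by
    rw [hW, map_conj_smul, map_conj_cx]
    simp
  have hcAB : cx A * cx B = 1 := by rw [← cx_mul, hAB, cx_one]
  have hcBA : cx B * cx A = 1 := by rw [← cx_mul, hBA, cx_one]
  have hcBAt : (cx B)ᵀ * (cx A)ᵀ = 1 := by rw [← Matrix.transpose_mul, hcAB, Matrix.transpose_one]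
  have hcABt : (cx A)ᵀ * (cx B)ᵀ = 1 := by rw [← Matrix.transpose_mul, hcBA, Matrix.transpose_one]
  have hcG : Complex.I • cx (G * stdOmega n) = (cx B)ᵀ * cx B * W := by
    rw [hW, hB, cx_mul, cx_mul, mul_smul_comm]
    rfl
  -- With `G = Bᵀ B` this matrix is Hermitian and imaginary, and `i G Ω` is `Bᵀ M (Bᵀ)⁻¹`; its
  -- inverse is `N` below.
  let M := cx B * W * (cx B)ᵀ
  have hMt : Mᵀ = -M := by
    simp only [M, Matrix.transpose_mul, Matrix.transpose_transpose, hWt]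
    simp [Matrix.mul_assoc]
  have hMc : M.map conj = -M := by
    have : ((cx B)ᵀ).map conj = (cx B)ᵀ := by rw [Matrix.transpose_map, map_conj_cx]
    simp only [M, map_conj_mul, map_conj_cx, hWc, this]
    simp
  have hMh : M.IsHermitian := by
    have : Mᴴ = (M.map conj)ᵀ := rfl
    rw [Matrix.IsHermitian, this, hMc, Matrix.transpose_neg, hMt, neg_neg]
  let N := (cx A)ᵀ * W * cx A
  have hMN : M * N = 1 := by
    calc M * N = cx B * W * ((cx B)ᵀ * (cx A)ᵀ) * W * cx A := by simp only [M, N, Matrix.mul_assoc]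
      _ = cx B * (W * W) * cx A := by rw [hcBAt]; simp only [Matrix.mul_one, Matrix.mul_assoc]
      _ = 1 := by rw [hWW, Matrix.mul_one, hcBA]
  have hdet : M.det ≠ 0 := by
    intro h
    have := congrArg Matrix.det hMN
    rw [Matrix.det_mul, h, zero_mul, Matrix.det_one] at this
    exact zero_ne_one this
  obtain ⟨X, ν, hν, hXM, hX1, hX0⟩ := exists_positive_eigenvectors (n := n)
    (by simp [two_mul]) hMh hMc hdet
  let D : Matrix (Fin n) (Fin n) ℂ := Matrix.diagonal fun i => (ν i : ℂ)
  let R : Matrix (Fin n) (Fin n) ℂ := Matrix.diagonal fun i => (Real.sqrt (ν i) : ℂ)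
  let D' : Matrix (Fin n) (Fin n) ℂ := Matrix.diagonal fun i => ((ν i)⁻¹ : ℂ)
  have hRD : R * D = D * R := by
    simp only [R, D, Matrix.diagonal_mul_diagonal]
    congr 1
    funext i
    exact mul_comm _ _
  have hD' : D' * D = 1 := by
    simp only [D', D, Matrix.diagonal_mul_diagonal]
    rw [← Matrix.diagonal_one]
    congr 1
    funext i
    exact inv_mul_cancel₀ (Complex.ofReal_ne_zero.2 (hν i).ne')
  have hRR : R * D' * R = 1 := by
    simp only [D', R, Matrix.diagonal_mul_diagonal]
    rw [← Matrix.diagonal_one]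
    congr 1
    funext i
    rw [mul_right_comm, ← Complex.ofReal_mul, Real.mul_self_sqrt (hν i).le]
    exact mul_inv_cancel₀ (Complex.ofReal_ne_zero.2 (hν i).ne')
  have hRh : Rᴴ = R := by
    simp only [R, Matrix.diagonal_conjTranspose]
    congr 1
    funext i
    simp
  have hRt : Rᵀ = R := Matrix.diagonal_transpose _
  have hXN : X * N = D' * X := by
    calc X * N = D' * D * X * N := by rw [hD', Matrix.one_mul]
      _ = D' * (D * X) * N := by simp only [Matrix.mul_assoc]
      _ = D' * X * (M * N) := by rw [← hXM]; simp only [Matrix.mul_assoc]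
      _ = D' * X := by rw [hMN, Matrix.mul_one]
  have hAh : (cx A)ᵀᴴ = cx A := by
    ext i j
    simp
  -- The eigenvectors are pulled back by `A = B⁻¹`. There the symplectic form becomes `M⁻¹`, with
  -- values `1/ν i`, so rows are rescaled by `√(ν i)` to obtain canonical commutation relations.
  refine ⟨R * X * (cx A)ᵀ, ν, hν, ?_, ?_, ?_⟩
  · calc R * X * (cx A)ᵀ * (Complex.I • cx (G * stdOmega n))
        = R * X * ((cx A)ᵀ * (cx B)ᵀ) * cx B * W := by rw [hcG]; simp only [Matrix.mul_assoc]
      _ = R * X * (cx B * W * ((cx B)ᵀ * (cx A)ᵀ)) := by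
        rw [hcABt, hcBAt]
        simp only [Matrix.mul_one, Matrix.mul_assoc]
      _ = R * (X * M) * (cx A)ᵀ := by simp only [M, Matrix.mul_assoc]
      _ = (R * D) * X * (cx A)ᵀ := by rw [hXM]; simp only [D, Matrix.mul_assoc]
      _ = D * (R * X * (cx A)ᵀ) := by rw [hRD]; simp only [Matrix.mul_assoc]
  · calc R * X * (cx A)ᵀ * W * (R * X * (cx A)ᵀ)ᴴ = R * (X * N) * Xᴴ * R := by
          rw [Matrix.conjTranspose_mul, Matrix.conjTranspose_mul, hRh, hAh]
          simp only [N, Matrix.mul_assoc]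
      _ = R * D' * (X * Xᴴ) * R := by rw [hXN]; simp only [Matrix.mul_assoc]
      _ = 1 := by rw [hX1, Matrix.mul_one, hRR]
  · calc R * X * (cx A)ᵀ * W * (R * X * (cx A)ᵀ)ᵀ = R * (X * N) * Xᵀ * R := by
          rw [Matrix.transpose_mul, Matrix.transpose_mul, hRt, Matrix.transpose_transpose]
          simp only [N, Matrix.mul_assoc]
      _ = R * D' * (X * Xᵀ) * R := by rw [hXN]; simp only [Matrix.mul_assoc]
      _ = 0 := by rw [hX0, Matrix.mul_zero, Matrix.zero_mul]

end LinearAlgebra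

/-! ### Determinant and rank in terms of symplectic eigenvalues. -/

section NormalForm

variable {n : ℕ} {G : Matrix (Fin n ⊕ Fin n) (Fin n ⊕ Fin n) ℝ}
  {h : Matrix (Fin n) (Fin n ⊕ Fin n) ℂ} {ν : Fin n → ℝ}

theorem map_conj_I_smul_cx {m l : Type*} (A : Matrix m l ℝ) :
    (Complex.I • cx A).map conj = -(Complex.I • cx A) := by
  rw [map_conj_smul, map_conj_cx, Complex.conj_I, neg_smul]

theorem IsWilliamson.mul_eq_conj (H : IsWilliamson G h ν) :
    h.map conj * (Complex.I • cx (G * stdOmega n)) =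
      Matrix.diagonal (fun i => (-ν i : ℂ)) * h.map conj := by
  have e := congrArg (fun M => -M.map conj) H.mul_eq
  simp only [map_conj_mul, map_conj_I_smul_cx] at e
  rw [Matrix.mul_neg, neg_neg] at e
  rw [e, ← Matrix.neg_mul]
  congr 1
  ext i j
  by_cases hij : i = j <;> simp [Matrix.diagonal, hij]

/-- The normal modes and their adjoints. -/
def doubled (h : Matrix (Fin n) (Fin n ⊕ Fin n) ℂ) : Matrix (Fin n ⊕ Fin n) (Fin n ⊕ Fin n) ℂ :=
  Matrix.fromRows h (h.map conj)

theorem IsWilliamson.doubled_mul (H : IsWilliamson G h ν) :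
    doubled h * (Complex.I • cx (G * stdOmega n)) =
      Matrix.diagonal (Sum.elim (fun i => (ν i : ℂ)) fun i => (-ν i : ℂ)) * doubled h := by
  rw [doubled, Matrix.fromRows_mul, H.mul_eq, H.mul_eq_conj]
  ext (i | i) j <;> simp [Matrix.diagonal_mul]

/-- The commutation relations exhibit a right inverse, `W [hᴴ, -hᵀ]` with `W = iΩ`. -/
theorem IsWilliamson.isUnit_det_doubled (H : IsWilliamson G h ν) : IsUnit (doubled h).det := by
  set W := Complex.I • cx (stdOmega n) with hW
  have h3 : h.map conj * W * hᴴ = 0 := by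
    have e := congrArg (fun M => -M.map conj) H.comm
    simp only [map_conj_mul, map_conj_I_smul_cx] at e
    rw [Matrix.mul_neg, Matrix.neg_mul, neg_neg] at e
    have e0 : -(0 : Matrix (Fin n) (Fin n) ℂ).map conj = 0 := by ext; simp
    exact e.trans e0
  have h4 : h.map conj * W * hᵀ = -1 := by
    have e := congrArg (fun M => -M.map conj) H.ccr
    simp only [map_conj_mul, map_conj_I_smul_cx] at e
    rw [Matrix.mul_neg, Matrix.neg_mul, neg_neg] at e
    have e0 : -(1 : Matrix (Fin n) (Fin n) ℂ).map conj = -1 := by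
      rw [Matrix.map_one _ (map_zero _) (map_one _)]
    have e1 : hᴴ.map conj = hᵀ := by ext; simp
    rw [e0, e1] at e
    exact e
  have h5 : doubled h * (W * Matrix.fromCols hᴴ (-hᵀ)) = 1 := by
    rw [← Matrix.mul_assoc, doubled, Matrix.fromRows_mul, Matrix.fromRows_mul_fromCols,
      Matrix.mul_neg, Matrix.mul_neg, h3, h4, H.ccr, H.comm, neg_neg, neg_zero,
      Matrix.fromBlocks_one]
  exact Matrix.isUnit_det_of_right_inverse h5

theorem IsWilliamson.norm_det (H : IsWilliamson G h ν) :
    ‖(Complex.I • cx (G * stdOmega n)).det‖ = (∏ i, ν i) ^ 2 := by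
  have e := congrArg Matrix.det H.doubled_mul
  rw [Matrix.det_mul, Matrix.det_mul, mul_comm] at e
  rw [mul_right_cancel₀ H.isUnit_det_doubled.ne_zero e, Matrix.det_diagonal, norm_prod,
    Fintype.prod_sum_type, sq]
  have h1 : ∀ i, |ν i| = ν i := fun i => abs_of_pos (H.pos i)
  simp [h1]

/-- With `C = i G Ω` the matrix is `1 - C²`. It is similar to a diagonal matrix in which `1 - (ν
i)²` occurs twice, once for `ν i` and once for `-ν i`. -/
theorem IsWilliamson.two_mul_card_eq_rank (H : IsWilliamson G h ν) :
    2 * Fintype.card {i // ν i ≠ 1} = (1 + cx (G * stdOmega n * (G * stdOmega n))).rank := by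
  set C := Complex.I • cx (G * stdOmega n) with hC
  set D : Fin n ⊕ Fin n → ℂ := Sum.elim (fun i => (ν i : ℂ)) fun i => (-ν i : ℂ) with hD
  have h1 : 1 + cx (G * stdOmega n * (G * stdOmega n)) = 1 - C * C := by
    rw [hC, smul_mul_smul_comm, ← cx_mul, Complex.I_mul_I, neg_one_smul, sub_neg_eq_add]
  have h2 : doubled h * (1 - C * C) = Matrix.diagonal (fun x => 1 - D x * D x) * doubled h := by
    have : Matrix.diagonal (fun x => 1 - D x * D x) =
        1 - Matrix.diagonal D * Matrix.diagonal D := by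
      rw [Matrix.diagonal_mul_diagonal, ← Matrix.diagonal_one, Matrix.diagonal_sub]
    rw [this, Matrix.mul_sub, Matrix.sub_mul, ← Matrix.mul_assoc, H.doubled_mul, Matrix.mul_assoc,
      H.doubled_mul, Matrix.mul_one, Matrix.one_mul, Matrix.mul_assoc]
  have h3 : (1 - C * C).rank = Fintype.card {x // 1 - D x * D x ≠ 0} := by
    rw [← Matrix.rank_mul_eq_right_of_isUnit_det _ _ H.isUnit_det_doubled, h2,
      Matrix.rank_mul_eq_left_of_isUnit_det _ _ H.isUnit_det_doubled, Matrix.rank_diagonal]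
  have h4 : ∀ i, 1 - (ν i : ℂ) * ν i ≠ 0 ↔ ν i ≠ 1 := by
    intro i
    rw [not_iff_not, sub_eq_zero, eq_comm, ← Complex.ofReal_mul, Complex.ofReal_eq_one]
    have := H.pos i
    constructor
    · intro e
      nlinarith
    · rintro e
      rw [e, one_mul]
  rw [h1, h3, Fintype.card_congr (Equiv.subtypeSum (p := fun x => 1 - D x * D x ≠ 0)),
    Fintype.card_sum, two_mul]
  congr 1
  · exact Fintype.card_congr (Equiv.subtypeEquivRight fun i => (h4 i).symm)
  · refine Fintype.card_congr (Equiv.subtypeEquivRight fun i => ?_)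
    rw [← h4 i]
    simp [D]

end NormalForm

/-! ### From canonical observables to ladder operators. -/

section ModeCoefficients

variable {ι : Type*} [Fintype ι]

/-- The coefficient of the annihilation operators in a linear observable. -/
def toα (g : ι ⊕ ι → ℂ) (i : ι) : ℂ :=
  1 / (Real.sqrt 2 : ℂ) * (g (Sum.inl i) - Complex.I * g (Sum.inr i))

/-- The coefficient of the creation operators in a linear observable. -/
def toβ (g : ι ⊕ ι → ℂ) (i : ι) : ℂ :=
  1 / (Real.sqrt 2 : ℂ) * (g (Sum.inl i) + Complex.I * g (Sum.inr i))

omit [Fintype ι] in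
theorem conj_toβ (g : ι ⊕ ι → ℂ) (i : ι) : conj (toβ g i) = toα (star g) i := by
  simp [toα, toβ, sub_eq_add_neg]

omit [Fintype ι] in
theorem conj_toα (g : ι ⊕ ι → ℂ) (i : ι) : conj (toα g i) = toβ (star g) i := by
  simp [toα, toβ]

theorem sqrt_two_mul_self : (1 / (Real.sqrt 2 : ℂ)) * (1 / (Real.sqrt 2 : ℂ)) = 1 / 2 := by
  rw [div_mul_div_comm, ← Complex.ofReal_mul, Real.mul_self_sqrt (by norm_num)]
  norm_num

variable [DecidableEq ι]

/-- The left side is the commutator of two observables in ladder form, the right side the same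
commutator through `iΩ`. -/
theorem sum_toα_mul_toβ_sub (g g' : ι ⊕ ι → ℂ) :
    ∑ i, (toα g i * toβ g' i - toβ g i * toα g' i) =
      g ⬝ᵥ ((Complex.I • cx (Matrix.fromBlocks 0 1 (-1) 0 : Matrix (ι ⊕ ι) (ι ⊕ ι) ℝ)) *ᵥ g') := by
  have h1 : (Complex.I • cx (Matrix.fromBlocks 0 1 (-1) 0 : Matrix (ι ⊕ ι) (ι ⊕ ι) ℝ)) *ᵥ g' =
      Sum.elim (fun i => Complex.I * g' (Sum.inr i)) fun i => -(Complex.I * g' (Sum.inl i)) := by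
    have : cx (Matrix.fromBlocks 0 1 (-1) 0 : Matrix (ι ⊕ ι) (ι ⊕ ι) ℝ) =
        Matrix.fromBlocks 0 1 (-1) 0 := by
      ext (i | i) (j | j) <;> simp [Matrix.one_apply, apply_ite]
    rw [Matrix.smul_mulVec, this, Matrix.fromBlocks_mulVec]
    ext (i | i) <;> simp [Matrix.neg_mulVec]
  rw [h1, dotProduct, Fintype.sum_sum_type, ← Finset.sum_add_distrib]
  refine Finset.sum_congr rfl fun i _ => ?_
  simp only [toα, toβ, Sum.elim_inl, Sum.elim_inr]
  linear_combination (2 * Complex.I * g (Sum.inl i) * g' (Sum.inr i) -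
    2 * Complex.I * g (Sum.inr i) * g' (Sum.inl i)) * sqrt_two_mul_self

omit [DecidableEq ι] in
theorem sum_norm_sq_toα_add (g : ι ⊕ ι → ℂ) :
    ∑ i, ‖toα g i‖ ^ 2 + ∑ i, ‖toβ g i‖ ^ 2 = ∑ r, ‖g r‖ ^ 2 := by
  rw [Fintype.sum_sum_type, ← Finset.sum_add_distrib, ← Finset.sum_add_distrib]
  refine Finset.sum_congr rfl fun i _ => ?_
  apply Complex.ofReal_injective
  push_cast
  simp only [← Complex.mul_conj', conj_toα, conj_toβ]
  simp only [toα, toβ, Pi.star_apply, Complex.star_def]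
  linear_combination (2 * g (Sum.inl i) * conj (g (Sum.inl i)) +
    2 * g (Sum.inr i) * conj (g (Sum.inr i))) * sqrt_two_mul_self +
    (-2 * (1 / (Real.sqrt 2 : ℂ)) ^ 2 * g (Sum.inr i) * conj (g (Sum.inr i))) * Complex.I_mul_I

omit [DecidableEq ι] in
/-- A linear observable in terms of the ladder operators. -/
theorem sum_mul_observable {E : Type*} [AddCommGroup E] [Module ℂ E] (g : ι ⊕ ι → ℂ) (a c : ι → E) :
    ∑ i, g (Sum.inl i) • (1 / (Real.sqrt 2 : ℂ)) • (a i + c i) +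
      ∑ i, g (Sum.inr i) • (1 / (Complex.I * (Real.sqrt 2 : ℂ))) • (a i - c i) =
    ∑ i, toα g i • a i + ∑ i, toβ g i • c i := by
  rw [← Finset.sum_add_distrib, ← Finset.sum_add_distrib]
  refine Finset.sum_congr rfl fun i _ => ?_
  have h1 : (1 / (Complex.I * (Real.sqrt 2 : ℂ))) = -Complex.I * (1 / (Real.sqrt 2 : ℂ)) := by
    rw [one_div, mul_inv, Complex.inv_I, one_div]
  rw [h1]
  simp only [toα, toβ]
  module

end ModeCoefficients

/-! ## Gaussian states in terms of ladder operators -/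

section AnnihilationForm

theorem norm_sum_mul_sq_le {ι : Type*} [Fintype ι] (x y : ι → ℂ) :
    ‖∑ i, x i * y i‖ ^ 2 ≤ (∑ i, ‖x i‖ ^ 2) * ∑ i, ‖y i‖ ^ 2 := by
  calc ‖∑ i, x i * y i‖ ^ 2 ≤ (∑ i, ‖x i‖ * ‖y i‖) ^ 2 := by
        gcongr
        refine (norm_sum_le _ _).trans_eq (Finset.sum_congr rfl fun i _ => norm_mul _ _)
    _ ≤ _ := Finset.sum_mul_sq_le_sq_mul_sq _ _ _

theorem sum_norm_sq_mulVec_le {ι κ : Type*} [Fintype ι] [Fintype κ] (A : Matrix κ ι ℂ)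
    (y : ι → ℂ) :
    ∑ r, ‖(A *ᵥ y) r‖ ^ 2 ≤ (∑ r, ∑ i, ‖A r i‖ ^ 2) * ∑ i, ‖y i‖ ^ 2 := by
  rw [Finset.sum_mul]
  exact Finset.sum_le_sum fun r _ => norm_sum_mul_sq_le _ _

/-- A matrix and its transpose have the same bounds. -/
theorem sum_norm_sq_mulVec_le_of_vecMul {ι : Type*} [Fintype ι] {S : Matrix ι ι ℂ} {σ : ℝ}
    (h : ∀ t : ι → ℂ, ∑ j, ‖(t ᵥ* S) j‖ ^ 2 ≤ σ * ∑ i, ‖t i‖ ^ 2) (y : ι → ℂ) :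
    ∑ i, ‖(S *ᵥ y) i‖ ^ 2 ≤ σ * ∑ j, ‖y j‖ ^ 2 := by
  set N := ∑ i, ‖(S *ᵥ y) i‖ ^ 2 with hN
  have hN0 : 0 ≤ N := by positivity
  have hy0 : 0 ≤ ∑ j, ‖y j‖ ^ 2 := by positivity
  -- Pairing with `t` writes `N` as `t S y`; Cauchy–Schwarz and the bound for `t S` give `N² ≤ σ N
  -- ‖y‖²`.
  let t := star (S *ᵥ y)
  have h1 : ((N : ℝ) : ℂ) = ∑ j, (t ᵥ* S) j * y j := by
    rw [← star_dotProduct_self_eq, Matrix.dotProduct_mulVec]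
    rfl
  have h2 : N ^ 2 ≤ (∑ j, ‖(t ᵥ* S) j‖ ^ 2) * ∑ j, ‖y j‖ ^ 2 := by
    refine le_trans (le_of_eq ?_) (norm_sum_mul_sq_le _ _)
    rw [← h1, Complex.norm_real, Real.norm_eq_abs, sq_abs]
  have h3 : ∑ i, ‖t i‖ ^ 2 = N := by simp [t, hN]
  have h4 := h t
  rw [h3] at h4
  have h5 : N * N ≤ N * (σ * ∑ j, ‖y j‖ ^ 2) := by nlinarith
  -- For `N = 0` no division is possible; as the sign of `σ` is not assumed, `0 ≤ σ ‖y‖²` is drawn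
  -- from the hypothesis at `star y` when `y ≠ 0`.
  rcases hN0.eq_or_lt with h0 | h0
  · rcases hy0.eq_or_lt with hy | hy
    · have hy' : y = 0 := by
        funext j
        have := (Finset.sum_eq_zero_iff_of_nonneg fun j _ => sq_nonneg ‖y j‖).1 hy.symm j
          (Finset.mem_univ j)
        simpa using this
      simp [hN, hy']
    · have h6 := h (star y)
      have h7 : ∑ i, ‖(star y) i‖ ^ 2 = ∑ j, ‖y j‖ ^ 2 := by simp
      rw [h7] at h6
      rw [← h0]
      exact le_trans (by positivity) h6
  · exact le_of_mul_le_mul_left h5 h0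

variable {ι : Type*} [Fintype ι] [DecidableEq ι]

/-- The standard symplectic matrix. -/
def sympl (ι : Type*) [DecidableEq ι] : Matrix (ι ⊕ ι) (ι ⊕ ι) ℝ := Matrix.fromBlocks 0 1 (-1) 0

theorem sympl_mul_self : sympl ι * sympl ι = -1 := by
  rw [sympl, Matrix.fromBlocks_multiply, ← Matrix.fromBlocks_one, Matrix.fromBlocks_neg]
  simp

theorem cx_sympl_mulVec (v : ι ⊕ ι → ℂ) :
    cx (sympl ι) *ᵥ v = Sum.elim (fun i => v (Sum.inr i)) fun i => -v (Sum.inl i) := by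
  have : cx (sympl ι) = Matrix.fromBlocks 0 1 (-1) 0 := by
    ext (i | i) (j | j) <;> simp [sympl, Matrix.one_apply, apply_ite]
  rw [this, Matrix.fromBlocks_mulVec]
  ext (i | i) <;> simp [Matrix.neg_mulVec]

theorem dotProduct_cx_mulVec_star {m : Type*} [Fintype m] (B : Matrix m m ℝ) (v : m → ℂ) :
    v ⬝ᵥ (cx (Bᵀ * B) *ᵥ star v) = ((∑ r, ‖(cx B *ᵥ star v) r‖ ^ 2 : ℝ) : ℂ) := by
  rw [← star_dotProduct_self_eq, Matrix.star_mulVec, star_star, cx_mul, ← Matrix.mulVec_mulVec,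
    Matrix.dotProduct_mulVec]
  congr 2
  ext i j
  simp

/-- Suitable combinations of the rows of `1 + iJ` have the identity as coefficient of the
annihilators, which solves the equations for `a ψ`. Strict contraction reflects that `G` is bounded
below by a positive constant. -/
theorem exists_annihilation_matrix {J : Matrix (ι ⊕ ι) (ι ⊕ ι) ℝ} (hJ : J * J = -1)
    (hG : (-(J * sympl ι)).PosDef) :
    ∃ (Γ : Matrix ι (ι ⊕ ι) ℂ) (F : Matrix ι (ι ⊕ ι) ℂ) (σ : ℝ),
      F = Γ * (1 + Complex.I • cx J) ∧ (∀ i j, toα (F i) j = if i = j then 1 else 0) ∧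
      0 ≤ σ ∧ σ < 1 ∧
      ∀ y : ι → ℂ, ∑ i, ‖∑ j, -toβ (F i) j * y j‖ ^ 2 ≤ σ * ∑ j, ‖y j‖ ^ 2 := by
  obtain ⟨B, A, hB, hAB⟩ := exists_factor_of_posDef hG
  have hcAB : cx A * cx B = 1 := by rw [← cx_mul, hAB, cx_one]
  set M : Matrix (ι ⊕ ι) (ι ⊕ ι) ℂ := 1 + Complex.I • cx J with hM
  have hMJ : M * (Complex.I • cx J) = M := by
    rw [hM, Matrix.add_mul, Matrix.one_mul, smul_mul_smul_comm, ← cx_mul, hJ, Complex.I_mul_I]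
    have : cx (-1 : Matrix (ι ⊕ ι) (ι ⊕ ι) ℝ) = -1 := by
      rw [← cx_one]
      ext
      exact Complex.ofReal_neg _
    rw [this, neg_one_smul, neg_neg, add_comm]
  have hJG : J = -(J * sympl ι) * sympl ι := by
    rw [Matrix.neg_mul, Matrix.mul_assoc, sympl_mul_self, Matrix.mul_neg, Matrix.mul_one, neg_neg]
  let P : Matrix ι (ι ⊕ ι) ℂ := Matrix.fromCols 1 (Complex.I • 1)
  let Q : Matrix (ι ⊕ ι) ι ℂ := Matrix.fromRows ((1 / (Real.sqrt 2 : ℂ)) • 1)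
    (-((1 / (Real.sqrt 2 : ℂ)) * Complex.I) • 1)
  have hQ : ∀ g : ι ⊕ ι → ℂ, g ᵥ* Q = toα g := by
    intro g
    ext i
    rw [Matrix.vecMul_fromRows, Pi.add_apply, Matrix.vecMul_smul, Matrix.vecMul_smul,
      Matrix.vecMul_one, Matrix.vecMul_one]
    simp only [toα, Pi.smul_apply, Function.comp_apply, smul_eq_mul]
    ring
  have hP : ∀ x : ι → ℂ, x ᵥ* P = Sum.elim x (Complex.I • x) := by
    intro x
    rw [Matrix.vecMul_fromCols, Matrix.vecMul_one, Matrix.vecMul_smul, Matrix.vecMul_one]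
  -- The rows of `P` are multiples of the annihilators, and `Q` extracts annihilator coefficients.
  -- If these vanish for `h M`, then `0 = h M h* = ‖h‖² + h G h*`, so `h = 0`.
  have hinj : Function.Injective fun x : ι → ℂ => x ᵥ* (P * M * Q) := by
    rw [← Matrix.coe_vecMulLinear, ← LinearMap.ker_eq_bot, LinearMap.ker_eq_bot']
    intro x hx
    rw [Matrix.vecMulLinear_apply] at hx
    set h : ι ⊕ ι → ℂ := Sum.elim x (Complex.I • x) with hh
    have h1 : toα (h ᵥ* M) = 0 := by
      rw [← hQ, hh, ← hP, Matrix.vecMul_vecMul, Matrix.vecMul_vecMul, ← Matrix.mul_assoc]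
      exact hx
    have h2 : (h ᵥ* M) ⬝ᵥ star h = 0 := by
      have : (h ᵥ* M) ⬝ᵥ star h =
          (Real.sqrt 2 : ℂ) * ∑ i, toα (h ᵥ* M) i * conj (x i) := by
        have h2 : (Real.sqrt 2 : ℂ) ≠ 0 := by simp
        rw [dotProduct, Fintype.sum_sum_type, Finset.mul_sum, ← Finset.sum_add_distrib]
        refine Finset.sum_congr rfl fun i _ => ?_
        simp only [hh, toα, Pi.star_apply, Sum.elim_inl, Sum.elim_inr, Pi.smul_apply, smul_eq_mul,
          Complex.star_def, map_mul, Complex.conj_I]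
        field_simp
        ring
      rw [this, h1]
      simp
    have h3 : cx (sympl ι) *ᵥ star h = -Complex.I • star h := by
      rw [cx_sympl_mulVec]
      ext (i | i)
      · simp [hh]
      · simp [hh, ← mul_assoc]
    have h4 : (h ᵥ* M) ⬝ᵥ star h =
        ((∑ r, ‖h r‖ ^ 2 + ∑ r, ‖(cx B *ᵥ star h) r‖ ^ 2 : ℝ) : ℂ) := by
      rw [Complex.ofReal_add, ← dotProduct_cx_mulVec_star, ← hB, ← Matrix.dotProduct_mulVec, hM,
        Matrix.add_mulVec, Matrix.one_mulVec, dotProduct_add, ← star_dotProduct_self_eq,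
        dotProduct_comm h]
      congr 2
      conv_lhs => rw [hJG]
      rw [cx_mul, Matrix.smul_mulVec, ← Matrix.mulVec_mulVec, h3, Matrix.mulVec_smul, smul_smul]
      simp
    rw [h4, Complex.ofReal_eq_zero] at h2
    have h5 : ∑ r, ‖h r‖ ^ 2 = 0 := by
      have : 0 ≤ ∑ r, ‖(cx B *ᵥ star h) r‖ ^ 2 := by positivity
      have : 0 ≤ ∑ r, ‖h r‖ ^ 2 := by positivity
      linarith
    funext i
    have := (Finset.sum_eq_zero_iff_of_nonneg fun r _ => sq_nonneg ‖h r‖).1 h5 (Sum.inl i)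
      (Finset.mem_univ _)
    simpa [hh] using this
  have hunit : IsUnit (P * M * Q) := Matrix.vecMul_injective_iff_isUnit.1 hinj
  obtain ⟨γ, hγ⟩ := hunit.exists_left_inv
  let F := γ * P * M
  have hFQ : F * Q = 1 := by
    rw [← hγ]
    simp only [F, Matrix.mul_assoc]
  have hα : ∀ t : ι → ℂ, toα (t ᵥ* F) = t := by
    intro t
    rw [← hQ, Matrix.vecMul_vecMul, hFQ, Matrix.vecMul_one]
  have hβ : ∀ t : ι → ℂ, t ᵥ* (Matrix.of fun i j => -toβ (F i) j) = -toβ (t ᵥ* F) := by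
    intro t
    ext j
    simp only [Matrix.vecMul, dotProduct, Matrix.of_apply, toβ, Pi.neg_apply, Finset.mul_sum,
      ← Finset.sum_add_distrib, ← Finset.sum_neg_distrib]
    refine Finset.sum_congr rfl fun i _ => ?_
    ring
  set C : ℝ := ∑ r, ∑ s, ‖cx A r s‖ ^ 2 with hC
  have hC0 : 0 ≤ C := by positivity
  -- Rows of `F` are fixed by `iJ`, so `f G f* = f iΩ f* = ‖t‖² - ‖β‖²`. The lower bound for `G`
  -- then gives `‖t‖² + ‖β‖² ≤ C (‖t‖² - ‖β‖²)`. Adding `‖β‖² ≤ ‖t‖²` leads to `C/(C + 2)`, which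
  -- lies in `[0, 1)` whatever `C ≥ 0` is.
  have key : ∀ t : ι → ℂ, (C + 2) * ∑ j, ‖toβ (t ᵥ* F) j‖ ^ 2 ≤ C * ∑ i, ‖t i‖ ^ 2 := by
    intro t
    set f := t ᵥ* F with hf
    have h1 : f ᵥ* (Complex.I • cx J) = f := by
      rw [hf, Matrix.vecMul_vecMul, Matrix.mul_assoc (γ * P), hMJ]
    have h2 : ((∑ r, ‖(cx B *ᵥ star f) r‖ ^ 2 : ℝ) : ℂ) =
        ((∑ i, ‖t i‖ ^ 2 - ∑ j, ‖toβ f j‖ ^ 2 : ℝ) : ℂ) := by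
      have h3 : ((∑ i, ‖t i‖ ^ 2 - ∑ j, ‖toβ f j‖ ^ 2 : ℝ) : ℂ) =
          ∑ i, (toα f i * toβ (star f) i - toβ f i * toα (star f) i) := by
        rw [Finset.sum_sub_distrib]
        simp only [← conj_toα, ← conj_toβ, Complex.mul_conj', hα t, hf]
        push_cast
        rfl
      rw [h3, sum_toα_mul_toβ_sub, ← dotProduct_cx_mulVec_star, ← hB]
      change _ = f ⬝ᵥ ((Complex.I • cx (sympl ι)) *ᵥ star f)
      have h4 : cx (-(J * sympl ι)) = (Complex.I • cx J) * (Complex.I • cx (sympl ι)) := by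
        rw [smul_mul_smul_comm, ← cx_mul, Complex.I_mul_I]
        ext
        simp
      rw [h4, Matrix.dotProduct_mulVec, ← Matrix.vecMul_vecMul, h1, Matrix.dotProduct_mulVec]
    have h3 := Complex.ofReal_injective h2
    have h4 : ∑ r, ‖f r‖ ^ 2 ≤ C * ∑ r, ‖(cx B *ᵥ star f) r‖ ^ 2 := by
      have := sum_norm_sq_mulVec_le (cx A) (cx B *ᵥ star f)
      rw [Matrix.mulVec_mulVec, hcAB, Matrix.one_mulVec] at this
      refine le_of_eq_of_le (Finset.sum_congr rfl fun r _ => ?_) this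
      rw [Pi.star_apply, norm_star]
    rw [← sum_norm_sq_toα_add, hα, h3] at h4
    have h5 : 0 ≤ ∑ j, ‖toβ f j‖ ^ 2 := by positivity
    have h6 : 0 ≤ ∑ r, ‖(cx B *ᵥ star f) r‖ ^ 2 := by positivity
    nlinarith
  refine ⟨γ * P, F, C / (C + 2), rfl, fun i j => ?_, by positivity, ?_, ?_⟩
  · have h1 := congrFun (hα (Pi.single i 1)) j
    rw [Matrix.single_one_vecMul] at h1
    refine h1.trans ?_
    rw [Pi.single_apply]
    exact if_congr eq_comm rfl rfl
  · rw [div_lt_one (by positivity)]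
    linarith
  · refine sum_norm_sq_mulVec_le_of_vecMul (S := Matrix.of fun i j => -toβ (F i) j) fun t => ?_
    rw [hβ, div_mul_eq_mul_div, le_div_iff₀ (by positivity), mul_comm]
    simpa using key t

end AnnihilationForm

/-! ## Classical bipartite systems -/

section Classical

variable {NA NB : ℕ} {Ω : Matrix (Fin (2 * (NA + NB))) (Fin (2 * (NA + NB))) ℝ}
  {J : Matrix (Fin (2 * (NA + NB))) (Fin (2 * (NA + NB))) ℝ}

theorem Subsystems.resolution (F : Subsystems NA NB Ω) : F.vA * F.θA + F.vB * F.θB = 1 := by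
  have h : Matrix.fromRows F.θA F.θB * Matrix.fromCols F.vA F.vB = 1 := by
    rw [Matrix.fromRows_mul_fromCols, F.dualAA, F.dualAB, F.dualBA, F.dualBB,
      Matrix.fromBlocks_one]
  have e : (Fin NA ⊕ Fin NA) ⊕ (Fin NB ⊕ Fin NB) ≃ Fin (2 * (NA + NB)) :=
    Fintype.equivFinOfCardEq (by simp only [Fintype.card_sum, Fintype.card_fin]; ring)
  rw [Matrix.mul_eq_one_comm_of_equiv e, Matrix.fromCols_mul_fromRows] at h
  exact h

theorem Subsystems.omega_mul_θA (F : Subsystems NA NB Ω) (hΩ : Ωᵀ = -Ω) :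
    Ω * F.θAᵀ = F.vA * stdOmega NA := by
  have h : F.θB * Ω * F.θAᵀ = 0 := by
    have e := congrArg Matrix.transpose F.bracketAB
    rw [Matrix.transpose_mul, Matrix.transpose_mul, Matrix.transpose_transpose, hΩ,
      Matrix.transpose_zero, Matrix.neg_mul, Matrix.mul_neg, neg_eq_zero] at e
    rw [Matrix.mul_assoc, e]
  calc Ω * F.θAᵀ = (F.vA * F.θA + F.vB * F.θB) * Ω * F.θAᵀ := by
        rw [F.resolution, Matrix.one_mul]
    _ = F.vA * (F.θA * Ω * F.θAᵀ) + F.vB * (F.θB * Ω * F.θAᵀ) := by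
        simp only [Matrix.add_mul, Matrix.mul_assoc]
    _ = _ := by rw [h, F.bracketAA, Matrix.mul_zero, add_zero]

theorem posDef_metricG {d : ℕ} {Ω J : Matrix (Fin d) (Fin d) ℝ} (hΩ : IsSymplecticForm Ω)
    (hJ : IsCompatibleComplexStructure Ω J) : (metricG Ω J).PosDef := by
  have h : (Ω⁻¹ * J)⁻¹ = metricG Ω J := by
    apply Matrix.inv_eq_right_inv
    rw [metricG, Matrix.mul_neg, Matrix.mul_assoc, ← Matrix.mul_assoc J J Ω, hJ.1, Matrix.neg_mul,
      Matrix.one_mul, Matrix.mul_neg, neg_neg, Matrix.nonsing_inv_mul _ hΩ.2]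
  rw [← h]
  exact hJ.2.2.inv

theorem mul_metricG {d : ℕ} {Ω J : Matrix (Fin d) (Fin d) ℝ}
    (hJ : IsCompatibleComplexStructure Ω J) : J * metricG Ω J = Ω := by
  rw [metricG, Matrix.mul_neg, ← Matrix.mul_assoc, hJ.1, Matrix.neg_mul, Matrix.one_mul, neg_neg]

theorem metricG_mul_transpose {d : ℕ} {Ω J : Matrix (Fin d) (Fin d) ℝ}
    (hJ : IsCompatibleComplexStructure Ω J) : metricG Ω J * Jᵀ = -Ω := by
  rw [metricG, Matrix.neg_mul, hJ.2.1]

/-- The uncertainty relation `G ≥ iΩ`. -/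
theorem uncertainty {d : ℕ} {Ω J : Matrix (Fin d) (Fin d) ℝ} (hΩ : IsSymplecticForm Ω)
    (hJ : IsCompatibleComplexStructure Ω J) (f : Fin d → ℂ) {a b : ℝ}
    (ha : f ⬝ᵥ (cx (metricG Ω J) *ᵥ star f) = (a : ℂ))
    (hb : f ⬝ᵥ ((Complex.I • cx Ω) *ᵥ star f) = (b : ℂ)) : b ≤ a := by
  obtain ⟨B, -, hB, -⟩ := exists_factor_of_posDef (posDef_metricG hΩ hJ)
  -- For `M = 1 - iJ` one has `M G Mᴴ = 2 (G - iΩ)`, so `2(a - b)` is a sum of squares.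
  set M : Matrix (Fin d) (Fin d) ℂ := 1 - Complex.I • cx J with hM
  have hMh : Mᴴ = 1 + Complex.I • cx Jᵀ := by
    ext i j
    simp [hM, Matrix.one_apply, apply_ite, eq_comm]
  have h1 : M * cx (metricG Ω J) * Mᴴ = (2 : ℂ) • (cx (metricG Ω J) - Complex.I • cx Ω) := by
    have e1 : Complex.I • cx J * cx (metricG Ω J) = Complex.I • cx Ω := by
      rw [Matrix.smul_mul, ← cx_mul, mul_metricG hJ]
    have e2 : cx (metricG Ω J) * Complex.I • cx Jᵀ = -(Complex.I • cx Ω) := by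
      rw [Matrix.mul_smul, ← cx_mul, metricG_mul_transpose hJ, ← smul_neg]
      congr 1
      ext
      simp
    have e3 : Complex.I • cx Ω * Complex.I • cx Jᵀ = -cx (metricG Ω J) := by
      rw [← e1, Matrix.mul_assoc, e2, Matrix.mul_neg, Matrix.smul_mul, Matrix.mul_smul, smul_smul,
        ← cx_mul, Complex.I_mul_I, neg_one_smul, neg_neg, metricG]
      ext
      simp
    rw [hM, Matrix.sub_mul, Matrix.one_mul, e1, hMh, Matrix.mul_add, Matrix.mul_one,
      Matrix.sub_mul, e2, e3]
    module
  have h2 := dotProduct_cx_mulVec_star B (f ᵥ* M)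
  rw [← hB, Matrix.star_vecMul, Matrix.mulVec_mulVec, ← Matrix.dotProduct_mulVec,
    Matrix.mulVec_mulVec, ← Matrix.mul_assoc, h1, Matrix.smul_mulVec, Matrix.sub_mulVec,
    dotProduct_smul, dotProduct_sub, ha, hb] at h2
  have h3 : (2 * (a - b) : ℝ) = ∑ r, ‖(cx B *ᵥ star (f ᵥ* M)) r‖ ^ 2 := by
    apply Complex.ofReal_injective
    rw [← Matrix.star_vecMul] at h2
    rw [← h2]
    push_cast
    simp
  have h4 : 0 ≤ ∑ r, ‖(cx B *ᵥ star (f ᵥ* M)) r‖ ^ 2 := by positivity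
  linarith

theorem Subsystems.posDef_restrict (F : Subsystems NA NB Ω) (hΩ : IsSymplecticForm Ω)
    (hJ : IsCompatibleComplexStructure Ω J) : (F.θA * metricG Ω J * F.θAᵀ).PosDef := by
  have h := (posDef_metricG hΩ hJ).mul_mul_conjTranspose_same (B := F.θA) ?_
  · simpa using h
  · refine Function.LeftInverse.injective (g := fun y => y ᵥ* F.vA) fun x => ?_
    change (x ᵥ* F.θA) ᵥ* F.vA = x
    rw [Matrix.vecMul_vecMul, F.dualAA, Matrix.vecMul_one]

/-- Through this identity the normal modes of `G_A` are left eigenvectors of `[iJ]_A`. -/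
theorem Subsystems.restrict_mul_stdOmega (F : Subsystems NA NB Ω) (hΩ : IsSymplecticForm Ω) :
    F.θA * metricG Ω J * F.θAᵀ * stdOmega NA = restrictJ F J := by
  rw [metricG, Matrix.mul_neg, Matrix.neg_mul, Matrix.neg_mul, ← Matrix.mul_assoc,
    Matrix.mul_assoc _ Ω, F.omega_mul_θA hΩ.1, Matrix.mul_assoc, Matrix.mul_assoc F.vA,
    stdOmega_mul_self, Matrix.mul_neg, Matrix.mul_one, Matrix.mul_neg, neg_neg, restrictJ]

/-- Inserting `vA θA = 1 - vB θB` between the two factors `J` cancels the identity against `J² = -1`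
and leaves a product through `B`, of rank at most `2 NB`. -/
theorem Subsystems.one_add_restrictJ_mul_self (F : Subsystems NA NB Ω) (hJ : J * J = -1) :
    1 + restrictJ F J * restrictJ F J = -(F.θA * J * F.vB) * (F.θB * J * F.vA) := by
  have h : F.vA * F.θA = 1 - F.vB * F.θB := eq_sub_of_add_eq F.resolution
  calc 1 + restrictJ F J * restrictJ F J = 1 + F.θA * J * (F.vA * F.θA) * J * F.vA := by
        simp only [restrictJ, Matrix.mul_assoc]
    _ = 1 + F.θA * (J * J) * F.vA - F.θA * J * (F.vB * F.θB) * J * F.vA := by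
        rw [h, Matrix.mul_sub, Matrix.mul_one, Matrix.sub_mul, Matrix.sub_mul, add_sub_assoc]
        simp only [Matrix.mul_assoc]
    _ = _ := by
        rw [hJ, Matrix.mul_neg, Matrix.mul_one, Matrix.neg_mul, F.dualAA, add_neg_cancel, zero_sub,
          Matrix.neg_mul]
        simp only [Matrix.mul_assoc]

theorem abs_det_stdOmega (n : ℕ) : ‖(Complex.I • cx (stdOmega n)).det‖ = 1 := by
  have h := congrArg (fun M => ‖M.det‖) (I_smul_stdOmega_mul_self n)
  simp only [Matrix.det_mul, Matrix.det_one, norm_mul, norm_one] at h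
  nlinarith [norm_nonneg (Complex.I • cx (stdOmega n)).det]

/-- The symplectic spectrum of a subsystem of a pure Gaussian state. -/
theorem Subsystems.exists_symplectic_spectrum (F : Subsystems NA NB Ω) (hΩ : IsSymplecticForm Ω)
    (hJ : IsCompatibleComplexStructure Ω J) :
    ∃ h ν, IsWilliamson (F.θA * metricG Ω J * F.θAᵀ) h ν ∧ (∀ i, 1 ≤ ν i) ∧
      Fintype.card {i // ν i ≠ 1} ≤ min NA NB ∧ cubeVolume F (metricG Ω J) = ∏ i, ν i ∧
      ‖(restrictIJ F J).det‖ = (∏ i, ν i) ^ 2 := by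
  have hG := F.posDef_restrict hΩ hJ
  obtain ⟨h, ν, H⟩ := exists_isWilliamson hG
  have hprod : 0 < ∏ i, ν i := Finset.prod_pos fun i _ => H.pos i
  refine ⟨h, ν, H, fun i => ?_, le_min ?_ ?_, ?_, ?_⟩
  -- In the normal modes `G_A` has the diagonal entries `ν i` and `iΩ` the entries `1`; the
  -- uncertainty relation compares them.
  · have h1 : h * cx (F.θA * metricG Ω J * F.θAᵀ) * hᴴ = Matrix.diagonal fun i => (ν i : ℂ) := by
      have e : cx (F.θA * metricG Ω J * F.θAᵀ) =
          (Complex.I • cx (F.θA * metricG Ω J * F.θAᵀ * stdOmega NA)) *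
            (Complex.I • cx (stdOmega NA)) := by
        rw [cx_mul _ (stdOmega NA), ← Matrix.mul_smul, Matrix.mul_assoc (cx _),
          I_smul_stdOmega_mul_self, Matrix.mul_one]
      rw [e, ← Matrix.mul_assoc, H.mul_eq, Matrix.mul_assoc, Matrix.mul_assoc, ← Matrix.mul_assoc h,
        H.ccr, Matrix.mul_one]
    have e0 : ∀ X : Matrix (Fin NA ⊕ Fin NA) (Fin NA ⊕ Fin NA) ℂ,
        (h * X * hᴴ) i i = h i ⬝ᵥ (X *ᵥ star (h i)) := by
      intro X
      rw [Matrix.mul_assoc]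
      rfl
    have e1 : star (h i ᵥ* cx F.θA) = (cx F.θAᵀ) *ᵥ star (h i) := by
      rw [Matrix.star_vecMul]
      congr 1
      ext
      simp
    refine uncertainty hΩ hJ (h i ᵥ* cx F.θA) ?_ ?_
    · rw [e1, ← Matrix.dotProduct_mulVec, Matrix.mulVec_mulVec, Matrix.mulVec_mulVec,
        ← cx_mul, ← cx_mul, ← e0, h1, Matrix.diagonal_apply_eq]
    · rw [e1, ← Matrix.dotProduct_mulVec, Matrix.mulVec_mulVec, Matrix.mulVec_mulVec,
        Matrix.mul_smul, Matrix.smul_mul, ← cx_mul, ← cx_mul, F.bracketAA,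
        ← e0, H.ccr, Matrix.one_apply_eq, Complex.ofReal_one]
  · exact (Fintype.card_subtype_le fun i => ν i ≠ 1).trans_eq (Fintype.card_fin NA)
  · have h1 := H.two_mul_card_eq_rank
    rw [F.restrict_mul_stdOmega hΩ] at h1
    have h2 : 1 + cx (restrictJ F J * restrictJ F J) =
        cx (-(F.θA * J * F.vB)) * cx (F.θB * J * F.vA) := by
      rw [← cx_mul, ← F.one_add_restrictJ_mul_self hJ.1, ← cx_one]
      ext
      exact (Complex.ofReal_add _ _).symm
    have h3 := (Matrix.rank_mul_le_left (cx (-(F.θA * J * F.vB))) (cx (F.θB * J * F.vA))).trans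
      (Matrix.rank_le_card_width _)
    rw [← h2, ← h1, Fintype.card_sum, Fintype.card_fin] at h3
    omega
  · have h1 : (((F.θA * metricG Ω J * F.θAᵀ).det : ℝ) : ℂ) =
        (cx (F.θA * metricG Ω J * F.θAᵀ)).det := RingHom.map_det Complex.ofRealHom _
    have h2 := congrArg norm h1
    have h3 := H.norm_det
    rw [cx_mul _ (stdOmega NA), ← Matrix.mul_smul, Matrix.det_mul, norm_mul,
      abs_det_stdOmega, mul_one, ← h2,
      Complex.norm_real, Real.norm_eq_abs, abs_of_pos hG.det_pos] at h3
    rw [cubeVolume, h3, Real.sqrt_sq hprod.le]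
  · rw [← H.norm_det, F.restrict_mul_stdOmega hΩ, restrictIJ]

end Classical

/-! ## The reduced state of a Gaussian state -/

section Quantum

/-- The linear observable `∑_r g_r (θ̂^r - z^r)`. -/
def observable {n : ℕ} (g z : Fin n ⊕ Fin n → ℂ) : Module.End ℂ ((Fin n → ℕ) → ℂ) :=
  ladder (toα g) (toβ g) (-(g ⬝ᵥ z))

theorem observable_eq_sum {n : ℕ} (g z : Fin n ⊕ Fin n → ℂ) :
    observable g z = ∑ r, g r • (canonicalObservable r - z r • 1) := by
  have h := sum_mul_observable g (fun i : Fin n => annihilate i) (fun i : Fin n => create i)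
  have e : ∑ r, g r • (canonicalObservable r - z r • 1) =
      ∑ r, g r • canonicalObservable r + (-(g ⬝ᵥ z)) • 1 := by
    have e' : (-(g ⬝ᵥ z)) • (1 : Module.End ℂ ((Fin n → ℕ) → ℂ)) = -((g ⬝ᵥ z) • 1) :=
      LinearMap.ext fun f => funext fun k => neg_mul (g ⬝ᵥ z) (f k)
    rw [e', ← sub_eq_add_neg]
    simp only [smul_sub, Finset.sum_sub_distrib, smul_smul, ← Finset.sum_smul, dotProduct]
  rw [observable, ladder, ← h, e, Fintype.sum_sum_type]
  rfl

theorem observable_smul {n : ℕ} (c : ℂ) (g z : Fin n ⊕ Fin n → ℂ) :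
    observable (c • g) z = c • observable g z := by
  simp only [observable_eq_sum, Finset.smul_sum, Pi.smul_apply, smul_eq_mul, mul_smul]

theorem ladder_conj_observable {n : ℕ} (g : Fin n ⊕ Fin n → ℂ) {z : Fin n ⊕ Fin n → ℂ}
    (hz : star z = z) :
    ladder (fun i => conj (toβ g i)) (fun i => conj (toα g i)) (conj (-(g ⬝ᵥ z))) =
      observable (star g) z := by
  have h : conj (-(g ⬝ᵥ z)) = -(star g ⬝ᵥ z) := by
    rw [map_neg]
    nth_rewrite 2 [← hz]
    rw [Matrix.star_dotProduct_star, dotProduct_comm]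
    rfl
  simp only [conj_toβ, conj_toα, h]
  rfl

variable {NA NB : ℕ} {Ω : Matrix (Fin (2 * (NA + NB))) (Fin (2 * (NA + NB))) ℝ}
  {J : Matrix (Fin (2 * (NA + NB))) (Fin (2 * (NA + NB))) ℝ}
  {ζ : Fin (2 * (NA + NB)) → ℝ}

/-- The amplitudes of `(θ̂^r - z^r) ψ` for the observables of `A`. -/
def deviationA (z : Fin NA ⊕ Fin NA → ℂ) (ψ : (Fin NA → ℕ) × (Fin NB → ℕ) → ℂ)
    (x : (Fin NA → ℕ) × (Fin NB → ℕ)) (r : Fin NA ⊕ Fin NA) : ℂ :=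
  onA (canonicalObservable r) ψ x - z r * ψ x

/-- The amplitudes of `(Θ̂^s - z^s) ψ` for the observables of `B`. -/
def deviationB (z : Fin NB ⊕ Fin NB → ℂ) (ψ : (Fin NA → ℕ) × (Fin NB → ℕ) → ℂ)
    (x : (Fin NA → ℕ) × (Fin NB → ℕ)) (s : Fin NB ⊕ Fin NB) : ℂ :=
  onB (canonicalObservable s) ψ x - z s * ψ x

theorem onA_observable (g z : Fin NA ⊕ Fin NA → ℂ) (ψ : (Fin NA → ℕ) × (Fin NB → ℕ) → ℂ)
    (x : (Fin NA → ℕ) × (Fin NB → ℕ)) :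
    onA (observable g z) ψ x = g ⬝ᵥ deviationA z ψ x := by
  rw [observable_eq_sum, onA_apply]
  simp only [LinearMap.sum_apply, LinearMap.smul_apply, LinearMap.sub_apply, Finset.sum_apply,
    Pi.smul_apply, Pi.sub_apply, Module.End.one_apply, smul_eq_mul]
  rfl

theorem onB_observable (g z : Fin NB ⊕ Fin NB → ℂ) (ψ : (Fin NA → ℕ) × (Fin NB → ℕ) → ℂ)
    (x : (Fin NA → ℕ) × (Fin NB → ℕ)) :
    onB (observable g z) ψ x = g ⬝ᵥ deviationB z ψ x := by
  rw [observable_eq_sum, onB_apply]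
  simp only [LinearMap.sum_apply, LinearMap.smul_apply, LinearMap.sub_apply, Finset.sum_apply,
    Pi.smul_apply, Pi.sub_apply, Module.End.one_apply, smul_eq_mul]
  rfl

/-- The mean values of the observables of `A`. -/
def meanA (F : Subsystems NA NB Ω) (ζ : Fin (2 * (NA + NB)) → ℝ) (r : Fin NA ⊕ Fin NA) : ℂ :=
  ((F.θA *ᵥ ζ) r : ℝ)

/-- The mean values of the observables of `B`. -/
def meanB (F : Subsystems NA NB Ω) (ζ : Fin (2 * (NA + NB)) → ℝ) (s : Fin NB ⊕ Fin NB) : ℂ :=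
  ((F.θB *ᵥ ζ) s : ℝ)

theorem star_meanA (F : Subsystems NA NB Ω) : star (meanA F ζ) = meanA F ζ := by
  ext
  simp [meanA]

theorem star_meanB (F : Subsystems NA NB Ω) : star (meanB F ζ) = meanB F ζ := by
  ext
  simp [meanB]

/-- The amplitudes of `(ξ̂^a - ζ^a) ψ`. -/
def deviation (F : Subsystems NA NB Ω) (ζ : Fin (2 * (NA + NB)) → ℝ)
    (ψ : (Fin NA → ℕ) × (Fin NB → ℕ) → ℂ) (x : (Fin NA → ℕ) × (Fin NB → ℕ)) :
    Fin (2 * (NA + NB)) → ℂ :=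
  cx F.vA *ᵥ deviationA (meanA F ζ) ψ x + cx F.vB *ᵥ deviationB (meanB F ζ) ψ x

theorem deviation_eq (F : Subsystems NA NB Ω) (ψ : (Fin NA → ℕ) × (Fin NB → ℕ) → ℂ)
    (x : (Fin NA → ℕ) × (Fin NB → ℕ)) (a : Fin (2 * (NA + NB))) :
    deviation F ζ ψ x a = (xiHat F a - (ζ a : ℂ) • 1) ψ x := by
  have h : ((F.vA *ᵥ (F.θA *ᵥ ζ) + F.vB *ᵥ (F.θB *ᵥ ζ)) a : ℝ) = ζ a := by
    rw [Matrix.mulVec_mulVec, Matrix.mulVec_mulVec, ← Matrix.add_mulVec, F.resolution,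
      Matrix.one_mulVec]
  have h' : (∑ r, (F.vA a r : ℂ) * meanA F ζ r + ∑ s, (F.vB a s : ℂ) * meanB F ζ s) =
      (ζ a : ℂ) := by
    rw [← h, Pi.add_apply, Complex.ofReal_add]
    simp only [meanA, meanB, Matrix.mulVec, dotProduct, Complex.ofReal_sum, Complex.ofReal_mul]
  simp only [deviation, Pi.add_apply, Matrix.mulVec, dotProduct, deviationA, deviationB, mul_sub,
    Finset.sum_sub_distrib, Matrix.map_apply, xiHat, LinearMap.sub_apply, LinearMap.add_apply,
    LinearMap.sum_apply, LinearMap.smul_apply, Pi.sub_apply, Finset.sum_apply, Pi.smul_apply,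
    smul_eq_mul, Module.End.one_apply]
  rw [← h', add_mul, Finset.sum_mul, Finset.sum_mul]
  simp only [mul_assoc]
  ring

theorem IsGaussianState.deviation_add {F : Subsystems NA NB Ω} {ψ : BipartiteFockSpace NA NB}
    (hψ : IsGaussianState F J ζ ψ) (x : (Fin NA → ℕ) × (Fin NB → ℕ)) :
    deviation F ζ ψ x + Complex.I • (cx J *ᵥ deviation F ζ ψ x) = 0 := by
  funext b
  have h := congrFun (hψ.2 b) x
  simp only [gaussianAnnihilator, LinearMap.smul_apply, Pi.smul_apply, smul_eq_mul,
    LinearMap.add_apply, Pi.add_apply, LinearMap.sum_apply, Finset.sum_apply, ← deviation_eq,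
    Pi.zero_apply] at h
  have h2 : (1 / (Real.sqrt 2 : ℂ)) ≠ 0 := by simp
  exact (mul_eq_zero.1 h).resolve_left h2

theorem Subsystems.θA_mulVec_deviation (F : Subsystems NA NB Ω)
    (ψ : (Fin NA → ℕ) × (Fin NB → ℕ) → ℂ) (x : (Fin NA → ℕ) × (Fin NB → ℕ)) :
    cx F.θA *ᵥ deviation F ζ ψ x = deviationA (meanA F ζ) ψ x := by
  have h0 : cx (0 : Matrix (Fin NA ⊕ Fin NA) (Fin NB ⊕ Fin NB) ℝ) = 0 := by ext; simp
  rw [deviation, Matrix.mulVec_add, Matrix.mulVec_mulVec, Matrix.mulVec_mulVec, ← cx_mul, ← cx_mul,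
    F.dualAA, F.dualAB, cx_one, h0, Matrix.one_mulVec, Matrix.zero_mulVec, add_zero]

theorem Subsystems.θB_mulVec_deviation (F : Subsystems NA NB Ω)
    (ψ : (Fin NA → ℕ) × (Fin NB → ℕ) → ℂ) (x : (Fin NA → ℕ) × (Fin NB → ℕ)) :
    cx F.θB *ᵥ deviation F ζ ψ x = deviationB (meanB F ζ) ψ x := by
  have h0 : cx (0 : Matrix (Fin NB ⊕ Fin NB) (Fin NA ⊕ Fin NA) ℝ) = 0 := by ext; simp
  rw [deviation, Matrix.mulVec_add, Matrix.mulVec_mulVec, Matrix.mulVec_mulVec, ← cx_mul, ← cx_mul,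
    F.dualBA, F.dualBB, cx_one, h0, Matrix.one_mulVec, Matrix.zero_mulVec, zero_add]

/-- A left eigenvector of `[iJ]_A` turns an observable of `A` into one of `B`. -/
theorem IsGaussianState.transfer {F : Subsystems NA NB Ω} {ψ : BipartiteFockSpace NA NB}
    (hψ : IsGaussianState F J ζ ψ) {g : Fin NA ⊕ Fin NA → ℂ} {κ : ℂ}
    (hg : g ᵥ* (Complex.I • cx (restrictJ F J)) = κ • g) (x : (Fin NA → ℕ) × (Fin NB → ℕ)) :
    ((1 + κ) • g) ⬝ᵥ deviationA (meanA F ζ) ψ x =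
      (-Complex.I • (g ᵥ* cx (F.θA * J * F.vB))) ⬝ᵥ deviationB (meanB F ζ) ψ x := by
  have h1 := congrArg (fun v => g ⬝ᵥ (cx F.θA *ᵥ v)) (hψ.deviation_add x)
  simp only [Matrix.mulVec_add, Matrix.mulVec_smul, dotProduct_add, F.θA_mulVec_deviation,
    Matrix.mulVec_zero, dotProduct_zero] at h1
  rw [deviation, Matrix.mulVec_add, Matrix.mulVec_add, Matrix.mulVec_mulVec, Matrix.mulVec_mulVec,
    Matrix.mulVec_mulVec, Matrix.mulVec_mulVec, ← cx_mul,
    ← cx_mul, ← cx_mul, smul_add, dotProduct_add, ← Matrix.smul_mulVec, Matrix.dotProduct_mulVec]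
    at h1
  change g ⬝ᵥ _ + ((g ᵥ* (Complex.I • cx (restrictJ F J))) ⬝ᵥ _ + _) = 0 at h1
  rw [hg, dotProduct_smul, Matrix.dotProduct_mulVec] at h1
  simp only [smul_dotProduct, smul_eq_mul] at h1 ⊢
  linear_combination h1

/-- The transfer is applied to `g` and, with eigenvalue `-κ`, to `star g`; the ratio `(κ - 1)/(κ +
1)` is the thermal ratio. -/
theorem IsGaussianState.observable_reducedDensity {F : Subsystems NA NB Ω}
    {ψ : BipartiteFockSpace NA NB} (hψ : IsGaussianState F J ζ ψ) (hE : BipartiteExpDecay ψ)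
    {g : Fin NA ⊕ Fin NA → ℂ} {κ : ℝ}
    (hg : g ᵥ* (Complex.I • cx (restrictJ F J)) = (κ : ℂ) • g) {φ χ : FockSpace NA}
    (hφ : ExpDecay φ) (hχ : (χ : (Fin NA → ℕ) → ℂ) = observable g (meanA F ζ) φ) :
    ((1 + κ : ℝ) : ℂ) • observable g (meanA F ζ) (reducedDensity ψ φ) =
      ((κ - 1 : ℝ) : ℂ) • (reducedDensity ψ χ : (Fin NA → ℕ) → ℂ) := by
  have hg' : star g ᵥ* (Complex.I • cx (restrictJ F J)) = (-κ : ℂ) • star g := by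
    have e := congrArg star hg
    rw [Matrix.star_vecMul] at e
    have e2 : (Complex.I • cx (restrictJ F J))ᴴ *ᵥ star g =
        -(star g ᵥ* (Complex.I • cx (restrictJ F J))) := by
      rw [← Matrix.vecMul_neg, ← Matrix.vecMul_transpose]
      congr 1
      ext
      simp
    rw [e2, star_smul] at e
    rw [neg_smul, ← neg_eq_iff_eq_neg, e]
    simp
  have h1 : onA (observable (((1 + κ : ℝ) : ℂ) • g) (meanA F ζ)) ψ =
      onB (observable (-Complex.I • (g ᵥ* cx (F.θA * J * F.vB))) (meanB F ζ)) ψ := by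
    funext x
    rw [onA_observable, onB_observable, ← hψ.transfer hg]
    simp
  have h2 : onA (observable (((κ - 1 : ℝ) : ℂ) • star g) (meanA F ζ)) ψ =
      onB (observable (star (-Complex.I • (g ᵥ* cx (F.θA * J * F.vB)))) (meanB F ζ)) ψ := by
    funext x
    have e := hψ.transfer hg' x
    -- Conjugating the factor `-i` changes its sign, so the adjoint observable of `B` is minus the
    -- one belonging to `star g`; this turns `1 - κ` into `κ - 1`.
    have e2 : star (-Complex.I • (g ᵥ* cx (F.θA * J * F.vB))) =
        -(-Complex.I • (star g ᵥ* cx (F.θA * J * F.vB))) := by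
      rw [star_smul, Matrix.star_vecMul, ← Matrix.vecMul_transpose, ← neg_smul]
      congr 1
      · simp
      · congr 1
        ext
        simp
    rw [onA_observable, onB_observable, e2, neg_dotProduct, ← e, ← neg_dotProduct, ← neg_smul]
    congr 2
    push_cast
    ring
  rw [← ladder_conj_observable _ (star_meanB F)] at h2
  have h3 : (((κ - 1 : ℝ) : ℂ) • χ : FockSpace NA) = ladder
      (fun i => conj (toβ (((κ - 1 : ℝ) : ℂ) • star g) i))
      (fun i => conj (toα (((κ - 1 : ℝ) : ℂ) • star g) i))
      (conj (-((((κ - 1 : ℝ) : ℂ) • star g) ⬝ᵥ meanA F ζ))) φ := by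
    rw [ladder_conj_observable _ (star_meanA F), star_smul, star_star, observable_smul,
      lp.coeFn_smul, hχ]
    simp
  have h := ladder_reducedDensity hE h1 h2 hφ h3
  rw [map_smul, lp.coeFn_smul] at h
  rw [← h]
  change _ = observable _ _ _
  rw [observable_smul, LinearMap.smul_apply]

end Quantum

/-! ### Decay of Gaussian states and spectrum of the reduced state. -/

section Spectrum

variable {NA NB : ℕ} {Ω : Matrix (Fin (2 * (NA + NB))) (Fin (2 * (NA + NB))) ℝ}
  {J : Matrix (Fin (2 * (NA + NB))) (Fin (2 * (NA + NB))) ℝ}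
  {ζ : Fin (2 * (NA + NB)) → ℝ}

/-- The Darboux basis `(q_A, q_B, p_A, p_B)` of the whole phase space, as rows. -/
def Subsystems.frame (F : Subsystems NA NB Ω) :
    Matrix ((Fin NA ⊕ Fin NB) ⊕ (Fin NA ⊕ Fin NB)) (Fin (2 * (NA + NB))) ℝ :=
  (Matrix.fromRows F.θA F.θB).submatrix
    (Equiv.sumSumSumComm (Fin NA) (Fin NB) (Fin NA) (Fin NB)) id

/-- The dual basis of `Subsystems.frame`, as columns. -/
def Subsystems.coframe (F : Subsystems NA NB Ω) :
    Matrix (Fin (2 * (NA + NB))) ((Fin NA ⊕ Fin NB) ⊕ (Fin NA ⊕ Fin NB)) ℝ :=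
  (Matrix.fromCols F.vA F.vB).submatrix id
    (Equiv.sumSumSumComm (Fin NA) (Fin NB) (Fin NA) (Fin NB))

theorem Subsystems.frame_mul_coframe (F : Subsystems NA NB Ω) : F.frame * F.coframe = 1 := by
  rw [frame, coframe, ← Matrix.submatrix_mul _ _ _ _ _ Function.bijective_id,
    Matrix.fromRows_mul_fromCols, F.dualAA, F.dualAB, F.dualBA, F.dualBB, Matrix.fromBlocks_one,
    Matrix.submatrix_one_equiv]

theorem Subsystems.coframe_mul_frame (F : Subsystems NA NB Ω) : F.coframe * F.frame = 1 := by
  rw [frame, coframe, Matrix.submatrix_mul_equiv, Matrix.fromCols_mul_fromRows, F.resolution]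
  simp

theorem Subsystems.frame_bracket (F : Subsystems NA NB Ω) (hΩ : Ωᵀ = -Ω) :
    F.frame * Ω * F.frameᵀ = sympl (Fin NA ⊕ Fin NB) := by
  have h : F.θB * Ω * F.θAᵀ = 0 := by
    rw [Matrix.mul_assoc, F.omega_mul_θA hΩ, ← Matrix.mul_assoc, F.dualBA, Matrix.zero_mul]
  have e : F.frame * Ω * F.frameᵀ =
      (Matrix.fromRows F.θA F.θB * Ω * (Matrix.fromRows F.θA F.θB)ᵀ).submatrix
        (Equiv.sumSumSumComm (Fin NA) (Fin NB) (Fin NA) (Fin NB))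
        (Equiv.sumSumSumComm (Fin NA) (Fin NB) (Fin NA) (Fin NB)) := rfl
  rw [e, Matrix.transpose_fromRows, Matrix.fromRows_mul, Matrix.fromRows_mul_fromCols, F.bracketAA,
    F.bracketAB, F.bracketBB, h]
  ext ((i | i) | (i | i)) ((j | j) | (j | j)) <;>
    simp [sympl, stdOmega, Matrix.one_apply]

/-- Gaussian states decay exponentially in the Fock basis. -/
theorem IsGaussianState.bipartiteExpDecay (hΩ : IsSymplecticForm Ω)
    (hJ : IsCompatibleComplexStructure Ω J) {F : Subsystems NA NB Ω}
    {ψ : BipartiteFockSpace NA NB} (hψ : IsGaussianState F J ζ ψ) : BipartiteExpDecay ψ := by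
  set T := F.frame with hT
  set U := F.coframe with hU
  have hTU : T * U = 1 := F.frame_mul_coframe
  have hUT : U * T = 1 := F.coframe_mul_frame
  have hJJ : (T * J * U) * (T * J * U) = -1 := by
    calc (T * J * U) * (T * J * U) = T * J * (U * T) * J * U := by simp only [Matrix.mul_assoc]
      _ = T * (J * J) * U := by rw [hUT, Matrix.mul_one]; simp only [Matrix.mul_assoc]
      _ = -1 := by rw [hJ.1, Matrix.mul_neg, Matrix.mul_one, Matrix.neg_mul, hTU]
  have hpos : (-(T * J * U * sympl (Fin NA ⊕ Fin NB))).PosDef := by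
    have e : -(T * J * U * sympl (Fin NA ⊕ Fin NB)) = T * metricG Ω J * Tᵀ := by
      calc -(T * J * U * sympl (Fin NA ⊕ Fin NB)) = -(T * J * (U * T) * Ω * Tᵀ) := by
            rw [← F.frame_bracket hΩ.1]
            simp only [Matrix.mul_assoc, hT]
        _ = _ := by
            rw [hUT, Matrix.mul_one, metricG, Matrix.mul_neg, Matrix.neg_mul]
            simp only [Matrix.mul_assoc]
    rw [e]
    have h := (posDef_metricG hΩ hJ).mul_mul_conjTranspose_same (B := T) ?_
    · simpa using h
    · refine Function.LeftInverse.injective (g := fun y => y ᵥ* U) fun x => ?_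
      change (x ᵥ* T) ᵥ* U = x
      rw [Matrix.vecMul_vecMul, hTU, Matrix.vecMul_one]
  obtain ⟨Γ, C, σ, hC, hα, hσ0, hσ1, hσ⟩ := exists_annihilation_matrix hJJ hpos
  let z : (Fin NA ⊕ Fin NB) ⊕ (Fin NA ⊕ Fin NB) → ℂ :=
    Sum.elim (meanA F ζ) (meanB F ζ) ∘ Equiv.sumSumSumComm (Fin NA) (Fin NB) (Fin NA) (Fin NB)
  let a : (Fin NA → ℕ) × (Fin NB → ℕ) → Fin NA ⊕ Fin NB → ℂ := fun x =>
    Sum.elim (fun i => onA (annihilate i) ψ x) (fun i => onB (annihilate i) ψ x)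
  let c : (Fin NA → ℕ) × (Fin NB → ℕ) → Fin NA ⊕ Fin NB → ℂ := fun x =>
    Sum.elim (fun i => onA (create i) ψ x) (fun i => onB (create i) ψ x)
  -- The rows of `C` are combinations of rows of `1 + iJ` in the frame, so they annihilate the
  -- deviation vector.
  have hdev : ∀ x, C *ᵥ (cx T *ᵥ deviation F ζ ψ x) = 0 := by
    intro x
    have h1 : cx (T * J * U) *ᵥ (cx T *ᵥ deviation F ζ ψ x) =
        cx T *ᵥ (cx J *ᵥ deviation F ζ ψ x) := by
      rw [Matrix.mulVec_mulVec, Matrix.mulVec_mulVec, ← cx_mul, ← cx_mul, Matrix.mul_assoc, hUT,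
        Matrix.mul_one]
    rw [hC, ← Matrix.mulVec_mulVec, Matrix.add_mulVec, Matrix.one_mulVec, Matrix.smul_mulVec, h1,
      ← Matrix.mulVec_smul, ← Matrix.mulVec_add, hψ.deviation_add, Matrix.mulVec_zero,
      Matrix.mulVec_zero]
  have hZ : ∀ x, cx T *ᵥ deviation F ζ ψ x =
      Sum.elim (deviationA (meanA F ζ) ψ x) (deviationB (meanB F ζ) ψ x) ∘
        Equiv.sumSumSumComm (Fin NA) (Fin NB) (Fin NA) (Fin NB) := by
    intro x
    funext r
    rcases r with (i | i) | (i | i)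
    · exact congrFun (F.θA_mulVec_deviation (ζ := ζ) ψ x) (Sum.inl i)
    · exact congrFun (F.θB_mulVec_deviation (ζ := ζ) ψ x) (Sum.inl i)
    · exact congrFun (F.θA_mulVec_deviation (ζ := ζ) ψ x) (Sum.inr i)
    · exact congrFun (F.θB_mulVec_deviation (ζ := ζ) ψ x) (Sum.inr i)
  have hann : ∀ x i, a x i = ∑ j, -toβ (C i) j * c x j + (C i ⬝ᵥ z) * ψ x := by
    intro x i
    have h1 := congrFun (hdev x) i
    have h2 := sum_mul_observable (C i) (a x) (c x)
    have h3 : C i ⬝ᵥ (cx T *ᵥ deviation F ζ ψ x) =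
        ∑ j, toα (C i) j • a x j + ∑ j, toβ (C i) j • c x j - (C i ⬝ᵥ z) * ψ x := by
      have h4 : cx T *ᵥ deviation F ζ ψ x =
          (fun r => Sum.elim (fun j => (1 / (Real.sqrt 2 : ℂ)) • (a x j + c x j))
            (fun j => (1 / (Complex.I * (Real.sqrt 2 : ℂ))) • (a x j - c x j)) r) -
              ψ x • z := by
        rw [hZ]
        funext r
        rcases r with (j | j) | (j | j) <;>
          simp only [Function.comp_apply, Pi.sub_apply, Pi.smul_apply, smul_eq_mul, mul_comm (ψ x)]
            <;> rfl
      rw [h4, ← h2, dotProduct_sub, dotProduct_smul, smul_eq_mul, mul_comm (ψ x), dotProduct,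
        Fintype.sum_sum_type]
      rfl
    change C i ⬝ᵥ _ = 0 at h1
    rw [h3] at h1
    simp only [hα, smul_eq_mul, ite_mul, one_mul, zero_mul, Finset.sum_ite_eq, Finset.mem_univ,
      if_true] at h1
    simp only [neg_mul, Finset.sum_neg_distrib]
    linear_combination h1
  obtain ⟨K, r, hr0, hr1, hK⟩ := expDecay_of_annihilation
    (ψ := fun k : Fin NA ⊕ Fin NB → ℕ => ψ (k ∘ Sum.inl, k ∘ Sum.inr))
    (S := Matrix.of fun i j => -toβ (C i) j) (u := fun i => C i ⬝ᵥ z) hσ0 hσ1 hσ (by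
      intro k i
      have h1 : ∀ j, a (k ∘ Sum.inl, k ∘ Sum.inr) j = (Real.sqrt ((k j : ℝ) + 1) : ℂ) *
          ψ (Function.update k j (k j + 1) ∘ Sum.inl, Function.update k j (k j + 1) ∘ Sum.inr) := by
        rintro (j | j)
        · rw [Sum.update_inl_comp_inl, Sum.update_inl_comp_inr]
          rfl
        · rw [Sum.update_inr_comp_inl, Sum.update_inr_comp_inr]
          rfl
      have h2 : ∀ j, c (k ∘ Sum.inl, k ∘ Sum.inr) j = (Real.sqrt (k j : ℝ) : ℂ) *
          ψ (Function.update k j (k j - 1) ∘ Sum.inl, Function.update k j (k j - 1) ∘ Sum.inr) := by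
        rintro (j | j)
        · rw [Sum.update_inl_comp_inl, Sum.update_inl_comp_inr]
          rfl
        · rw [Sum.update_inr_comp_inl, Sum.update_inr_comp_inr]
          rfl
      have h3 := hann (k ∘ Sum.inl, k ∘ Sum.inr) i
      simp only [h1, h2] at h3
      exact h3)
  refine ⟨K, r, hr0, hr1, fun k l => ?_⟩
  have h := hK (Sum.elim k l)
  rw [Fintype.sum_sum_type, pow_add, ← mul_assoc] at h
  exact h

/-- The ladder operators of the normal modes of `G`. -/
def IsWilliamson.normalModes {n : ℕ} {G : Matrix (Fin n ⊕ Fin n) (Fin n ⊕ Fin n) ℝ}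
    {h : Matrix (Fin n) (Fin n ⊕ Fin n) ℂ} {ν : Fin n → ℝ} (H : IsWilliamson G h ν)
    (z : Fin n ⊕ Fin n → ℂ) : NormalModes n where
  α := Matrix.of fun i => toα (h i)
  β := Matrix.of fun i => toβ (h i)
  w i := -(h i ⬝ᵥ z)
  ccr := by
    rw [← H.ccr]
    ext i j
    have e := sum_toα_mul_toβ_sub (h i) (star (h j))
    rw [Matrix.mul_assoc]
    refine Eq.trans ?_ e
    simp only [Matrix.sub_apply, Matrix.mul_apply, Matrix.conjTranspose_apply, Matrix.of_apply,
      ← Finset.sum_sub_distrib, ← conj_toα, ← conj_toβ]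
    rfl
  comm := by
    rw [← sub_eq_zero, ← H.comm]
    ext i j
    have e := sum_toα_mul_toβ_sub (h i) (h j)
    rw [Matrix.mul_assoc]
    refine Eq.trans ?_ e
    simp only [Matrix.sub_apply, Matrix.mul_apply, Matrix.transpose_apply, Matrix.of_apply,
      ← Finset.sum_sub_distrib]

theorem reducedDensity_ne_zero {ψ : BipartiteFockSpace NA NB} (hψ : ‖ψ‖ = 1) :
    reducedDensity ψ ≠ 0 := by
  intro h
  have h0 : HasTrace (reducedDensity ψ) 0 := by
    rw [h]
    intro ι b
    simp [hasSum_zero]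
  have := h0.eq_norm_sq_of_reducedDensity
  simp [hψ] at this

/-- The reduced state is a product of thermal states of its normal modes. -/
theorem IsGaussianState.exists_isDiagonal (hΩ : IsSymplecticForm Ω)
    (hJ : IsCompatibleComplexStructure Ω J) {F : Subsystems NA NB Ω}
    {ψ : BipartiteFockSpace NA NB} (hψ : IsGaussianState F J ζ ψ)
    {h : Matrix (Fin NA) (Fin NA ⊕ Fin NA) ℂ} {ν : Fin NA → ℝ}
    (H : IsWilliamson (F.θA * metricG Ω J * F.θAᵀ) h ν) (hν : ∀ i, 1 ≤ ν i) :
    ∃ e : (Fin NA → ℕ) → FockSpace NA, IsDiagonal (reducedDensity ψ) e fun k =>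
      ∏ i, (1 - thermalRatio (ν i)) * thermalRatio (ν i) ^ k i := by
  have hE := hψ.bipartiteExpDecay hΩ hJ
  have hrow : ∀ i, h i ᵥ* (Complex.I • cx (restrictJ F J)) = (ν i : ℂ) • h i := by
    intro i
    have e := congrFun H.mul_eq i
    rw [F.restrict_mul_stdOmega hΩ] at e
    refine Eq.trans e ?_
    ext j
    simp [Matrix.diagonal_mul]
  have hrow' : ∀ i, star (h i) ᵥ* (Complex.I • cx (restrictJ F J)) =
      ((-ν i : ℝ) : ℂ) • star (h i) := by
    intro i
    have e := congrFun H.mul_eq_conj i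
    rw [F.restrict_mul_stdOmega hΩ] at e
    refine Eq.trans e ?_
    ext j
    simp [Matrix.diagonal_mul]
  have hpos : ∀ i, (0 : ℝ) < ν i + 1 := fun i => by linarith [hν i]
  have hratio : ∀ i, ((ν i + 1 : ℝ) : ℂ) * (thermalRatio (ν i) : ℂ) = ((ν i - 1 : ℝ) : ℂ) := by
    intro i
    rw [← Complex.ofReal_mul, thermalRatio, mul_div_cancel₀ _ (hpos i).ne']
  have hne : ∀ i, ((ν i + 1 : ℝ) : ℂ) ≠ 0 := fun i => Complex.ofReal_ne_zero.2 (hpos i).ne'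
  -- The creator is the observable of the conjugate row, whose eigenvalue is `-ν i`; the
  -- intertwining relation then has `ρ` and the creator in the opposite order.
  have hd : ∀ i, (H.normalModes (meanA F ζ)).d i = observable (star (h i)) (meanA F ζ) :=
    fun i => ladder_conj_observable (h i) (star_meanA F)
  obtain ⟨e, μ, hμ, hD⟩ := (H.normalModes (meanA F ζ)).exists_isDiagonal
    (isCompactOperator_reducedDensity ψ) (isPositive_reducedDensity ψ)
    (expDecay_reducedDensity hE) (l := fun i => thermalRatio (ν i))
    (fun i => thermalRatio_lt_one (hν i)) (fun i => thermalRatio_nonneg (hν i))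
    (fun i φ χ hφ hχ => by
      have e := hψ.observable_reducedDensity hE (hrow i) hφ hχ
      refine smul_right_injective _ (hne i) ?_
      change ((ν i + 1 : ℝ) : ℂ) • observable (h i) (meanA F ζ) (reducedDensity ψ φ) =
        ((ν i + 1 : ℝ) : ℂ) • _
      rw [smul_smul, hratio, add_comm, e])
    (fun i φ χ hφ hχ => by
      rw [hd] at hχ ⊢
      have e := hψ.observable_reducedDensity hE (hrow' i) hφ hχ
      refine smul_right_injective _ (hne i) ?_
      change ((ν i + 1 : ℝ) : ℂ) • _ = ((ν i + 1 : ℝ) : ℂ) • _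
      rw [smul_smul, hratio, ← neg_inj, ← neg_smul, ← neg_smul]
      have e1 : ((-ν i - 1 : ℝ) : ℂ) = -((ν i + 1 : ℝ) : ℂ) := by push_cast; ring
      have e2 : ((1 + -ν i : ℝ) : ℂ) = -((ν i - 1 : ℝ) : ℂ) := by push_cast; ring
      rw [e1, e2] at e
      exact e.symm)
    (reducedDensity_ne_zero hψ.1)
  refine ⟨e, ?_⟩
  have hl0 : ∀ i, 0 ≤ thermalRatio (ν i) := fun i => thermalRatio_nonneg (hν i)
  have hl1 : ∀ i, thermalRatio (ν i) < 1 := fun i => thermalRatio_lt_one (hν i)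
  have hsum := (hasSum_prod_pi (fun i k => pow_nonneg (hl0 i) k)
    (fun i => hasSum_geometric_of_lt_one (hl0 i) (hl1 i))).mul_left μ
  have htr := (hD.hasTrace (fun k => mul_nonneg hμ.le
    (Finset.prod_nonneg fun i _ => pow_nonneg (hl0 i) _)) hsum).eq_norm_sq_of_reducedDensity
  rw [hψ.1, one_pow] at htr
  -- The trace `μ ∏ (1 - λ i)⁻¹` equals `‖ψ‖² = 1`.
  have hμ' : μ = ∏ i, (1 - thermalRatio (ν i)) := by
    have := Complex.ofReal_injective htr
    rw [Finset.prod_inv_distrib] at this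
    exact (mul_inv_eq_one₀ (Finset.prod_ne_zero_iff.2 fun i _ => by linarith [hl1 i])).1 this
  simpa only [hμ', Finset.prod_mul_distrib] using hD

end Spectrum

/-! ### Traces of the thermal state and the corridor. -/

section Entropies

theorem sum_entropyFunction_sub_log_lt {n d : ℕ} {ν : Fin n → ℝ} (hν : ∀ i, 1 ≤ ν i)
    (hd : 0 < d) (hcard : Fintype.card {i // ν i ≠ 1} ≤ d) :
    ∑ i, (entropyFunction (ν i) - Real.log (ν i)) < (1 - Real.log 2) * d := by
  have h2 : 0 < 1 - Real.log 2 := by linarith [Real.log_two_lt_d9]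
  have hd' : (0 : ℝ) < d := Nat.cast_pos.2 hd
  rw [Fintype.card_subtype] at hcard
  rw [← Finset.sum_filter_of_ne (p := fun i => ν i ≠ 1) fun i _ h hi => h (by
    rw [hi, entropyFunction_one, Real.log_one, sub_zero])]
  -- Without entangled modes the sum is `0`, and strictness rests on `d > 0`; otherwise it comes
  -- from each single mode.
  rcases (Finset.univ.filter fun i => ν i ≠ 1).eq_empty_or_nonempty with h0 | h0
  · rw [h0, Finset.sum_empty]
    positivity
  · refine (Finset.sum_lt_sum_of_nonempty h0
      fun i _ => entropyFunction_sub_log_lt (hν i)).trans_le ?_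
    rw [Finset.sum_const, nsmul_eq_mul, mul_comm]
    gcongr

variable {NA NB : ℕ} {ψ : BipartiteFockSpace NA NB} {e : (Fin NA → ℕ) → FockSpace NA}
  {ν : Fin NA → ℝ}

theorem hasTrace_reducedDensity_sq (hν : ∀ i, 1 ≤ ν i)
    (hD : IsDiagonal (reducedDensity ψ) e fun k =>
      ∏ i, (1 - thermalRatio (ν i)) * thermalRatio (ν i) ^ k i) :
    HasTrace (reducedDensity ψ ^ 2) ((∏ i, (ν i)⁻¹ : ℝ) : ℂ) := by
  have h := hasSum_prod_pi
    (fun i k => sq_nonneg ((1 - thermalRatio (ν i)) * thermalRatio (ν i) ^ k))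
    fun i => hasSum_thermal_sq (hν i)
  have h2 := hD.sq
  simp only [Finset.prod_pow] at h
  exact h2.hasTrace (fun k => sq_nonneg _) h

theorem hasTrace_entropyOperator (hν : ∀ i, 1 ≤ ν i)
    (hD : IsDiagonal (reducedDensity ψ) e fun k =>
      ∏ i, (1 - thermalRatio (ν i)) * thermalRatio (ν i) ^ k i) :
    HasTrace (entropyOperator (reducedDensity ψ)) ((∑ i, entropyFunction (ν i) : ℝ) : ℂ) := by
  have h0 : ∀ i k, 0 ≤ (1 - thermalRatio (ν i)) * thermalRatio (ν i) ^ k := fun i k =>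
    mul_nonneg (sub_nonneg.2 (thermalRatio_lt_one (hν i)).le)
      (pow_nonneg (thermalRatio_nonneg (hν i)) k)
  have h1 := fun i => hasSum_thermal (hν i)
  have h2 := hasSum_negMulLog_prod_pi h0 h1 fun i => hasSum_negMulLog_thermal (hν i)
  have h3 := hD.cfc (isPositive_reducedDensity ψ).isSelfAdjoint Real.continuous_negMulLog
    Real.negMulLog_zero
  exact h3.hasTrace (fun k => Real.negMulLog_nonneg (Finset.prod_nonneg fun i _ => h0 i _)
    (Finset.prod_le_one (fun i _ => h0 i _) fun i _ =>
      le_hasSum (h1 i) (k i) fun j _ => h0 i j)) h2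

end Entropies

end GaussianEntropy

end

theorem mainTheorem6 :
    (∀ ν : ℝ, 1 ≤ ν →
      0 ≤ GaussianEntropy.entropyFunction ν - Real.log ν ∧
        GaussianEntropy.entropyFunction ν - Real.log ν < 1 - Real.log 2) ∧
    (∀ (NA NB : ℕ) (Ω : Matrix (Fin (2 * (NA + NB))) (Fin (2 * (NA + NB))) ℝ)
      (_hΩ : GaussianEntropy.IsSymplecticForm Ω)
      (F : GaussianEntropy.Subsystems NA NB Ω)
      (J : Matrix (Fin (2 * (NA + NB))) (Fin (2 * (NA + NB))) ℝ)
      (_hJ : GaussianEntropy.IsCompatibleComplexStructure Ω J)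
      (ζ : Fin (2 * (NA + NB)) → ℝ)
      (ψ : GaussianEntropy.BipartiteFockSpace NA NB)
      (_hψ : GaussianEntropy.IsGaussianState F J ζ ψ),
      -- the traces and the volume in the entropies are well defined
      (∃ s : ℝ, GaussianEntropy.HasTrace
        (GaussianEntropy.entropyOperator (GaussianEntropy.reducedDensity ψ)) (s : ℂ)) ∧
      (∃ t : ℝ, 0 < t ∧ GaussianEntropy.HasTrace (GaussianEntropy.reducedDensity ψ ^ 2) (t : ℂ)) ∧
      0 < GaussianEntropy.cubeVolume F (GaussianEntropy.metricG Ω J) ∧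
      -- the corridor for the entanglement entropy
      GaussianEntropy.renyiEntropy ψ ≤ GaussianEntropy.entanglementEntropy ψ ∧
      (0 < NA → 0 < NB →
        GaussianEntropy.entanglementEntropy ψ <
          GaussianEntropy.renyiEntropy ψ + (1 - Real.log 2) * (min NA NB : ℕ)) ∧
      -- the Rényi entropy as a phase space volume and as a determinant
      GaussianEntropy.renyiEntropy ψ =
        Real.log (GaussianEntropy.cubeVolume F (GaussianEntropy.metricG Ω J)) ∧
      GaussianEntropy.renyiEntropy ψ =
        1 / 2 * Real.log ‖(GaussianEntropy.restrictIJ F J).det‖) := by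
  refine ⟨fun ν hν => ⟨sub_nonneg.2 (GaussianEntropy.log_le_entropyFunction hν),
    GaussianEntropy.entropyFunction_sub_log_lt hν⟩, fun NA NB Ω hΩ F J hJ ζ ψ hψ => ?_⟩
  obtain ⟨h, ν, H, hν, hcard, hvol, hdet⟩ := F.exists_symplectic_spectrum hΩ hJ
  obtain ⟨e, hD⟩ := hψ.exists_isDiagonal hΩ hJ H hν
  have hS := GaussianEntropy.hasTrace_entropyOperator hν hD
  have hR := GaussianEntropy.hasTrace_reducedDensity_sq hν hD
  have hν0 : ∀ i, 0 < ν i := fun i => one_pos.trans_le (hν i)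
  have hprod : 0 < ∏ i, ν i := Finset.prod_pos fun i _ => hν0 i
  have hlog : Real.log (∏ i, ν i) = ∑ i, Real.log (ν i) :=
    Real.log_prod fun i _ => (hν0 i).ne'
  have hS' : GaussianEntropy.entanglementEntropy ψ =
      ∑ i, GaussianEntropy.entropyFunction (ν i) := by
    rw [GaussianEntropy.entanglementEntropy, hS.opTrace_eq, Complex.ofReal_re]
  have hR' : GaussianEntropy.renyiEntropy ψ = Real.log (∏ i, ν i) := by
    rw [GaussianEntropy.renyiEntropy, GaussianEntropy.renyiEntropyOfOrder, hR.opTrace_eq,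
      Complex.ofReal_re, Finset.prod_inv_distrib, Real.log_inv]
    norm_num
  refine ⟨⟨_, hS⟩, ⟨_, Finset.prod_pos fun i _ => inv_pos.2 (hν0 i), hR⟩, hvol ▸ hprod, ?_, ?_,
    ?_, ?_⟩
  · rw [hS', hR', hlog]
    exact Finset.sum_le_sum fun i _ => GaussianEntropy.log_le_entropyFunction (hν i)
  · intro hA hB
    have h1 := GaussianEntropy.sum_entropyFunction_sub_log_lt hν (lt_min hA hB) hcard
    rw [Finset.sum_sub_distrib] at h1
    rw [hS', hR', hlog]
    linarith
  · rw [hR', hvol]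
  · rw [hR', hdet, Real.log_pow]
    push_cast
    ring
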